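/- Let $-\infty<a<b<\infty$, $\Omega=(a,b)$, $\tfrac12<\alpha<1$ and $\lambda\in\{0,1\}$. For $\varphi\in C_0^\infty(\Omega)$, extended by zero to $\mathbb R$, let $${}^{-}D^\alpha\varphi(x)=\frac{1}{\Gamma(1-\alpha)}\frac{d}{dx}\int_{-\infty}^x (x-y)^{-\alpha}\varphi(y)\,dy,\qquad {}^{+}D^\alpha\varphi(x)=-\frac{1}{\Gamma(1-\alpha)}\frac{d}{dx}\int_x^{\infty}(y-x)^{-\alpha}\varphi(y)\,dy .$$ For $u\in L^1(\Omega)$, functions ${}^{\pm}\mathcal D^\alpha u\in L^1_{loc}(\Omega)$ are called the left ($-$) and right ($+$) weak fractional derivatives of $u$ if $\int_\Omega {}^{\pm}\mathcal D^\alpha u\,\varphi\,dx=\int_\Omega u\,{}^{\mp}D^\alpha\varphi\,dx$ for all $\varphi\in C_0^\infty(\Omega)$, and ${}^z\mathcal D^\alpha u:=\tfrac12({}^{-}\mathcal D^\alpha u+{}^{+}\mathcal D^\alpha u)$ is the Riesz weak fractional derivative. Let ${}^zH^\alpha(\Omega)=\{u\in L^2(\Omega): {}^z\mathcal D^\alpha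 u\in L^2(\Omega)\}$, and let ${}^zH^\alpha_0(\Omega)$ be the subspace of those $u\in{}^zH^\alpha(\Omega)$ whose traces at both end points exist and vanish: $u$ has a representative that is continuous on $(a,b]$ and zero at $b$, and one that is continuous on $[a,b)$ and zero at $a$. Equip ${}^zH^\alpha_0(\Omega)$ with the norm $\|v\|_\lambda:=\big(\|{}^z\mathcal D^\alpha v\|_{L^2(\Omega)}^2+\lambda\|v\|_{L^2(\Omega)}^2\big)^{1/2}$, that is, with the full norm of ${}^zH^\alpha(\Omega)$ for $\lambda=1$ and with $\|{}^z\mathcal D^\alpha v\|_{L^2(\Omega)}$ for $\lambda=0$. Then for every linear functional $f$ on ${}^zH^\alpha_0(\Omega)$ that is bounded with respect to $\|\cdot\|_\lambda$, the Riesz Dirichlet energy $$\mathcal E^\alpha_{z,\lambda}(v)=\frac12\int_\Omega \big(|{}^z\mathcal D^\alpha v|^2+\lambda|v|^2\big)\,dx-\langle f,v\rangle$$ has a unique minimizer $u$ over ${}^zH^\alpha_0(\Omega)$. -/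

import Mathlib

open MeasureTheory Set
open scoped ContDiff

noncomputable section

namespace RieszFrac

/-! ### Classical Riemann–Liouville derivatives of order `0 < α < 1` on the real line -/

/-- Left Riemann–Liouville fractional integral of order `σ > 0` on `ℝ`. -/
def leftIntegral (σ : ℝ) (φ : ℝ → ℝ) (x : ℝ) : ℝ :=
  (Real.Gamma σ)⁻¹ * ∫ y in Iio x, (x - y) ^ (σ - 1) * φ y

/-- Right Riemann–Liouville fractional integral of order `σ > 0` on `ℝ`. -/
def rightIntegral (σ : ℝ) (φ : ℝ → ℝ) (x : ℝ) : ℝ :=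
  (Real.Gamma σ)⁻¹ * ∫ y in Ioi x, (y - x) ^ (σ - 1) * φ y

/-- Left Riemann–Liouville derivative of order `α ∈ (0, 1)`. -/
def leftDeriv (α : ℝ) (φ : ℝ → ℝ) (x : ℝ) : ℝ := deriv (leftIntegral (1 - α) φ) x

/-- Right Riemann–Liouville derivative of order `α ∈ (0, 1)`. -/
def rightDeriv (α : ℝ) (φ : ℝ → ℝ) (x : ℝ) : ℝ := -deriv (rightIntegral (1 - α) φ) x

/-- Zero extensions to `ℝ` of the functions in `C₀^∞((a, b))`. -/
structure IsTest (a b : ℝ) (φ : ℝ → ℝ) : Prop where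
  contDiff : ContDiff ℝ ∞ φ
  hasCompactSupport : HasCompactSupport φ
  tsupport_subset : tsupport φ ⊆ Ioo a b

/-- Lebesgue measure on the interval `Ω = (a, b)`. -/
abbrev vol (a b : ℝ) : Measure ℝ := volume.restrict (Ioo a b)

/-! ### Weak fractional derivatives on `(a, b)`, `0 < α < 1` -/

/-- `v` is the left weak fractional derivative of order `α` of `u` on `(a, b)`. -/
structure IsWeakLeftDeriv (α a b : ℝ) (u v : ℝ → ℝ) : Prop where
  integrable : Integrable u (vol a b)
  locallyIntegrable : LocallyIntegrableOn v (Ioo a b)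
  integral_eq : ∀ φ : ℝ → ℝ, IsTest a b φ →
    ∫ x in Ioo a b, v x * φ x = ∫ x in Ioo a b, u x * rightDeriv α φ x

/-- `w` is the right weak fractional derivative of order `α` of `u` on `(a, b)`. -/
structure IsWeakRightDeriv (α a b : ℝ) (u w : ℝ → ℝ) : Prop where
  integrable : Integrable u (vol a b)
  locallyIntegrable : LocallyIntegrableOn w (Ioo a b)
  integral_eq : ∀ φ : ℝ → ℝ, IsTest a b φ →
    ∫ x in Ioo a b, w x * φ x = ∫ x in Ioo a b, u x * leftDeriv α φ x

/-- `g` is the Riesz weak fractional derivative of order `α` of `u` on `(a, b)`: the average of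
the left and the right weak fractional derivatives. -/
def IsRieszDeriv (α a b : ℝ) (u g : ℝ → ℝ) : Prop :=
  ∃ v w : ℝ → ℝ, IsWeakLeftDeriv α a b u v ∧ IsWeakRightDeriv α a b u w ∧
    g =ᵐ[vol a b] fun x => (v x + w x) / 2

open Classical in
/-- The Riesz weak fractional derivative of `u` (a representative of it, unique up to null sets by
`IsRieszDeriv.ae_eq`), and `0` if `u` does not have one. -/
def rieszDeriv (α a b : ℝ) (u : ℝ → ℝ) : ℝ → ℝ :=
  if h : ∃ g, IsRieszDeriv α a b u g then h.choose else 0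

/-- `u` has the trace `t` at the end point `c` of `(a, b)`: a representative of `u` is continuous
on `(a, b) ∪ {c}` and takes the value `t` at `c`. -/
def HasTrace (a b : ℝ) (u : ℝ → ℝ) (c t : ℝ) : Prop :=
  ∃ U : ℝ → ℝ, ContinuousOn U (insert c (Ioo a b)) ∧ u =ᵐ[vol a b] U ∧ U c = t

/-! ### Basic facts: regularity on test functions, linearity, uniqueness -/

/-- The kernel of the left fractional integral of order `1 - α`. -/
def leftKernel (α : ℝ) : ℝ → ℝ := (Ioi (0 : ℝ)).indicator fun t => t ^ (-α)

lemma leftKernel_locallyIntegrable {α : ℝ} (h1 : α < 1) :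
    LocallyIntegrable (leftKernel α) volume := by
  rw [locallyIntegrable_iff]
  intro K hK
  obtain ⟨R, hR⟩ := hK.isBounded.subset_closedBall 0
  have h : IntervalIntegrable (fun t : ℝ => t ^ (-α)) volume 0 |R| :=
    intervalIntegral.intervalIntegrable_rpow' (by linarith)
  rw [intervalIntegrable_iff_integrableOn_Ioc_of_le (abs_nonneg _)] at h
  have h2 : IntegrableOn (leftKernel α) (Iic |R|) := by
    unfold leftKernel
    rw [IntegrableOn, integrable_indicator_iff measurableSet_Ioi, IntegrableOn,
      Measure.restrict_restrict measurableSet_Ioi]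
    simpa [Ioi_inter_Iic, IntegrableOn] using h
  refine h2.mono_set fun x hx => ?_
  have h3 := hR hx
  rw [Metric.mem_closedBall, dist_zero_right, Real.norm_eq_abs] at h3
  exact (le_abs_self x).trans (h3.trans (le_abs_self R))

lemma leftIntegral_eq_convolution (α : ℝ) (φ : ℝ → ℝ) :
    leftIntegral (1 - α) φ = fun x => (Real.Gamma (1 - α))⁻¹ *
      (convolution (leftKernel α) φ (ContinuousLinearMap.mul ℝ ℝ) volume) x := by
  funext x
  rw [leftIntegral, convolution_eq_swap]
  congr 1
  rw [← integral_indicator measurableSet_Iio]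
  congr 1
  funext y
  by_cases hy : y < x
  · have : 0 < x - y := sub_pos.mpr hy
    simp [leftKernel, hy, show 1 - α - 1 = -α by ring]
  · simp [leftKernel, hy]

lemma rightIntegral_eq_leftIntegral (σ : ℝ) (φ : ℝ → ℝ) :
    rightIntegral σ φ = fun x => leftIntegral σ (fun y => φ (-y)) (-x) := by
  funext x
  rw [rightIntegral, leftIntegral]
  congr 1
  have h := integral_comp_neg_Iic (-x) (fun y => (y - x) ^ (σ - 1) * φ y)
  rw [neg_neg, integral_Iic_eq_integral_Iio] at h
  rw [← h]
  refine setIntegral_congr_fun measurableSet_Iio fun y _ => ?_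
  simp only [show -x - y = -y - x by ring]

lemma contDiff_leftIntegral {α : ℝ} (h1 : α < 1) {φ : ℝ → ℝ} (hφ : ContDiff ℝ ∞ φ)
    (hc : HasCompactSupport φ) : ContDiff ℝ ∞ (leftIntegral (1 - α) φ) := by
  rw [leftIntegral_eq_convolution]
  exact contDiff_const.mul
    (hc.contDiff_convolution_right _ (leftKernel_locallyIntegrable h1) hφ)

lemma contDiff_rightIntegral {α : ℝ} (h1 : α < 1) {φ : ℝ → ℝ} (hφ : ContDiff ℝ ∞ φ)
    (hc : HasCompactSupport φ) : ContDiff ℝ ∞ (rightIntegral (1 - α) φ) := by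
  rw [rightIntegral_eq_leftIntegral]
  exact (contDiff_leftIntegral h1 (hφ.comp contDiff_neg)
    (hc.comp_homeomorph (Homeomorph.neg ℝ))).comp contDiff_neg

lemma IsTest.continuous_leftDeriv {α a b : ℝ} (h1 : α < 1) {φ : ℝ → ℝ} (hφ : IsTest a b φ) :
    Continuous (leftDeriv α φ) :=
  (contDiff_leftIntegral h1 hφ.contDiff hφ.hasCompactSupport).continuous_deriv (by simp)

lemma IsTest.continuous_rightDeriv {α a b : ℝ} (h1 : α < 1) {φ : ℝ → ℝ} (hφ : IsTest a b φ) :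
    Continuous (rightDeriv α φ) :=
  ((contDiff_rightIntegral h1 hφ.contDiff hφ.hasCompactSupport).continuous_deriv (by simp)).neg

lemma integrable_mul_continuous {a b : ℝ} {u ψ : ℝ → ℝ} (hu : Integrable u (vol a b))
    (hψ : Continuous ψ) : Integrable (fun x => u x * ψ x) (vol a b) := by
  obtain ⟨C, hC⟩ := (isCompact_Icc (a := a) (b := b)).exists_bound_of_continuousOn hψ.continuousOn
  refine hu.mul_bdd (c := C) hψ.aestronglyMeasurable ?_
  filter_upwards [ae_restrict_mem measurableSet_Ioo] with x hx
  exact hC x (Ioo_subset_Icc_self hx)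

lemma integrable_mul_test {a b : ℝ} {v φ : ℝ → ℝ} (hv : LocallyIntegrableOn v (Ioo a b))
    (hφ : IsTest a b φ) : Integrable (fun x => v x * φ x) (vol a b) := by
  have hK : IsCompact (tsupport φ) := hφ.hasCompactSupport
  have h1 : IntegrableOn v (tsupport φ) := hv.integrableOn_compact_subset hφ.tsupport_subset hK
  have h2 : IntegrableOn (fun x => v x * φ x) (tsupport φ) :=
    h1.mul_continuousOn hφ.contDiff.continuous.continuousOn hK
  exact ((integrableOn_iff_integrable_of_support_subset
    ((Function.support_mul_subset_right v φ).trans (subset_tsupport φ))).mp h2).integrableOn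

lemma IsWeakLeftDeriv.add {α a b : ℝ} (h1 : α < 1) {u u' v v' : ℝ → ℝ}
    (h : IsWeakLeftDeriv α a b u v) (h' : IsWeakLeftDeriv α a b u' v') :
    IsWeakLeftDeriv α a b (u + u') (v + v') where
  integrable := h.integrable.add h'.integrable
  locallyIntegrable := h.locallyIntegrable.add h'.locallyIntegrable
  integral_eq φ hφ := by
    simp only [Pi.add_apply, add_mul]
    rw [integral_add (integrable_mul_test h.locallyIntegrable hφ)
        (integrable_mul_test h'.locallyIntegrable hφ),
      integral_add (integrable_mul_continuous h.integrable (hφ.continuous_rightDeriv h1))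
        (integrable_mul_continuous h'.integrable (hφ.continuous_rightDeriv h1)),
      h.integral_eq φ hφ, h'.integral_eq φ hφ]

lemma IsWeakRightDeriv.add {α a b : ℝ} (h1 : α < 1) {u u' w w' : ℝ → ℝ}
    (h : IsWeakRightDeriv α a b u w) (h' : IsWeakRightDeriv α a b u' w') :
    IsWeakRightDeriv α a b (u + u') (w + w') where
  integrable := h.integrable.add h'.integrable
  locallyIntegrable := h.locallyIntegrable.add h'.locallyIntegrable
  integral_eq φ hφ := by
    simp only [Pi.add_apply, add_mul]
    rw [integral_add (integrable_mul_test h.locallyIntegrable hφ)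
        (integrable_mul_test h'.locallyIntegrable hφ),
      integral_add (integrable_mul_continuous h.integrable (hφ.continuous_leftDeriv h1))
        (integrable_mul_continuous h'.integrable (hφ.continuous_leftDeriv h1)),
      h.integral_eq φ hφ, h'.integral_eq φ hφ]

lemma IsWeakLeftDeriv.smul {α a b : ℝ} (c : ℝ) {u v : ℝ → ℝ} (h : IsWeakLeftDeriv α a b u v) :
    IsWeakLeftDeriv α a b (c • u) (c • v) where
  integrable := h.integrable.smul c
  locallyIntegrable := h.locallyIntegrable.smul c
  integral_eq φ hφ := by
    simp only [Pi.smul_apply, smul_eq_mul, mul_assoc, integral_const_mul, h.integral_eq φ hφ]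

lemma IsWeakRightDeriv.smul {α a b : ℝ} (c : ℝ) {u w : ℝ → ℝ}
    (h : IsWeakRightDeriv α a b u w) : IsWeakRightDeriv α a b (c • u) (c • w) where
  integrable := h.integrable.smul c
  locallyIntegrable := h.locallyIntegrable.smul c
  integral_eq φ hφ := by
    simp only [Pi.smul_apply, smul_eq_mul, mul_assoc, integral_const_mul, h.integral_eq φ hφ]

lemma IsRieszDeriv.add {α a b : ℝ} (h1 : α < 1) {u u' g g' : ℝ → ℝ}
    (h : IsRieszDeriv α a b u g) (h' : IsRieszDeriv α a b u' g') :
    IsRieszDeriv α a b (u + u') (g + g') := by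
  obtain ⟨v, w, hv, hw, hg⟩ := h
  obtain ⟨v', w', hv', hw', hg'⟩ := h'
  refine ⟨v + v', w + w', hv.add h1 hv', hw.add h1 hw', ?_⟩
  filter_upwards [hg, hg'] with x hx hx'
  simp only [Pi.add_apply, hx, hx']
  ring

lemma IsRieszDeriv.smul {α a b : ℝ} (c : ℝ) {u g : ℝ → ℝ} (h : IsRieszDeriv α a b u g) :
    IsRieszDeriv α a b (c • u) (c • g) := by
  obtain ⟨v, w, hv, hw, hg⟩ := h
  refine ⟨c • v, c • w, hv.smul c, hw.smul c, ?_⟩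
  filter_upwards [hg] with x hx
  simp only [Pi.smul_apply, smul_eq_mul, hx]
  ring

lemma IsRieszDeriv.congr {α a b : ℝ} {u u' g : ℝ → ℝ} (h : IsRieszDeriv α a b u g)
    (huu' : u =ᵐ[vol a b] u') : IsRieszDeriv α a b u' g := by
  have key : ∀ ψ : ℝ → ℝ, ∫ x in Ioo a b, u x * ψ x = ∫ x in Ioo a b, u' x * ψ x := fun ψ =>
    integral_congr_ae (huu'.mono fun x hx => by simp only [hx])
  obtain ⟨v, w, hv, hw, hg⟩ := h
  exact ⟨v, w,
    ⟨hv.integrable.congr huu', hv.locallyIntegrable,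
      fun φ hφ => (hv.integral_eq φ hφ).trans (key _)⟩,
    ⟨hw.integrable.congr huu', hw.locallyIntegrable,
      fun φ hφ => (hw.integral_eq φ hφ).trans (key _)⟩, hg⟩

lemma ae_eq_of_integral_test {a b : ℝ} {v v' : ℝ → ℝ} (hv : LocallyIntegrableOn v (Ioo a b))
    (hv' : LocallyIntegrableOn v' (Ioo a b))
    (h : ∀ φ, IsTest a b φ → ∫ x in Ioo a b, v x * φ x = ∫ x in Ioo a b, v' x * φ x) :
    v =ᵐ[vol a b] v' := by
  have h0 := isOpen_Ioo.ae_eq_zero_of_integral_contDiff_smul_eq_zero (μ := volume)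
    (hv.sub hv') (fun φ hφ hc hs => by
      have ht : IsTest a b φ := ⟨hφ, hc, hs⟩
      have e : ∫ x, φ x • (v - v') x = ∫ x in Ioo a b, φ x • (v - v') x := by
        refine (setIntegral_eq_integral_of_forall_compl_eq_zero fun x hx => ?_).symm
        have : φ x = 0 := by
          by_contra h0
          exact hx (hs (subset_tsupport φ h0))
        simp [this]
      rw [e]
      have e2 : ∀ x, φ x • (v - v') x = v x * φ x - v' x * φ x := fun x => by
        simp only [Pi.sub_apply, smul_eq_mul]
        ring
      simp only [e2]
      rw [integral_sub (integrable_mul_test hv ht) (integrable_mul_test hv' ht), h φ ht, sub_self])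
  rw [Filter.EventuallyEq, ae_restrict_iff' measurableSet_Ioo]
  filter_upwards [h0] with x hx hxm
  exact sub_eq_zero.mp (hx hxm)

/-- The Riesz weak fractional derivative is unique up to null sets. -/
lemma IsRieszDeriv.ae_eq {α a b : ℝ} {u g g' : ℝ → ℝ} (h : IsRieszDeriv α a b u g)
    (h' : IsRieszDeriv α a b u g') : g =ᵐ[vol a b] g' := by
  obtain ⟨v, w, hv, hw, hg⟩ := h
  obtain ⟨v', w', hv', hw', hg'⟩ := h'
  have e1 := ae_eq_of_integral_test hv.locallyIntegrable hv'.locallyIntegrable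
    fun φ hφ => (hv.integral_eq φ hφ).trans (hv'.integral_eq φ hφ).symm
  have e2 := ae_eq_of_integral_test hw.locallyIntegrable hw'.locallyIntegrable
    fun φ hφ => (hw.integral_eq φ hφ).trans (hw'.integral_eq φ hφ).symm
  filter_upwards [hg, hg', e1, e2] with x a1 a2 a3 a4
  rw [a1, a2, a3, a4]

lemma isRieszDeriv_zero (α a b : ℝ) : IsRieszDeriv α a b 0 0 :=
  ⟨0, 0, ⟨integrable_zero _ _ _, locallyIntegrable_zero.locallyIntegrableOn _, by simp⟩,
    ⟨integrable_zero _ _ _, locallyIntegrable_zero.locallyIntegrableOn _, by simp⟩, by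
      filter_upwards with x
      simp⟩

lemma isRieszDeriv_rieszDeriv {α a b : ℝ} {u g : ℝ → ℝ} (h : IsRieszDeriv α a b u g) :
    IsRieszDeriv α a b u (rieszDeriv α a b u) := by
  have hex : ∃ g, IsRieszDeriv α a b u g := ⟨g, h⟩
  rw [rieszDeriv, dif_pos hex]
  exact hex.choose_spec

/-! ### Riesz fractional Sobolev spaces and the Riesz–Dirichlet energy -/

/-- The Riesz fractional Sobolev space of order `α` (with `p = 2`): the functions in `L²((a, b))`
that have a Riesz weak fractional derivative in `L²((a, b))`. -/
def rieszH (α a b : ℝ) (h1 : α < 1) : Submodule ℝ (Lp ℝ 2 (vol a b)) where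
  carrier := {u | ∃ g, IsRieszDeriv α a b u g ∧ MemLp g 2 (vol a b)}
  add_mem' := by
    rintro u u' ⟨g, hg, hgm⟩ ⟨g', hg', hgm'⟩
    exact ⟨g + g', (hg.add h1 hg').congr (Lp.coeFn_add u u').symm, hgm.add hgm'⟩
  zero_mem' := ⟨0, (isRieszDeriv_zero α a b).congr (Lp.coeFn_zero ℝ 2 (vol a b)).symm,
    MemLp.zero⟩
  smul_mem' := by
    rintro c u ⟨g, hg, hgm⟩
    exact ⟨c • g, (hg.smul c).congr (Lp.coeFn_smul c u).symm, hgm.const_smul c⟩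

/-- The functions in `L²((a, b))` whose trace at the end point `c` exists and is zero. -/
def zeroTrace (a b c : ℝ) : Submodule ℝ (Lp ℝ 2 (vol a b)) where
  carrier := {u | HasTrace a b u c 0}
  add_mem' := by
    rintro u u' ⟨U, hU, hu, h0⟩ ⟨U', hU', hu', h0'⟩
    exact ⟨U + U', hU.add hU', (Lp.coeFn_add u u').trans (hu.add hu'), by simp [h0, h0']⟩
  zero_mem' := ⟨0, continuousOn_const, Lp.coeFn_zero ℝ 2 (vol a b), rfl⟩
  smul_mem' := by
    rintro c u ⟨U, hU, hu, h0⟩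
    exact ⟨c • U, hU.const_smul c, (Lp.coeFn_smul c u).trans (hu.const_smul c), by simp [h0]⟩

/-- The zero-trace Riesz space: the elements of `rieszH` whose traces at `b` and at `a` vanish. -/
def rieszHZero (α a b : ℝ) (h1 : α < 1) : Submodule ℝ (Lp ℝ 2 (vol a b)) :=
  rieszH α a b h1 ⊓ zeroTrace a b b ⊓ zeroTrace a b a

/-- `∫ |ᶻ𝒟^α v|² + lam |v|²` over `(a, b)`. -/
def rieszQuad (α a b lam : ℝ) (v : ℝ → ℝ) : ℝ :=
  ∫ x in Ioo a b, (|rieszDeriv α a b v x| ^ 2 + lam * |v x| ^ 2)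

/-- The norm on the energy space: for `lam = 1` the norm
`(‖v‖² + ‖ᶻ𝒟^α v‖²)^(1/2)`, for `lam = 0` the norm `‖ᶻ𝒟^α v‖`. -/
def energyNorm (α a b lam : ℝ) (v : ℝ → ℝ) : ℝ := √(rieszQuad α a b lam v)

/-- `f` is an element of the dual of the energy space: a linear functional that is bounded with
respect to `energyNorm`. -/
def IsBoundedFunctional (α a b lam : ℝ) (h1 : α < 1) (f : rieszHZero α a b h1 →ₗ[ℝ] ℝ) : Prop :=
  ∃ C : ℝ, ∀ v : rieszHZero α a b h1, |f v| ≤ C * energyNorm α a b lam (v : Lp ℝ 2 (vol a b))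

/-- The Riesz–Dirichlet energy `½ ∫ (|ᶻ𝒟^α v|² + lam |v|²) - ⟨f, v⟩`. -/
def rieszEnergy (α a b lam : ℝ) (h1 : α < 1) (f : rieszHZero α a b h1 →ₗ[ℝ] ℝ)
    (v : rieszHZero α a b h1) : ℝ :=
  1 / 2 * rieszQuad α a b lam (v : Lp ℝ 2 (vol a b)) - f v

end RieszFrac

end

open MeasureTheory Set
open scoped ContDiff Polynomial

noncomputable section

namespace RieszFrac

/-! ### Potentials with the kernel `t₊ ^ (-α)` -/

/-! The Riesz derivative is a bijection from the zero-trace space onto `L²` whose inverse is bounded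
into `L²` (`bijective_rieszLin`, `exists_norm_le_norm_rieszLin`). Written in terms of `g = ᶻ𝒟^α v`,
the energy is a coercive quadratic functional on the Hilbert space `L²`, and Lax–Milgram together
with a completed square gives its unique minimizer (`existsUnique_minimizer`).

The bijection rests on two facts about test functions. Up to the factor `1 / (2 Γ(1 - α))` the Riesz
derivative of `φ` is `L φ' - R φ'`, with `L` and `R` the left and right potentials of kernel `t₊ ^
(-α)`.

A priori estimate (`exists_norm_le`): the `L²` norms of both one-sided derivatives and the sup norm
of `φ` are bounded by the norm of `L φ' - R φ'` on `(a, b)` alone. On all of `ℝ`, homogeneity makes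
`∫ (L f)²`, `∫ (R f)²` and `∫ L f R f` fixed multiples of one double integral, and positivity of the
fractional derivative makes `∫ (L f - R f)²` a strictly positive multiple of `∫ (L f)²` whenever the
latter is nonzero (`cLR_lt`). To discard the exterior of `(a, b)`, `φ` is multiplied by `b - y` or
by `a - y`: the commutator is of order zero, the exterior tail is controlled by a potential of
`|φ|`, and the difference of the two products is `(b - a) φ`
(`exists_integral_leftPot_deriv_sq_le`). The term of order zero is absorbed by positivity
(`exists_integral_sq_le`), and Abel inversion gives the sup norm since `t ^ (α - 1)` is locally
square integrable for `α > 1/2` (`exists_sq_le`).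

Density (`denseRange_rieszMap`): on `(-1, 1)` the potential `L - R` sends the derivative of `(1 -
y²) ^ (α/2) yⁿ` to a polynomial of degree exactly `n` (`exists_polynomial_pots`). These weights are
not test functions, but after shrinking, mollifying and passing to the limit, any `h ∈ L²`
orthogonal to the Riesz derivatives of all test functions is orthogonal to a polynomial of each
degree, hence to all polynomials, hence is zero.

Density gives injectivity by duality. Density and the estimate give surjectivity: if the Riesz
derivatives of `φₙ` tend to `g`, then `φₙ` converges uniformly to a continuous function vanishing
outside `(a, b)`, whose weak derivatives are the limits of the one-sided derivatives
(`exists_isRieszDeriv`). -/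

/-- The left potential of `f` with kernel `t₊ ^ (-α)`. -/
def leftPot (α : ℝ) (f : ℝ → ℝ) (x : ℝ) : ℝ := ∫ y, leftKernel α (x - y) * f y

/-- The right potential of `f` with kernel `t₊ ^ (-α)`. -/
def rightPot (α : ℝ) (f : ℝ → ℝ) (x : ℝ) : ℝ := ∫ y, leftKernel α (y - x) * f y

lemma leftKernel_of_pos (α : ℝ) {t : ℝ} (ht : 0 < t) : leftKernel α t = t ^ (-α) := by
  simp [leftKernel, ht]

lemma leftKernel_of_nonpos (α : ℝ) {t : ℝ} (ht : t ≤ 0) : leftKernel α t = 0 := by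
  simp [leftKernel, ht]

lemma leftKernel_nonneg (α t : ℝ) : 0 ≤ leftKernel α t := by
  rcases le_or_gt t 0 with h | h
  · rw [leftKernel_of_nonpos α h]
  · rw [leftKernel_of_pos α h]; positivity

lemma measurable_leftKernel (α : ℝ) : Measurable (leftKernel α) :=
  (measurable_id.pow_const _).indicator measurableSet_Ioi

lemma leftPot_eq_convolution (α : ℝ) (f : ℝ → ℝ) :
    leftPot α f = convolution (leftKernel α) f (ContinuousLinearMap.mul ℝ ℝ) volume := by
  funext x
  rw [convolution_eq_swap]
  rfl

lemma rightPot_eq_leftPot (α : ℝ) (f : ℝ → ℝ) (x : ℝ) :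
    rightPot α f x = leftPot α (fun y => f (-y)) (-x) := by
  rw [rightPot, leftPot, ← integral_neg_eq_self]
  refine integral_congr_ae (Filter.Eventually.of_forall fun y => ?_)
  simp only
  congr 2
  ring

lemma continuous_leftPot {α : ℝ} (h1 : α < 1) {f : ℝ → ℝ} (hf : Continuous f)
    (hc : HasCompactSupport f) : Continuous (leftPot α f) := by
  rw [leftPot_eq_convolution]
  exact hc.continuous_convolution_right _ (leftKernel_locallyIntegrable h1) hf

lemma continuous_rightPot {α : ℝ} (h1 : α < 1) {f : ℝ → ℝ} (hf : Continuous f)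
    (hc : HasCompactSupport f) : Continuous (rightPot α f) := by
  rw [funext (rightPot_eq_leftPot α f)]
  exact (continuous_leftPot h1 (hf.comp continuous_neg)
    (hc.comp_homeomorph (Homeomorph.neg ℝ))).comp continuous_neg

lemma hasDerivAt_leftPot {α : ℝ} (h1 : α < 1) {φ : ℝ → ℝ} (hφ : ContDiff ℝ 1 φ)
    (hc : HasCompactSupport φ) (x : ℝ) : HasDerivAt (leftPot α φ) (leftPot α (deriv φ) x) x := by
  rw [leftPot_eq_convolution, leftPot_eq_convolution]
  exact hc.hasDerivAt_convolution_right _ (leftKernel_locallyIntegrable h1) hφ x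

lemma hasDerivAt_rightPot {α : ℝ} (h1 : α < 1) {φ : ℝ → ℝ} (hφ : ContDiff ℝ 1 φ)
    (hc : HasCompactSupport φ) (x : ℝ) :
    HasDerivAt (rightPot α φ) (rightPot α (deriv φ) x) x := by
  have h := (hasDerivAt_leftPot h1 (hφ.comp contDiff_neg)
    (hc.comp_homeomorph (Homeomorph.neg ℝ)) (-x)).comp x (hasDerivAt_neg x)
  rw [funext (rightPot_eq_leftPot α φ), rightPot_eq_leftPot]
  refine HasDerivAt.congr_deriv (f := fun x => leftPot α (fun y => φ (-y)) (-x)) h ?_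
  simp only [leftPot]
  rw [← integral_mul_const]
  refine integral_congr_ae (Filter.Eventually.of_forall fun y => ?_)
  have : deriv (φ ∘ fun y => -y) y = - deriv φ (-y) := deriv_comp_neg φ y
  simp only [this]
  ring

lemma leftIntegral_eq_leftPot (α : ℝ) (φ : ℝ → ℝ) (x : ℝ) :
    leftIntegral (1 - α) φ x = (Real.Gamma (1 - α))⁻¹ * leftPot α φ x := by
  rw [leftIntegral_eq_convolution, leftPot_eq_convolution]

lemma leftDeriv_eq {α : ℝ} (h1 : α < 1) {φ : ℝ → ℝ} (hφ : ContDiff ℝ ∞ φ)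
    (hc : HasCompactSupport φ) (x : ℝ) :
    leftDeriv α φ x = (Real.Gamma (1 - α))⁻¹ * leftPot α (deriv φ) x := by
  rw [leftDeriv, funext (leftIntegral_eq_leftPot α φ)]
  exact ((hasDerivAt_leftPot h1 (hφ.of_le (by simp)) hc x).const_mul _).deriv

lemma rightIntegral_eq_rightPot (α : ℝ) (φ : ℝ → ℝ) (x : ℝ) :
    rightIntegral (1 - α) φ x = (Real.Gamma (1 - α))⁻¹ * rightPot α φ x := by
  simp only [rightIntegral_eq_leftIntegral, leftIntegral_eq_leftPot, rightPot_eq_leftPot]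

lemma rightDeriv_eq {α : ℝ} (h1 : α < 1) {φ : ℝ → ℝ} (hφ : ContDiff ℝ ∞ φ)
    (hc : HasCompactSupport φ) (x : ℝ) :
    rightDeriv α φ x = -((Real.Gamma (1 - α))⁻¹ * rightPot α (deriv φ) x) := by
  rw [rightDeriv, funext (rightIntegral_eq_rightPot α φ)]
  rw [((hasDerivAt_rightPot h1 (hφ.of_le (by simp)) hc x).const_mul _).deriv]

lemma rightDeriv_eq_leftDeriv (α : ℝ) (φ : ℝ → ℝ) (x : ℝ) :
    rightDeriv α φ x = leftDeriv α (fun y => φ (-y)) (-x) := by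
  rw [rightDeriv, leftDeriv, rightIntegral_eq_leftIntegral, deriv_comp_neg, neg_neg]

/-- Only differences of points of the two supports matter, so `κ` may be cut off to a ball; the rest
is a convolution integrand of integrable functions times a bounded factor. -/
lemma integrable_prod_kernel {κ f g : ℝ → ℝ} (hκ : LocallyIntegrable κ)
    (hf : Continuous f) (hfc : HasCompactSupport f) (hg : Continuous g)
    (hgc : HasCompactSupport g) :
    Integrable (fun p : ℝ × ℝ => f p.1 * g p.2 * κ (p.1 - p.2)) := by
  obtain ⟨r, hr⟩ := hfc.isCompact.isBounded.subset_closedBall 0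
  obtain ⟨r', hr'⟩ := hgc.isCompact.isBounded.subset_closedBall 0
  have hκ' : Integrable ((Metric.closedBall (0 : ℝ) (r + r')).indicator κ) :=
    (hκ.integrableOn_isCompact (isCompact_closedBall 0 (r + r'))).integrable_indicator
      measurableSet_closedBall
  have h1 := (hg.integrable_of_hasCompactSupport (μ := volume) hgc).convolution_integrand
    (ContinuousLinearMap.mul ℝ ℝ) hκ'
  obtain ⟨C, hC⟩ := hfc.exists_bound_of_continuous hf
  have h2 := h1.bdd_mul (c := C) (f := fun p : ℝ × ℝ => f p.1)
    (hf.comp continuous_fst).aestronglyMeasurable (Filter.Eventually.of_forall fun p => hC p.1)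
  refine h2.congr (Filter.Eventually.of_forall fun p => ?_)
  simp only [ContinuousLinearMap.mul_apply']
  by_cases h3 : f p.1 = 0
  · simp [h3]
  by_cases h4 : g p.2 = 0
  · simp [h4]
  have h5 : p.1 - p.2 ∈ Metric.closedBall (0 : ℝ) (r + r') := by
    have a1 := hr (subset_tsupport f h3)
    have a2 := hr' (subset_tsupport g h4)
    simp only [Metric.mem_closedBall, dist_zero_right, Real.norm_eq_abs] at a1 a2 ⊢
    exact (abs_sub _ _).trans (add_le_add a1 a2)
  rw [indicator_of_mem h5]
  ring

lemma integral_leftPot_mul {α : ℝ} (h1 : α < 1) {f g : ℝ → ℝ}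
    (hf : Continuous f) (hfc : HasCompactSupport f) (hg : Continuous g)
    (hgc : HasCompactSupport g) :
    ∫ x, leftPot α f x * g x = ∫ y, f y * rightPot α g y := by
  have h := integrable_prod_kernel (leftKernel_locallyIntegrable h1) hg hgc hf hfc
  calc ∫ x, leftPot α f x * g x
      = ∫ x, ∫ y, g x * f y * leftKernel α (x - y) := by
        congr 1 with x
        rw [leftPot, ← integral_mul_const]
        congr 1 with y
        ring
    _ = ∫ y, ∫ x, g x * f y * leftKernel α (x - y) := integral_integral_swap h
    _ = _ := by
        congr 1 with y
        rw [rightPot, ← integral_const_mul]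
        congr 1 with x
        ring

/-- Fractional integration by parts: Fubini transposes the kernel, and an ordinary integration by
parts then moves the derivative. It makes the classical derivatives of test functions weak
derivatives as well. -/
lemma integral_leftDeriv_mul {α : ℝ} (h1 : α < 1) {φ ψ : ℝ → ℝ} (hφ : ContDiff ℝ ∞ φ)
    (hφc : HasCompactSupport φ) (hψ : ContDiff ℝ ∞ ψ) (hψc : HasCompactSupport ψ) :
    ∫ x, leftDeriv α φ x * ψ x = ∫ x, φ x * rightDeriv α ψ x := by
  have hd : Continuous (deriv φ) := hφ.continuous_deriv (by simp)
  have hd' : Continuous (deriv ψ) := hψ.continuous_deriv (by simp)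
  simp only [leftDeriv_eq h1 hφ hφc, rightDeriv_eq h1 hψ hψc, mul_assoc, mul_neg, integral_neg,
    integral_const_mul, mul_left_comm (φ _)]
  rw [integral_leftPot_mul h1 hd hφc.deriv hψ.continuous hψc, ← mul_neg]
  congr 1
  have hc := continuous_rightPot h1 hψ.continuous hψc
  have hc' := continuous_rightPot h1 hd' hψc.deriv
  have := integral_mul_deriv_eq_deriv_mul_of_integrable (u := φ) (v := rightPot α ψ)
    (u' := deriv φ) (v' := rightPot α (deriv ψ))
    (fun x _ => (hφ.differentiable (by simp)).differentiableAt.hasDerivAt)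
    (fun x _ => hasDerivAt_rightPot h1 (hψ.of_le (by simp)) hψc x)
    ((hφ.continuous.mul hc').integrable_of_hasCompactSupport hφc.mul_right)
    ((hd.mul hc).integrable_of_hasCompactSupport hφc.deriv.mul_right)
    ((hφ.continuous.mul hc).integrable_of_hasCompactSupport hφc.mul_right)
  rw [this, neg_neg]

/-! ### The `L²` pairing of potentials -/

lemma ae_prod_ne : ∀ᵐ p : ℝ × ℝ, p.1 - p.2 ≠ 0 := by
  have h : MeasurableSet {p : ℝ × ℝ | p.1 - p.2 = 0} :=
    measurableSet_eq_fun (measurable_fst.sub measurable_snd) measurable_const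
  have : (volume : Measure (ℝ × ℝ)) {p : ℝ × ℝ | p.1 - p.2 = 0} = 0 := by
    rw [Measure.volume_eq_prod, Measure.measure_prod_null h]
    filter_upwards with x
    have : Prod.mk x ⁻¹' {p : ℝ × ℝ | p.1 - p.2 = 0} = {x} := by
      ext y
      simp [sub_eq_zero, eq_comm]
    rw [this]
    simp
  exact measure_eq_zero_iff_ae_notMem.mp this

/-- Fubini with the `x` integration done first leaves the correlation `κ` of the two kernels.
Because the kernels are nonnegative, absolute integrability of the triple integral reduces to local
integrability of `κ`. The value `d = 0` must be excluded, since `t ^ (-2 α)` is not integrable at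
`0`; it corresponds to the diagonal, a null set. -/
lemma integral_pairing {k₁ k₂ κ f g : ℝ → ℝ} (m₁ : Measurable k₁) (m₂ : Measurable k₂)
    (n₁ : ∀ t, 0 ≤ k₁ t) (n₂ : ∀ t, 0 ≤ k₂ t)
    (hint : ∀ d ≠ 0, Integrable fun t => k₁ t * k₂ (t + d))
    (hκ : ∀ d ≠ 0, ∫ t, k₁ t * k₂ (t + d) = κ d) (hκl : LocallyIntegrable κ)
    (hf : Continuous f) (hfc : HasCompactSupport f) (hg : Continuous g)
    (hgc : HasCompactSupport g) :
    Integrable (fun x => (∫ y, k₁ (x - y) * f y) * ∫ y, k₂ (x - y) * g y) ∧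
    ∫ x, (∫ y, k₁ (x - y) * f y) * ∫ y, k₂ (x - y) * g y =
      ∫ p : ℝ × ℝ, f p.1 * g p.2 * κ (p.1 - p.2) := by
  have e1 : ∀ p : ℝ × ℝ, (fun x => k₁ (x - p.1) * k₂ (x - p.2)) =
      fun x => (fun t => k₁ t * k₂ (t + (p.1 - p.2))) (x - p.1) := fun p => by
    funext x
    simp only [sub_add_sub_cancel]
  have hI : ∀ p : ℝ × ℝ, p.1 - p.2 ≠ 0 →
      Integrable fun x => k₁ (x - p.1) * k₂ (x - p.2) := fun p hp => by
    rw [e1 p]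
    exact (hint _ hp).comp_sub_right p.1
  have hE : ∀ p : ℝ × ℝ, p.1 - p.2 ≠ 0 →
      ∫ x, k₁ (x - p.1) * k₂ (x - p.2) = κ (p.1 - p.2) := fun p hp => by
    rw [e1 p]
    rw [integral_sub_right_eq_self (fun x => k₁ x * k₂ (x + (p.1 - p.2))), hκ _ hp]
  have hm : Measurable fun q : (ℝ × ℝ) × ℝ => k₁ (q.2 - q.1.1) * k₂ (q.2 - q.1.2) := by
    fun_prop
  have hΦ : Integrable (fun q : (ℝ × ℝ) × ℝ =>
      f q.1.1 * g q.1.2 * (k₁ (q.2 - q.1.1) * k₂ (q.2 - q.1.2)))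
      ((volume : Measure (ℝ × ℝ)).prod volume) := by
    rw [integrable_prod_iff]
    · refine ⟨?_, ?_⟩
      · filter_upwards [ae_prod_ne] with p hp
        exact (hI p hp).const_mul _
      · refine (integrable_prod_kernel hκl hf hfc hg hgc).norm.congr ?_
        filter_upwards [ae_prod_ne] with p hp
        have : ∀ x, ‖f p.1 * g p.2 * (k₁ (x - p.1) * k₂ (x - p.2))‖ =
            ‖f p.1 * g p.2‖ * (k₁ (x - p.1) * k₂ (x - p.2)) := fun x => by
          rw [norm_mul, Real.norm_of_nonneg (mul_nonneg (n₁ _) (n₂ _))]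
        simp only [this]
        rw [integral_const_mul, hE p hp, norm_mul, Real.norm_of_nonneg (r := κ _)]
        rw [← hE p hp]
        exact integral_nonneg fun x => mul_nonneg (n₁ _) (n₂ _)
    · have h2 : Measurable fun q : (ℝ × ℝ) × ℝ => f q.1.1 * g q.1.2 := by
        have := hf.measurable
        have := hg.measurable
        fun_prop
      exact (h2.mul hm).aestronglyMeasurable
  have hx : ∀ x, ∫ p : ℝ × ℝ, f p.1 * g p.2 * (k₁ (x - p.1) * k₂ (x - p.2)) =
      (∫ y, k₁ (x - y) * f y) * ∫ y, k₂ (x - y) * g y := fun x => by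
    rw [← integral_prod_mul, ← Measure.volume_eq_prod]
    congr 1 with p
    ring
  constructor
  · exact hΦ.integral_prod_right.congr (Filter.Eventually.of_forall hx)
  · rw [← integral_congr_ae (Filter.Eventually.of_forall hx), ← integral_prod_symm _ hΦ,
      integral_prod _ hΦ]
    refine integral_congr_ae ?_
    filter_upwards [ae_prod_ne] with p hp
    rw [integral_const_mul, hE p hp]

/-! ### Homogeneity of the kernels and the constants in the pairings. -/

lemma leftKernel_mul (α : ℝ) {c : ℝ} (hc : 0 < c) (t : ℝ) :
    leftKernel α (c * t) = c ^ (-α) * leftKernel α t := by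
  rcases le_or_gt t 0 with h | h
  · rw [leftKernel_of_nonpos α h, leftKernel_of_nonpos α (mul_nonpos_of_nonneg_of_nonpos hc.le h),
      mul_zero]
  · rw [leftKernel_of_pos α h, leftKernel_of_pos α (mul_pos hc h), Real.mul_rpow hc.le h.le]

lemma integrableOn_Ioc_rpow {σ : ℝ} (hσ : -1 < σ) (c : ℝ) :
    IntegrableOn (fun t : ℝ => t ^ σ) (Ioc 0 c) := by
  rcases le_or_gt 0 c with hc | hc
  · have h := intervalIntegral.intervalIntegrable_rpow' (a := 0) (b := c) hσ
    rwa [intervalIntegrable_iff_integrableOn_Ioc_of_le hc] at h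
  · rw [Ioc_eq_empty (not_lt.mpr hc.le)]
    exact integrableOn_empty

/-- Near `0` the product is at most `t ^ (-α)`, integrable for `α < 1`; at infinity it is at most `t
^ (-2 α)`, integrable for `α > 1/2`. -/
lemma integrable_leftKernel_mul_add_one {α : ℝ} (hα : 1 / 2 < α) (h1 : α < 1) :
    Integrable fun t => leftKernel α t * leftKernel α (t + 1) := by
  have hm : AEStronglyMeasurable (fun t => leftKernel α t * leftKernel α (t + 1)) volume :=
    ((measurable_leftKernel α).mul
      ((measurable_leftKernel α).comp (measurable_add_const 1))).aestronglyMeasurable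
  have h01 : IntegrableOn (fun t : ℝ => t ^ (-α)) (Ioc 0 1) :=
    integrableOn_Ioc_rpow (by linarith) 1
  have h2 : IntegrableOn (fun t : ℝ => t ^ (-(2 * α))) (Ioi 1) :=
    integrableOn_Ioi_rpow_of_lt (by linarith) one_pos
  have H := (h01.integrable_indicator measurableSet_Ioc).add
    (h2.integrable_indicator measurableSet_Ioi)
  refine H.mono' hm (Filter.Eventually.of_forall fun t => ?_)
  rw [Real.norm_of_nonneg (mul_nonneg (leftKernel_nonneg _ _) (leftKernel_nonneg _ _))]
  simp only [Pi.add_apply]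
  rcases le_or_gt t 0 with h | h
  · rw [leftKernel_of_nonpos α h, zero_mul, indicator_of_notMem (by simp [h]),
      indicator_of_notMem (by simp; linarith)]
    simp
  rw [leftKernel_of_pos α h, leftKernel_of_pos α (by linarith)]
  rcases le_or_gt t 1 with h' | h'
  · rw [indicator_of_mem (show t ∈ Ioc (0 : ℝ) 1 from ⟨h, h'⟩), indicator_of_notMem (by simp [h']), add_zero]
    refine mul_le_of_le_one_right (by positivity) ?_
    exact Real.rpow_le_one_of_one_le_of_nonpos (by linarith) (by linarith)
  · rw [indicator_of_notMem (by simp [h']), indicator_of_mem (by exact h'), zero_add,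
      show -(2 * α) = -α + -α by ring, Real.rpow_add h]
    gcongr ?_ * ?_
    exact Real.rpow_le_rpow_of_nonpos h (by linarith) (by linarith)

/-- On each half of `(0, 1)` only one of the two factors is singular; the other is bounded by its
value at `1/2`. -/
lemma integrable_leftKernel_mul_one_sub {α β : ℝ} (hα : 0 < α) (h1 : α < 1) (hβ : 0 < β)
    (hβ1 : β < 1) : Integrable fun t => leftKernel α t * leftKernel β (1 - t) := by
  have hm : AEStronglyMeasurable (fun t => leftKernel α t * leftKernel β (1 - t)) volume :=
    ((measurable_leftKernel α).mul
      ((measurable_leftKernel β).comp (measurable_const.sub measurable_id))).aestronglyMeasurable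
  have h2 : Integrable ((Ioc (0 : ℝ) 1).indicator fun t : ℝ => t ^ (-α)) :=
    (integrableOn_Ioc_rpow (by linarith) 1).integrable_indicator measurableSet_Ioc
  have h3 : Integrable ((Ioc (0 : ℝ) 1).indicator fun t : ℝ => t ^ (-β)) :=
    (integrableOn_Ioc_rpow (by linarith) 1).integrable_indicator measurableSet_Ioc
  have H := (h2.const_mul ((1 / 2 : ℝ) ^ (-β))).add
    ((h3.comp_sub_left 1).const_mul ((1 / 2 : ℝ) ^ (-α)))
  refine H.mono' hm (Filter.Eventually.of_forall fun t => ?_)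
  rw [Real.norm_of_nonneg (mul_nonneg (leftKernel_nonneg _ _) (leftKernel_nonneg _ _))]
  have hp : ∀ γ s : ℝ, 0 ≤ (Ioc (0 : ℝ) 1).indicator (fun t : ℝ => t ^ (-γ)) s := fun γ s =>
    indicator_nonneg (fun x hx => by have := hx.1; positivity) s
  simp only [Pi.add_apply]
  have q1 := hp α t
  have q2 := hp β (1 - t)
  rcases le_or_gt t 0 with h | h
  · rw [leftKernel_of_nonpos α h, zero_mul]
    positivity
  rcases le_or_gt 1 t with h' | h'
  · rw [leftKernel_of_nonpos β (sub_nonpos.mpr h'), mul_zero]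
    positivity
  rw [leftKernel_of_pos α h, leftKernel_of_pos β (sub_pos.mpr h'),
    indicator_of_mem (show t ∈ Ioc (0 : ℝ) 1 from ⟨h, h'.le⟩),
    indicator_of_mem (show 1 - t ∈ Ioc (0 : ℝ) 1 from ⟨by linarith, by linarith⟩)]
  have p1 : 0 < t ^ (-α) := by positivity
  have p2 : 0 < (1 - t) ^ (-β) := Real.rpow_pos_of_pos (sub_pos.mpr h') _
  have p3 : (0 : ℝ) < (1 / 2 : ℝ) ^ (-α) := by positivity
  have p4 : (0 : ℝ) < (1 / 2 : ℝ) ^ (-β) := by positivity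
  rcases le_or_gt t (1 / 2) with h3 | h3
  · have : (1 - t) ^ (-β) ≤ (1 / 2 : ℝ) ^ (-β) :=
      Real.rpow_le_rpow_of_nonpos (by norm_num) (by linarith) (by linarith)
    nlinarith
  · have : t ^ (-α) ≤ (1 / 2 : ℝ) ^ (-α) :=
      Real.rpow_le_rpow_of_nonpos (by norm_num) (by linarith) (by linarith)
    nlinarith

/-- The even kernel `|t| ^ (1 - 2 α)`. -/
def evenKernel (α t : ℝ) : ℝ := leftKernel (2 * α - 1) t + leftKernel (2 * α - 1) (-t)

lemma evenKernel_neg (α t : ℝ) : evenKernel α (-t) = evenKernel α t := by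
  rw [evenKernel, evenKernel, neg_neg, add_comm]

lemma evenKernel_nonneg (α t : ℝ) : 0 ≤ evenKernel α t :=
  add_nonneg (leftKernel_nonneg _ _) (leftKernel_nonneg _ _)

lemma locallyIntegrable_leftKernel_neg {α : ℝ} (h1 : α < 1) :
    LocallyIntegrable (fun t => leftKernel α (-t)) volume := by
  rw [locallyIntegrable_iff]
  intro K hK
  have h := (leftKernel_locallyIntegrable h1).integrableOn_isCompact
    (hK.image continuous_neg)
  have := (Measure.measurePreserving_neg (volume : Measure ℝ)).integrableOn_comp_preimage
    (Homeomorph.neg ℝ).measurableEmbedding (f := leftKernel α) (s := (fun x => -x) '' K)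
  refine (this.mpr h).mono_set ?_
  intro x hx
  exact ⟨x, hx, rfl⟩

lemma locallyIntegrable_evenKernel {α : ℝ} (h1 : α < 1) :
    LocallyIntegrable (evenKernel α) volume :=
  (leftKernel_locallyIntegrable (by linarith)).add
    (locallyIntegrable_leftKernel_neg (by linarith))

/-- The constant `∫ t₊^(-α) (t + 1)₊^(-α)`. -/
def cLL (α : ℝ) : ℝ := ∫ t, leftKernel α t * leftKernel α (t + 1)

/-- The constant `∫ t₊^(-α) (1 - t)₊^(-α)`. -/
def cLR (α : ℝ) : ℝ := ∫ t, leftKernel α t * leftKernel α (1 - t)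

lemma cLL_nonneg (α : ℝ) : 0 ≤ cLL α :=
  integral_nonneg fun _ => mul_nonneg (leftKernel_nonneg _ _) (leftKernel_nonneg _ _)

/-- The substitution `t ↦ d t` reduces every `d > 0` to `d = 1` and produces the power `d ^ (1 - α -
β)`. The family `k` covers both `t + d` and `d - t`. -/
lemma scaled_pairing {α β : ℝ} {k : ℝ → ℝ → ℝ} {d : ℝ} (hd : 0 < d)
    (hk : ∀ t, k d (d * t) = d ^ (-β) * k 1 t)
    (hi : Integrable fun t => leftKernel α t * k 1 t) :
    (Integrable fun t => leftKernel α t * k d t) ∧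
    ∫ t, leftKernel α t * k d t =
      (∫ t, leftKernel α t * k 1 t) * leftKernel (α + β - 1) d := by
  have e : ∀ t, leftKernel α (d * t) * k d (d * t) =
      d ^ (-(α + β)) * (leftKernel α t * k 1 t) := fun t => by
    rw [leftKernel_mul α hd, hk, show -(α + β) = -α + -β by ring, Real.rpow_add hd]
    ring
  constructor
  · rw [← integrable_comp_mul_left_iff _ hd.ne']
    simp only [e]
    exact hi.const_mul _
  · have h := Measure.integral_comp_mul_left (fun t => leftKernel α t * k d t) d
    simp only [e] at h
    rw [integral_const_mul, smul_eq_mul, abs_of_pos (inv_pos.mpr hd)] at h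
    rw [leftKernel_of_pos _ hd, show -(α + β - 1) = -(α + β) + 1 by ring,
      Real.rpow_add hd, Real.rpow_one]
    field_simp at h
    linarith

lemma pairing_LL {α : ℝ} (hα : 1 / 2 < α) (h1 : α < 1) {d : ℝ} (hd : d ≠ 0) :
    (Integrable fun t => leftKernel α t * leftKernel α (t + d)) ∧
    ∫ t, leftKernel α t * leftKernel α (t + d) = cLL α * evenKernel α d := by
  have main : ∀ d, 0 < d → (Integrable fun t => leftKernel α t * leftKernel α (t + d)) ∧
      ∫ t, leftKernel α t * leftKernel α (t + d) = cLL α * leftKernel (2 * α - 1) d :=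
    fun d hd => two_mul α ▸ scaled_pairing (k := fun d t => leftKernel α (t + d)) hd
      (fun t => by rw [← leftKernel_mul α hd]; congr 1; ring)
      (integrable_leftKernel_mul_add_one hα h1)
  rcases lt_or_gt_of_ne hd with h | h
  · obtain ⟨i, e⟩ := main (-d) (neg_pos.mpr h)
    have e2 : (fun t => leftKernel α t * leftKernel α (t + d)) =
        fun t => (fun t => leftKernel α t * leftKernel α (t + -d)) (t + d) := by
      funext t
      simp only
      rw [mul_comm]
      congr 2
      ring
    rw [e2]
    refine ⟨i.comp_add_right d, ?_⟩
    rw [integral_add_right_eq_self (fun t => leftKernel α t * leftKernel α (t + -d)), e,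
      evenKernel, leftKernel_of_nonpos _ h.le, zero_add]
  · rw [evenKernel, leftKernel_of_nonpos _ (neg_nonpos.mpr h.le), add_zero]
    exact main d h

/-- The half-lines where the two factors live overlap only for `d < 0`, so this correlation is
one-sided, unlike the even one of `pairing_LL`. -/
lemma pairing_LR {α : ℝ} (hα : 1 / 2 < α) (h1 : α < 1) {d : ℝ} (hd : d ≠ 0) :
    (Integrable fun t => leftKernel α t * leftKernel α (-(t + d))) ∧
    ∫ t, leftKernel α t * leftKernel α (-(t + d)) = cLR α * leftKernel (2 * α - 1) (-d) := by
  rcases lt_or_gt_of_ne hd with h | h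
  · have := scaled_pairing (α := α) (β := α) (k := fun d t => leftKernel α (d - t)) (neg_pos.mpr h)
      (fun t => by rw [← leftKernel_mul α (neg_pos.mpr h)]; congr 1; ring)
      (integrable_leftKernel_mul_one_sub (by linarith) h1 (by linarith) h1)
    simp only [show ∀ t, -(t + d) = -d - t from fun t => by ring, two_mul]
    exact this
  · have : ∀ t, leftKernel α t * leftKernel α (-(t + d)) = 0 := fun t => by
      rcases le_or_gt t 0 with h2 | h2
      · rw [leftKernel_of_nonpos _ h2, zero_mul]
      · rw [leftKernel_of_nonpos α (t := -(t + d)) (by linarith), mul_zero]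
    simp only [this, leftKernel_of_nonpos _ (neg_nonpos.mpr h.le)]
    simp

/-- The double integral `∬ f(y) f(z) |y - z| ^ (1 - 2 α)`. -/
def doubleInt (α : ℝ) (f : ℝ → ℝ) : ℝ :=
  ∫ p : ℝ × ℝ, f p.1 * f p.2 * evenKernel α (p.1 - p.2)

lemma integral_leftPot_sq {α : ℝ} (hα : 1 / 2 < α) (h1 : α < 1) {f : ℝ → ℝ} (hf : Continuous f)
    (hfc : HasCompactSupport f) :
    Integrable (fun x => leftPot α f x ^ 2) ∧
      ∫ x, leftPot α f x ^ 2 = cLL α * doubleInt α f := by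
  have h := integral_pairing (measurable_leftKernel α) (measurable_leftKernel α)
    (leftKernel_nonneg α) (leftKernel_nonneg α) (fun d hd => (pairing_LL hα h1 hd).1)
    (κ := fun d => cLL α * evenKernel α d)
    (fun d hd => (pairing_LL hα h1 hd).2)
    ((locallyIntegrable_evenKernel h1).smul (cLL α)) hf hfc hf hfc
  simp only [← pow_two] at h
  refine ⟨h.1, h.2.trans ?_⟩
  rw [doubleInt, ← integral_const_mul]
  congr 1 with p
  ring

lemma integral_leftPot_mul_rightPot {α : ℝ} (hα : 1 / 2 < α) (h1 : α < 1) {f : ℝ → ℝ}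
    (hf : Continuous f) (hfc : HasCompactSupport f) :
    Integrable (fun x => leftPot α f x * rightPot α f x) ∧
      ∫ x, leftPot α f x * rightPot α f x = cLR α / 2 * doubleInt α f := by
  have hl := (locallyIntegrable_leftKernel_neg (α := 2 * α - 1) (by linarith)).smul (cLR α)
  have h := integral_pairing (measurable_leftKernel α)
    (k₂ := fun t => leftKernel α (-t)) ((measurable_leftKernel α).comp measurable_neg)
    (leftKernel_nonneg α) (fun _ => leftKernel_nonneg α _)
    (fun d hd => (pairing_LR hα h1 hd).1)
    (κ := fun d => cLR α * leftKernel (2 * α - 1) (-d))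
    (fun d hd => (pairing_LR hα h1 hd).2) hl hf hfc hf hfc
  simp only [neg_sub] at h
  refine ⟨h.1, h.2.trans ?_⟩
  have i1 := integrable_prod_kernel hl hf hfc hf hfc
  have i2 := i1.swap
  -- Swapping the variables shows that the one-sided kernel and its reflection give the same
  -- integral. Their average is half the even kernel, whence the factor `1/2`.
  have e : ∫ p : ℝ × ℝ, f p.1 * f p.2 * (cLR α * leftKernel (2 * α - 1) (p.2 - p.1)) =
      ∫ p : ℝ × ℝ, f p.1 * f p.2 * (cLR α * leftKernel (2 * α - 1) (p.1 - p.2)) := by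
    rw [Measure.volume_eq_prod, ← integral_prod_swap]
    refine integral_congr_ae (Filter.Eventually.of_forall fun p => ?_)
    simp only [Prod.fst_swap, Prod.snd_swap]
    ring
  have key : ∀ I A B : ℝ, I = A → I = B → I = (A + B) / 2 := fun I A B h h' => by linarith
  rw [key _ _ _ rfl e, ← integral_add]
  · rw [doubleInt, ← integral_const_mul, ← integral_div]
    congr 1 with p
    rw [evenKernel, neg_sub]
    ring
  · refine i1.congr (Filter.Eventually.of_forall fun p => ?_)
    simp [Pi.smul_apply]
  · refine i2.congr (Filter.Eventually.of_forall fun p => ?_)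
    simp only [Function.comp_apply, Prod.fst_swap, Prod.snd_swap, Pi.smul_apply, smul_eq_mul,
      neg_sub]
    ring

lemma integral_rightPot_sq {α : ℝ} (hα : 1 / 2 < α) (h1 : α < 1) {f : ℝ → ℝ} (hf : Continuous f)
    (hfc : HasCompactSupport f) :
    Integrable (fun x => rightPot α f x ^ 2) ∧
      ∫ x, rightPot α f x ^ 2 = cLL α * doubleInt α f := by
  obtain ⟨i, e⟩ := integral_leftPot_sq hα h1 (hf.comp continuous_neg)
    (hfc.comp_homeomorph (Homeomorph.neg ℝ))
  simp only [rightPot_eq_leftPot]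
  refine ⟨i.comp_neg, ?_⟩
  rw [integral_neg_eq_self (fun x => leftPot α (fun y => f (-y)) x ^ 2)]
  refine e.trans ?_
  congr 1
  have hmp : MeasurePreserving (Prod.map (fun x : ℝ => -x) fun x : ℝ => -x)
      (volume : Measure (ℝ × ℝ)) volume :=
    (Measure.measurePreserving_neg volume).prod (Measure.measurePreserving_neg volume)
  have := hmp.integral_comp ((Homeomorph.neg ℝ).prodCongr (Homeomorph.neg ℝ)).measurableEmbedding
    (fun p : ℝ × ℝ => f p.1 * f p.2 * evenKernel α (p.1 - p.2))
  rw [doubleInt, doubleInt, ← this]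
  congr 1 with p
  simp only [Function.comp_apply, Prod.map_fst, Prod.map_snd]
  rw [← evenKernel_neg]
  congr 2
  ring

/-- Schur's estimate: the left potential is bounded in `L²` on functions supported in a fixed
bounded interval. -/
lemma exists_integral_leftPot_sq_le {α : ℝ} (hα : 1 / 2 < α) (h1 : α < 1) (a b : ℝ) :
    ∃ C : ℝ, 0 ≤ C ∧ ∀ f : ℝ → ℝ, Continuous f → HasCompactSupport f →
      tsupport f ⊆ Ioo a b → ∫ x, leftPot α f x ^ 2 ≤ C * ∫ x, f x ^ 2 := by
  have hl := (locallyIntegrable_evenKernel h1).integrableOn_isCompact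
    (isCompact_Icc (a := a - b) (b := b - a))
  obtain ⟨D, hD⟩ : ∃ D, D = ∫ t in Icc (a - b) (b - a), evenKernel α t := ⟨_, rfl⟩
  have hD0 : 0 ≤ D := hD ▸ integral_nonneg fun t => evenKernel_nonneg α t
  refine ⟨cLL α * D, mul_nonneg (cLL_nonneg α) hD0, fun f hf hfc hs => ?_⟩
  rw [(integral_leftPot_sq hα h1 hf hfc).2, mul_assoc]
  refine mul_le_mul_of_nonneg_left ?_ (cLL_nonneg α)
  have hκ := hl.integrable_indicator measurableSet_Icc
  obtain ⟨κ, hκd⟩ : ∃ κ, κ = (Icc (a - b) (b - a)).indicator (evenKernel α) := ⟨_, rfl⟩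
  rw [← hκd] at hκ
  have hκn : ∀ t, κ (-t) = κ t := fun t => by
    by_cases ht : t ∈ Icc (a - b) (b - a)
    · rw [hκd, indicator_of_mem ht, indicator_of_mem, evenKernel_neg]
      exact ⟨by linarith [ht.2], by linarith [ht.1]⟩
    · rw [hκd, indicator_of_notMem ht, indicator_of_notMem]
      exact fun h => ht ⟨by linarith [h.2], by linarith [h.1]⟩
  have i1 : Integrable (fun x => f x ^ 2) := by
    simp only [pow_two]
    exact (hf.mul hf).integrable_of_hasCompactSupport hfc.mul_right
  have i2 : Integrable (fun p : ℝ × ℝ => f p.2 ^ 2 * κ (p.1 - p.2)) := by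
    rw [Measure.volume_eq_prod]
    exact i1.convolution_integrand (ContinuousLinearMap.mul ℝ ℝ) hκ
  have i3 : Integrable (fun p : ℝ × ℝ => f p.1 ^ 2 * κ (p.2 - p.1)) := i2.swap
  -- Pointwise `2 f(y) f(z) ≤ f(y)² + f(z)²`. Since `f` lives in `(a, b)`, the kernel may be cut off
  -- at distance `b - a`, where its mass `D` is finite.
  have hle : doubleInt α f ≤ ∫ p : ℝ × ℝ, (f p.2 ^ 2 * κ (p.1 - p.2) / 2 +
      f p.1 ^ 2 * κ (p.2 - p.1) / 2) := by
    refine integral_mono (integrable_prod_kernel (locallyIntegrable_evenKernel h1) hf hfc hf hfc)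
      ((i2.div_const 2).add (i3.div_const 2)) fun p => ?_
    simp only
    rw [← neg_sub p.1 p.2, hκn]
    have hκ0 : 0 ≤ κ (p.1 - p.2) := hκd ▸ indicator_nonneg (fun x _ => evenKernel_nonneg α x) _
    have : f p.1 * f p.2 * evenKernel α (p.1 - p.2) = f p.1 * f p.2 * κ (p.1 - p.2) := by
      by_cases h3 : f p.1 = 0
      · simp [h3]
      by_cases h4 : f p.2 = 0
      · simp [h4]
      have a1 := hs (subset_tsupport f h3)
      have a2 := hs (subset_tsupport f h4)
      rw [hκd, indicator_of_mem]
      exact ⟨by linarith [a1.1, a2.2], by linarith [a1.2, a2.1]⟩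
    rw [this]
    nlinarith [mul_nonneg hκ0 (sq_nonneg (f p.1 - f p.2))]
  refine hle.trans (le_of_eq ?_)
  have e1 : ∫ p : ℝ × ℝ, f p.2 ^ 2 * κ (p.1 - p.2) = D * ∫ x, f x ^ 2 := by
    rw [Measure.volume_eq_prod, integral_prod_symm _ i2, ← integral_const_mul]
    congr 1 with y
    simp only
    rw [integral_const_mul, integral_sub_right_eq_self κ, hκd, integral_indicator measurableSet_Icc,
      ← hD, mul_comm]
  have e2 : ∫ p : ℝ × ℝ, f p.1 ^ 2 * κ (p.2 - p.1) = D * ∫ x, f x ^ 2 := by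
    rw [← e1, Measure.volume_eq_prod, ← integral_prod_swap]
    refine integral_congr_ae (Filter.Eventually.of_forall fun p => ?_)
    simp only [Prod.fst_swap, Prod.snd_swap]
  rw [integral_add (i2.div_const 2) (i3.div_const 2), integral_div, integral_div, e1, e2]
  ring

/-! ### Positivity of the fractional derivative -/

/-- Integration by parts: the boundary term at `0` vanishes because `r t ≤ M t` and `α < 1`, and the
remaining integral `α ∫ t ^ (-α - 1) r` is nonnegative. -/
lemma rpow_mul_le_integral {α D : ℝ} (hα : 0 < α) (h1 : α < 1) (hD : 0 < D) {r g : ℝ → ℝ}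
    (hr : ∀ t, HasDerivAt r (g t) t) (hg : Continuous g) (r0 : r 0 = 0) (hpos : ∀ t, 0 ≤ r t) :
    D ^ (-α) * r D ≤ ∫ t in 0..D, t ^ (-α) * g t := by
  obtain ⟨M, hM⟩ := (isCompact_Icc (a := (0 : ℝ)) (b := D)).exists_bound_of_continuousOn
    hg.continuousOn
  have hM0 : 0 ≤ M := (norm_nonneg _).trans (hM 0 (left_mem_Icc.mpr hD.le))
  have hrM : ∀ t ∈ Icc 0 D, r t ≤ M * t := fun t ht => by
    have := (convex_Icc (0 : ℝ) D).norm_image_sub_le_of_norm_hasDerivWithin_le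
      (fun x _ => (hr x).hasDerivWithinAt) hM (left_mem_Icc.mpr hD.le) ht
    rw [r0, sub_zero, sub_zero, Real.norm_of_nonneg (hpos t), Real.norm_of_nonneg ht.1] at this
    exact this
  have hrc : Continuous r := continuous_iff_continuousAt.mpr fun t => (hr t).continuousAt
  have hpw : IntervalIntegrable (fun t : ℝ => t ^ (-α)) volume 0 D :=
    intervalIntegral.intervalIntegrable_rpow' (by linarith)
  have i1 : IntervalIntegrable (fun t => t ^ (-α) * g t) volume 0 D :=
    hpw.mul_continuousOn hg.continuousOn
  have i2 : IntervalIntegrable (fun t => α * t ^ (-α - 1) * r t) volume 0 D := by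
    rw [intervalIntegrable_iff_integrableOn_Ioc_of_le hD.le] at hpw ⊢
    refine (hpw.const_mul (α * M)).mono' ?_ ?_
    · have := hrc.measurable
      exact Measurable.aestronglyMeasurable (by fun_prop)
    · filter_upwards [ae_restrict_mem measurableSet_Ioc] with t ht
      have h0 : 0 < t := ht.1
      have p : 0 ≤ t ^ (-α - 1) := by positivity
      rw [Real.norm_of_nonneg (mul_nonneg (mul_nonneg hα.le p) (hpos t))]
      calc α * t ^ (-α - 1) * r t ≤ α * t ^ (-α - 1) * (M * t) := by
            gcongr
            exact hrM t ⟨h0.le, ht.2⟩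
        _ = α * M * (t ^ (-α - 1) * t) := by ring
        _ = α * M * t ^ (-α) := by
            rw [← Real.rpow_add_one h0.ne']
            congr 2
            ring
  have hc : ContinuousOn (fun t => t ^ (-α) * r t) (Icc 0 D) := by
    intro t ht
    rcases ht.1.eq_or_lt with h | h
    · subst h
      rw [ContinuousWithinAt, r0, mul_zero]
      have hlim : Filter.Tendsto (fun t : ℝ => M * t ^ (1 - α)) (nhdsWithin 0 (Icc 0 D))
          (nhds 0) := by
        have : ContinuousAt (fun t : ℝ => M * t ^ (1 - α)) 0 :=
          (Real.continuousAt_rpow_const 0 (1 - α) (Or.inr (by linarith))).const_mul M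
        have h2 := this.tendsto
        rw [Real.zero_rpow (by linarith), mul_zero] at h2
        exact h2.mono_left nhdsWithin_le_nhds
      refine squeeze_zero' ?_ ?_ hlim
      · filter_upwards [self_mem_nhdsWithin] with t ht
        exact mul_nonneg (Real.rpow_nonneg ht.1 _) (hpos t)
      · filter_upwards [self_mem_nhdsWithin] with t ht
        rcases ht.1.eq_or_lt with h | h
        · rw [← h, r0, mul_zero, Real.zero_rpow (by linarith), mul_zero]
        · calc t ^ (-α) * r t ≤ t ^ (-α) * (M * t) := by
                gcongr
                exact hrM t ht
            _ = M * (t ^ (-α) * t) := by ring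
            _ = M * t ^ (1 - α) := by
                rw [← Real.rpow_add_one h.ne']
                congr 2
                ring
    · exact ((Real.continuousAt_rpow_const t (-α) (Or.inl h.ne')).mul
        hrc.continuousAt).continuousWithinAt
  have key := integral_eq_of_hasDerivAt_off_countable_of_le
    (fun t => t ^ (-α) * r t) (fun t => t ^ (-α) * g t - α * t ^ (-α - 1) * r t) hD.le
    (s := ∅) countable_empty hc (fun t ht => by
      have h := (Real.hasDerivAt_rpow_const (x := t) (p := -α) (Or.inl ht.1.1.ne')).mul (hr t)
      refine h.congr_deriv ?_
      ring) (i1.sub i2)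
  rw [r0, mul_zero, sub_zero, intervalIntegral.integral_sub i1 i2] at key
  have : 0 ≤ ∫ t in 0..D, α * t ^ (-α - 1) * r t :=
    intervalIntegral.integral_nonneg hD.le fun t ht =>
      mul_nonneg (mul_nonneg hα.le (Real.rpow_nonneg ht.1 _)) (hpos t)
  linarith

lemma IsTest.eq_zero {a b : ℝ} {φ : ℝ → ℝ} (h : IsTest a b φ) {x : ℝ} (hx : x ∉ Ioo a b) :
    φ x = 0 := by
  by_contra h0
  exact hx (h.tsupport_subset (subset_tsupport φ h0))

lemma IsTest.isTest_deriv {a b : ℝ} {φ : ℝ → ℝ} (h : IsTest a b φ) : IsTest a b (deriv φ) where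
  contDiff := (contDiff_infty_iff_deriv.mp h.contDiff).2
  hasCompactSupport := h.hasCompactSupport.deriv
  tsupport_subset := fun _ hx => h.tsupport_subset (tsupport_deriv_subset hx)

lemma IsTest.mul {a b : ℝ} {φ ψ : ℝ → ℝ} (hψ : ContDiff ℝ ∞ ψ) (h : IsTest a b φ) :
    IsTest a b (fun x => ψ x * φ x) where
  contDiff := hψ.mul h.contDiff
  hasCompactSupport := h.hasCompactSupport.mul_left
  tsupport_subset := (tsupport_mul_subset_right).trans h.tsupport_subset

lemma IsTest.comp_neg {a b : ℝ} {φ : ℝ → ℝ} (h : IsTest a b φ) :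
    IsTest (-b) (-a) (fun x => φ (-x)) where
  contDiff := h.contDiff.comp contDiff_neg
  hasCompactSupport := h.hasCompactSupport.comp_homeomorph (Homeomorph.neg ℝ)
  tsupport_subset := by
    intro x hx
    have h2 := h.tsupport_subset (tsupport_comp_subset_preimage φ continuous_neg hx)
    exact ⟨by linarith [h2.2], by linarith [h2.1]⟩

lemma IsTest.integrable_mul {a b : ℝ} {φ ψ : ℝ → ℝ} (h : IsTest a b φ) (hψ : Continuous ψ) :
    Integrable (fun x => φ x * ψ x) :=
  (h.contDiff.continuous.mul hψ).integrable_of_hasCompactSupport h.hasCompactSupport.mul_right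

lemma leftPot_eq_integral_sub (α : ℝ) (f : ℝ → ℝ) (x : ℝ) :
    leftPot α f x = ∫ t, leftKernel α t * f (x - t) := by
  rw [leftPot, ← integral_sub_left_eq_self _ _ x]
  simp only [sub_sub_cancel]

/-- Positivity of the fractional derivative on test functions. -/
lemma IsTest.le_integral_leftPot_mul {a b α : ℝ} (hab : a < b) (hα : 0 < α) (h1 : α < 1)
    {φ : ℝ → ℝ} (h : IsTest a b φ) :
    (b - a) ^ (-α) * ∫ x, φ x ^ 2 ≤ ∫ x, leftPot α (deriv φ) x * φ x := by
  have hd := h.isTest_deriv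
  have hφc := h.contDiff.continuous
  have hdc := hd.contDiff.continuous
  -- `ρ` is the autocorrelation of `φ` and `g = -ρ'`; by Fubini the pairing is `∫ t ^ (-α) g`. The
  -- preceding bound is applied to `r = ρ 0 - ρ t ≥ 0` up to `t = b - a`, where the translates of
  -- `φ` separate and `ρ` vanishes.
  let g : ℝ → ℝ := fun t => ∫ x, φ x * deriv φ (x - t)
  let ρ : ℝ → ℝ := fun t => ∫ x, φ x * φ (x - t)
  have hsh : ∀ {ψ : ℝ → ℝ}, Continuous ψ → ∀ t, Integrable fun x => φ x * ψ (x - t) :=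
    fun hψ t => h.integrable_mul (hψ.comp (continuous_sub_right t))
  have hρ : ∀ t, HasDerivAt ρ (-g t) t := fun t => by
    have hn := h.comp_neg
    have := hn.hasCompactSupport.hasDerivAt_convolution_right (ContinuousLinearMap.mul ℝ ℝ)
      (hφc.locallyIntegrable (μ := volume)) (hn.contDiff.of_le (by simp)) t
    have e : convolution φ (fun x => φ (-x)) (ContinuousLinearMap.mul ℝ ℝ) volume = ρ := by
      funext t
      simp [convolution, ρ]
    rw [e] at this
    refine this.congr_deriv ?_
    simp only [convolution, g, ContinuousLinearMap.mul_apply', ← integral_neg]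
    congr 1 with x
    rw [deriv_comp_neg, neg_sub]
    ring
  have hgc : Continuous g := by
    have := (hd.comp_neg.hasCompactSupport.continuous_convolution_right
      (ContinuousLinearMap.mul ℝ ℝ) (hφc.locallyIntegrable (μ := volume))
      hd.comp_neg.contDiff.continuous)
    convert this using 1
    funext t
    simp [convolution, g]
  have hzero : ∀ {ψ : ℝ → ℝ}, IsTest a b ψ → ∀ t, b - a ≤ t → ∀ x, φ x * ψ (x - t) = 0 :=
    fun {ψ} hψ t ht x => by
      by_cases hx : x ∈ Ioo a b
      · rw [hψ.eq_zero (x := x - t) fun h' => by linarith [h'.1, hx.2], mul_zero]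
      · rw [h.eq_zero hx, zero_mul]
  have hρ0 : ρ (b - a) = 0 := by
    simp only [ρ, hzero h (b - a) le_rfl, integral_zero]
  have hsq : ∀ t, 0 ≤ ρ 0 - ρ t := fun t => by
    have i1 : Integrable fun x => φ x ^ 2 := by
      simp only [pow_two]
      exact h.integrable_mul hφc
    have i2 := i1.comp_sub_right t
    have e : ∫ x, (φ x - φ (x - t)) ^ 2 = 2 * (ρ 0 - ρ t) := by
      have : ∀ x, (φ x - φ (x - t)) ^ 2 = φ x ^ 2 + φ (x - t) ^ 2 - 2 * (φ x * φ (x - t)) :=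
        fun x => by ring
      simp only [this]
      have i12 : Integrable fun x => φ x ^ 2 + φ (x - t) ^ 2 := i1.add i2
      rw [integral_sub i12 ((hsh hφc t).const_mul 2), integral_add i1 i2,
        integral_sub_right_eq_self (fun x => φ x ^ 2), integral_const_mul]
      simp only [ρ, sub_zero, pow_two]
      ring
    have : 0 ≤ ∫ x, (φ x - φ (x - t)) ^ 2 := integral_nonneg fun x => sq_nonneg _
    linarith
  have key := rpow_mul_le_integral hα h1 (sub_pos.mpr hab) (r := fun t => ρ 0 - ρ t) (g := g)
    (fun t => by simpa using (hρ t).const_sub (ρ 0)) hgc (by simp) hsq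
  have eρ : ρ 0 = ∫ x, φ x ^ 2 := by simp [ρ, pow_two]
  simp only [hρ0, sub_zero, eρ] at key
  refine key.trans (le_of_eq ?_)
  have hk : Integrable ((Icc 0 (b - a)).indicator (leftKernel α)) :=
    ((leftKernel_locallyIntegrable h1).integrableOn_isCompact isCompact_Icc).integrable_indicator
      measurableSet_Icc
  have h2 := hk.convolution_integrand (ContinuousLinearMap.mul ℝ ℝ)
    (hdc.integrable_of_hasCompactSupport (μ := volume) hd.hasCompactSupport)
  obtain ⟨C, hC⟩ := h.hasCompactSupport.exists_bound_of_continuous hφc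
  have h3 := h2.bdd_mul (c := C) (f := fun p : ℝ × ℝ => φ p.1)
    (hφc.comp continuous_fst).aestronglyMeasurable (Filter.Eventually.of_forall fun p => hC p.1)
  -- The product vanishes for `t ≥ b - a`, so the kernel can be replaced by an integrable
  -- truncation, as Fubini requires.
  have e4 : ∀ x t, φ x * (leftKernel α t * deriv φ (x - t)) =
      φ x * ((Icc 0 (b - a)).indicator (leftKernel α) t * deriv φ (x - t)) := fun x t => by
    by_cases ht : t ∈ Icc 0 (b - a)
    · rw [indicator_of_mem ht]
    rw [indicator_of_notMem ht]
    rw [mem_Icc, not_and_or, not_le, not_le] at ht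
    rcases ht with ht | ht
    · rw [leftKernel_of_nonpos α ht.le]
    · rw [mul_left_comm, hzero hd t ht.le x]
      simp
  calc ∫ t in 0..(b - a), t ^ (-α) * g t
      = ∫ t in Ioc 0 (b - a), leftKernel α t * g t := by
        rw [intervalIntegral.integral_of_le (sub_pos.mpr hab).le]
        refine setIntegral_congr_fun measurableSet_Ioc fun t ht => ?_
        simp only [leftKernel_of_pos α ht.1]
    _ = ∫ t, leftKernel α t * g t := by
        refine setIntegral_eq_integral_of_forall_compl_eq_zero fun t ht => ?_
        rw [mem_Ioc, not_and_or, not_lt, not_le] at ht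
        rcases ht with ht | ht
        · rw [leftKernel_of_nonpos α ht, zero_mul]
        · simp only [g, hzero hd t ht.le, integral_zero, mul_zero]
    _ = ∫ t, ∫ x, φ x * (leftKernel α t * deriv φ (x - t)) := by
        congr 1 with t
        rw [← integral_const_mul]
        congr 1 with x
        ring
    _ = ∫ x, ∫ t, φ x * (leftKernel α t * deriv φ (x - t)) := by
        simp only [e4]
        exact (integral_integral_swap h3).symm
    _ = _ := by
        congr 1 with x
        rw [integral_const_mul, leftPot_eq_integral_sub, mul_comm]

/-! ### The a priori estimate -/

lemma integrable_leftKernel_mul {α : ℝ} (h1 : α < 1) {f : ℝ → ℝ} (hf : Continuous f)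
    (hfc : HasCompactSupport f) (x : ℝ) : Integrable fun y => leftKernel α (x - y) * f y :=
  ((hfc.convolutionExists_right (ContinuousLinearMap.mul ℝ ℝ) (leftKernel_locallyIntegrable h1)
    hf) x).integrable_swap

/-- Integration by parts against `(x - y)₊ ^ (1 - α)`. This factor is continuous across `y = x`
because `1 - α > 0`, so that point is a harmless exception to differentiability. -/
lemma IsTest.integral_leftKernel_mul_sub_mul_deriv {a b α : ℝ} (hab : a < b) (h1 : α < 1)
    {φ : ℝ → ℝ} (h : IsTest a b φ) (x : ℝ) :
    ∫ y, leftKernel α (x - y) * ((x - y) * deriv φ y) = (1 - α) * leftPot α φ x := by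
  have hd := h.isTest_deriv
  have hφc := h.contDiff.continuous
  have hd' : IsTest a b fun y => (x - y) * deriv φ y := hd.mul (by fun_prop)
  have i1 := integrable_leftKernel_mul h1 hd'.contDiff.continuous hd'.hasCompactSupport x
  have i2 := (integrable_leftKernel_mul h1 hφc h.hasCompactSupport x).const_mul (1 - α)
  rw [leftPot, ← integral_const_mul, ← sub_eq_zero, ← integral_sub i1 i2]
  have hs : Function.support (fun y => leftKernel α (x - y) * ((x - y) * deriv φ y) -
      (1 - α) * (leftKernel α (x - y) * φ y)) ⊆ Ioc a b := fun y hy => by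
    by_contra hn
    have hn' : y ∉ Ioo a b := fun h' => hn (Ioo_subset_Ioc_self h')
    exact hy (by simp [h.eq_zero hn', hd.eq_zero hn'])
  rw [← intervalIntegral.integral_eq_integral_of_support_subset hs]
  have hcont : Continuous fun y => max (x - y) 0 ^ (1 - α) :=
    ((continuous_const.sub continuous_id).max continuous_const).rpow_const
      fun _ => Or.inr (by linarith)
  have key := integral_eq_of_hasDerivAt_off_countable_of_le
    (fun y => max (x - y) 0 ^ (1 - α) * φ y)
    (fun y => leftKernel α (x - y) * ((x - y) * deriv φ y) -
      (1 - α) * (leftKernel α (x - y) * φ y)) hab.le (s := {x}) (countable_singleton x)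
    (hcont.mul hφc).continuousOn ?_ (i1.sub i2).intervalIntegrable
  · rw [key, h.eq_zero (by simp), h.eq_zero (by simp)]
    simp
  · rintro y ⟨-, hy⟩
    have hφd : HasDerivAt φ (deriv φ y) y :=
      (h.contDiff.differentiable (by simp)).differentiableAt.hasDerivAt
    rcases lt_or_gt_of_ne (show y ≠ x from hy) with hlt | hgt
    · have hpos : 0 < x - y := sub_pos.mpr hlt
      have h2 := (((hasDerivAt_id y).const_sub x).rpow_const (p := 1 - α)
        (Or.inl hpos.ne')).mul hφd
      have h3 := h2.congr_of_eventuallyEq (f₁ := fun y => max (x - y) 0 ^ (1 - α) * φ y) (by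
        filter_upwards [Iio_mem_nhds hlt] with z hz
        simp only [Pi.mul_apply, id]
        rw [max_eq_left (sub_pos.mpr hz).le])
      refine h3.congr_deriv ?_
      simp only [id]
      rw [leftKernel_of_pos α hpos, show 1 - α - 1 = -α by ring,
        show 1 - α = -α + 1 by ring, Real.rpow_add_one hpos.ne']
      ring
    · have hneg : x - y < 0 := sub_neg.mpr hgt
      rw [leftKernel_of_nonpos α hneg.le]
      have h3 := (hasDerivAt_const y (0 : ℝ)).congr_of_eventuallyEq
        (f₁ := fun y => max (x - y) 0 ^ (1 - α) * φ y) (by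
        filter_upwards [Ioi_mem_nhds hgt] with z hz
        rw [max_eq_right (sub_neg.mpr hz).le, Real.zero_rpow (by linarith), zero_mul])
      refine h3.congr_deriv ?_
      ring

lemma IsTest.hasDerivAt {a b : ℝ} {φ : ℝ → ℝ} (h : IsTest a b φ) (x : ℝ) :
    HasDerivAt φ (deriv φ x) x :=
  (h.contDiff.differentiable (by simp)).differentiableAt.hasDerivAt

lemma IsTest.deriv_sub_mul {a b : ℝ} {φ : ℝ → ℝ} (h : IsTest a b φ) (c x : ℝ) :
    deriv (fun y => (c - y) * φ y) x = -φ x + (c - x) * deriv φ x := by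
  have := (((hasDerivAt_id x).const_sub c).mul (h.hasDerivAt x)).deriv
  have e : deriv (fun y => (c - y) * φ y) x = -1 * φ x + (c - id x) * deriv φ x := this
  rw [e]
  simp

/-- The commutator of the fractional derivative with multiplication by an affine function. -/
lemma IsTest.leftPot_deriv_sub_mul {a b α : ℝ} (hab : a < b) (h1 : α < 1)
    {φ : ℝ → ℝ} (h : IsTest a b φ) (c x : ℝ) :
    leftPot α (deriv fun y => (c - y) * φ y) x =
      (c - x) * leftPot α (deriv φ) x - α * leftPot α φ x := by
  have hd := h.isTest_deriv
  have hd' : IsTest a b fun y => (x - y) * deriv φ y := hd.mul (by fun_prop)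
  have i1 := integrable_leftKernel_mul h1 hd'.contDiff.continuous hd'.hasCompactSupport x
  have i2 := integrable_leftKernel_mul h1 h.contDiff.continuous h.hasCompactSupport x
  have i3 := integrable_leftKernel_mul h1 hd.contDiff.continuous hd.hasCompactSupport x
  -- Write `c - y = (c - x) + (x - y)`: the second summand weakens the singularity and leaves only a
  -- potential of `φ` itself.
  have e : ∀ y, leftKernel α (x - y) * deriv (fun y => (c - y) * φ y) y =
      (c - x) * (leftKernel α (x - y) * deriv φ y) +
        leftKernel α (x - y) * ((x - y) * deriv φ y) - leftKernel α (x - y) * φ y := fun y => by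
    rw [h.deriv_sub_mul]
    ring
  have i4 : Integrable fun y => (c - x) * (leftKernel α (x - y) * deriv φ y) +
      leftKernel α (x - y) * ((x - y) * deriv φ y) := (i3.const_mul _).add i1
  rw [leftPot]
  simp only [e]
  rw [integral_sub i4 i2, integral_add (i3.const_mul _) i1, integral_const_mul,
    h.integral_leftKernel_mul_sub_mul_deriv hab h1]
  simp only [leftPot]
  ring

lemma leftPot_neg (α : ℝ) (f : ℝ → ℝ) (x : ℝ) :
    leftPot α (fun y => -f y) x = -leftPot α f x := by
  simp only [leftPot, mul_neg, integral_neg]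

lemma rightPot_deriv (α : ℝ) (φ : ℝ → ℝ) (x : ℝ) :
    rightPot α (deriv φ) x = -leftPot α (deriv fun y => φ (-y)) (-x) := by
  rw [rightPot_eq_leftPot, ← leftPot_neg]
  congr 1
  funext y
  rw [deriv_comp_neg, neg_neg]

lemma leftPot_deriv (α : ℝ) (φ : ℝ → ℝ) (x : ℝ) :
    leftPot α (deriv φ) x = -rightPot α (deriv fun y => φ (-y)) (-x) := by
  rw [rightPot_deriv]
  simp

lemma IsTest.rightPot_deriv_sub_mul {a b α : ℝ} (hab : a < b) (h1 : α < 1)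
    {φ : ℝ → ℝ} (h : IsTest a b φ) (c x : ℝ) :
    rightPot α (deriv fun y => (c - y) * φ y) x =
      (c - x) * rightPot α (deriv φ) x - α * rightPot α φ x := by
  have h2 := h.comp_neg.leftPot_deriv_sub_mul (by linarith) h1 (-c) (-x)
  have e : (fun y => (c - -y) * φ (-y)) = fun y => -((-c - y) * φ (-y)) := by
    funext y
    ring
  have e2 : ∀ f : ℝ → ℝ, deriv (fun y => -f y) = fun y => -deriv f y := fun f => by
    funext y
    exact deriv.fun_neg
  rw [rightPot_deriv, rightPot_deriv, rightPot_eq_leftPot, e, e2, leftPot_neg, h2]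
  ring

lemma leftPot_eq_zero {a b α : ℝ} {f : ℝ → ℝ} (hf : ∀ y ∉ Ioo a b, f y = 0) {x : ℝ} (hx : x ≤ a) :
    leftPot α f x = 0 := by
  rw [leftPot]
  refine integral_eq_zero_of_ae (Filter.Eventually.of_forall fun y => ?_)
  by_cases hy : y ∈ Ioo a b
  · simp only [leftKernel_of_nonpos α (show x - y ≤ 0 by linarith [hy.1]), zero_mul, Pi.zero_apply]
  · simp only [hf y hy, mul_zero, Pi.zero_apply]

lemma rightPot_eq_zero {a b α : ℝ} {f : ℝ → ℝ} (hf : ∀ y ∉ Ioo a b, f y = 0) {x : ℝ}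
    (hx : b ≤ x) : rightPot α f x = 0 := by
  rw [rightPot_eq_leftPot]
  refine leftPot_eq_zero (a := -b) (b := -a) (fun y hy => hf _ fun h => hy ?_) (neg_le_neg hx)
  exact ⟨by linarith [h.2], by linarith [h.1]⟩

/-- For `x > b` the kernel is smooth on `[a, b]`, so the derivative can be moved onto it. The
resulting extra power `(x - y) ^ (-1)` is absorbed by `b - y ≤ x - y`; the weight `b - y` is chosen
for this. -/
lemma IsTest.abs_leftPot_deriv_le {a b α : ℝ} (hab : a < b) (hα : 0 < α) (h1 : α < 1)
    {φ : ℝ → ℝ} (h : IsTest a b φ) {x : ℝ} (hx : b < x) :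
    |leftPot α (deriv fun y => (b - y) * φ y) x| ≤ leftPot α (fun y => |φ y|) x := by
  have hψ : IsTest a b fun y => (b - y) * φ y := h.mul (by fun_prop)
  have hpos : ∀ y ∈ Icc a b, 0 < x - y := fun y hy => by linarith [hy.2]
  have hc : ∀ p : ℝ, ContinuousOn (fun y => (x - y) ^ p) (Icc a b) := fun p =>
    (continuousOn_const.sub continuousOn_id).rpow_const fun y hy => Or.inl (hpos y hy).ne'
  have i1 : IntervalIntegrable (fun y => α * (x - y) ^ (-α - 1) * ((b - y) * φ y)) volume a b := by
    refine ContinuousOn.intervalIntegrable ?_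
    rw [uIcc_of_le hab.le]
    exact (continuousOn_const.mul (hc _)).mul hψ.contDiff.continuous.continuousOn
  have i2 : IntervalIntegrable (fun y => (x - y) ^ (-α) * deriv (fun y => (b - y) * φ y) y)
      volume a b := by
    refine ContinuousOn.intervalIntegrable ?_
    rw [uIcc_of_le hab.le]
    exact (hc _).mul hψ.isTest_deriv.contDiff.continuous.continuousOn
  have key := integral_eq_of_hasDerivAt_off_countable_of_le
    (fun y => (x - y) ^ (-α) * ((b - y) * φ y))
    (fun y => α * (x - y) ^ (-α - 1) * ((b - y) * φ y) +
      (x - y) ^ (-α) * deriv (fun y => (b - y) * φ y) y) hab.le (s := ∅) countable_empty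
    ((hc _).mul hψ.contDiff.continuous.continuousOn) (fun y hy => by
      have h2 := ((hasDerivAt_id y).const_sub x).rpow_const (p := -α)
        (Or.inl (hpos y (Ioo_subset_Icc_self hy.1)).ne')
      refine (h2.mul (hψ.hasDerivAt y)).congr_deriv ?_
      simp only [id]
      ring) (i1.add i2)
  rw [intervalIntegral.integral_add i1 i2, h.eq_zero (x := b) (by simp),
    h.eq_zero (x := a) (by simp)] at key
  simp only [mul_zero, sub_zero] at key
  have conv : ∀ f : ℝ → ℝ, (∀ y ∉ Ioo a b, f y = 0) →
      leftPot α f x = ∫ y in a..b, (x - y) ^ (-α) * f y := fun f hf => by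
    rw [intervalIntegral.integral_of_le hab.le, leftPot]
    rw [← setIntegral_eq_integral_of_forall_compl_eq_zero (s := Ioc a b) fun y hy => by
      rw [hf y fun h => hy (Ioo_subset_Ioc_self h), mul_zero]]
    refine setIntegral_congr_fun measurableSet_Ioc fun y hy => ?_
    simp only [leftKernel_of_pos α (hpos y (Ioc_subset_Icc_self hy))]
  rw [conv _ fun y hy => hψ.isTest_deriv.eq_zero hy, conv _ fun y hy => by simp [h.eq_zero hy],
    eq_neg_of_add_eq_zero_right key, abs_neg]
  refine (intervalIntegral.abs_integral_le_integral_abs hab.le).trans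
    (intervalIntegral.integral_mono_on hab.le i1.abs ?_ fun y hy => ?_)
  · refine ContinuousOn.intervalIntegrable ?_
    rw [uIcc_of_le hab.le]
    exact (hc _).mul h.contDiff.continuous.abs.continuousOn
  · have hp := hpos y hy
    have e : (x - y) ^ (-α) = (x - y) ^ (-α - 1) * (x - y) := by
      rw [← Real.rpow_add_one hp.ne']
      congr 1
      ring
    rw [abs_mul, abs_mul, abs_mul, abs_of_pos hα, abs_of_nonneg (sub_nonneg.mpr hy.2),
      abs_of_pos (Real.rpow_pos_of_pos hp _), ← mul_assoc, e]
    refine mul_le_mul_of_nonneg_right ?_ (abs_nonneg _)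
    have hp2 : 0 < (x - y) ^ (-α - 1) := Real.rpow_pos_of_pos hp _
    calc α * (x - y) ^ (-α - 1) * (b - y) ≤ 1 * (x - y) ^ (-α - 1) * (x - y) := by
          gcongr
          linarith [hy.2]
      _ = _ := by ring

/-! ### Strict sectoriality on the whole line. -/

lemma exists_isTest_ne_zero {a b : ℝ} (hab : a < b) :
    ∃ φ, IsTest a b φ ∧ 0 < ∫ x, φ x ^ 2 := by
  let f : ContDiffBump ((a + b) / 2) := ⟨(b - a) / 8, (b - a) / 4, by linarith, by linarith⟩
  have ht : IsTest a b f := by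
    refine ⟨f.contDiff, f.hasCompactSupport, ?_⟩
    rw [f.tsupport_eq]
    intro x hx
    rw [Metric.mem_closedBall, Real.dist_eq, abs_le] at hx
    have e : f.rOut = (b - a) / 4 := rfl
    rw [e] at hx
    exact ⟨by linarith [hx.1], by linarith [hx.2]⟩
  refine ⟨f, ht, ?_⟩
  have hc : Continuous fun x => f x ^ 2 := f.continuous.pow 2
  have h1 : f ((a + b) / 2) = 1 := f.one_of_mem_closedBall (by simp [f.rIn_pos.le])
  refine hc.integral_pos_of_hasCompactSupport_nonneg_nonzero ?_ (fun x => sq_nonneg _)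
    (x := (a + b) / 2) (by simp [h1])
  simp only [pow_two]
  exact f.hasCompactSupport.mul_right

/-- Fractional integration by parts of `φ` against itself, with the Gamma factor cancelled. -/
lemma IsTest.integral_leftPot_mul_self {a b α : ℝ} (h1 : α < 1) {φ : ℝ → ℝ}
    (h : IsTest a b φ) :
    ∫ x, rightPot α (deriv φ) x * φ x = -∫ x, leftPot α (deriv φ) x * φ x := by
  have h2 := integral_leftDeriv_mul h1 h.contDiff h.hasCompactSupport h.contDiff
    h.hasCompactSupport
  simp only [leftDeriv_eq h1 h.contDiff h.hasCompactSupport,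
    rightDeriv_eq h1 h.contDiff h.hasCompactSupport, mul_assoc, mul_neg, integral_neg,
    integral_const_mul, mul_left_comm (φ _)] at h2
  have hγ : (Real.Gamma (1 - α))⁻¹ ≠ 0 := (inv_pos.mpr (Real.Gamma_pos_of_pos (by linarith))).ne'
  rw [← mul_neg] at h2
  have h3 := mul_left_cancel₀ hγ h2
  rw [h3, neg_neg]
  congr 1 with x
  ring

lemma IsTest.integral_leftPot_sub_rightPot_mul {a b α : ℝ} (h1 : α < 1) {φ : ℝ → ℝ}
    (h : IsTest a b φ) :
    ∫ x, (leftPot α (deriv φ) x - rightPot α (deriv φ) x) * φ x =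
      2 * ∫ x, leftPot α (deriv φ) x * φ x := by
  have hd := h.isTest_deriv
  have i1 := h.integrable_mul (continuous_leftPot h1 hd.contDiff.continuous hd.hasCompactSupport)
  have i2 := h.integrable_mul (continuous_rightPot h1 hd.contDiff.continuous hd.hasCompactSupport)
  simp only [mul_comm (φ _)] at i1 i2
  simp only [sub_mul]
  rw [integral_sub i1 i2, h.integral_leftPot_mul_self h1]
  ring

lemma integral_sub_sq_pot {α : ℝ} (hα : 1 / 2 < α) (h1 : α < 1) {f : ℝ → ℝ} (hf : Continuous f)
    (hfc : HasCompactSupport f) :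
    Integrable (fun x => (leftPot α f x - rightPot α f x) ^ 2) ∧
      ∫ x, (leftPot α f x - rightPot α f x) ^ 2 = (2 * cLL α - cLR α) * doubleInt α f := by
  obtain ⟨i1, e1⟩ := integral_leftPot_sq hα h1 hf hfc
  obtain ⟨i2, e2⟩ := integral_rightPot_sq hα h1 hf hfc
  obtain ⟨i3, e3⟩ := integral_leftPot_mul_rightPot hα h1 hf hfc
  have e : ∀ x, (leftPot α f x - rightPot α f x) ^ 2 =
      leftPot α f x ^ 2 + rightPot α f x ^ 2 - 2 * (leftPot α f x * rightPot α f x) :=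
    fun x => by ring
  have i4 : Integrable fun x => leftPot α f x ^ 2 + rightPot α f x ^ 2 := i1.add i2
  simp only [e]
  refine ⟨i4.sub (i3.const_mul 2), ?_⟩
  rw [integral_sub i4 (i3.const_mul 2), integral_add i1 i2, integral_const_mul, e1, e2, e3]
  ring

/-- The strict inequality behind the sectoriality of the Riesz derivative. -/
lemma cLR_lt {α : ℝ} (hα : 1 / 2 < α) (h1 : α < 1) : 0 < cLL α ∧ cLR α < 2 * cLL α := by
  obtain ⟨φ, h, hpos⟩ := exists_isTest_ne_zero (zero_lt_one' ℝ)
  have hd := h.isTest_deriv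
  have hp := h.le_integral_leftPot_mul zero_lt_one (by linarith) h1
  have hp' : 0 < ∫ x, leftPot α (deriv φ) x * φ x := by
    refine lt_of_lt_of_le ?_ hp
    positivity
  -- For a nonzero test function both `L φ'` and `L φ' - R φ'` pair strictly positively with `φ`, so
  -- neither has norm zero. Their squared norms are `cLL` and `2 cLL - cLR` times the same double
  -- integral, which forces both constants to be positive.
  have nz : ∀ P : ℝ → ℝ, Integrable (fun x => P x ^ 2) → 0 < ∫ x, P x * φ x →
      0 < ∫ x, P x ^ 2 := fun P hP h0 => by
    refine lt_of_le_of_ne (integral_nonneg fun x => sq_nonneg _) fun he => ?_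
    have := (integral_eq_zero_iff_of_nonneg (fun x => sq_nonneg (P x)) hP).mp he.symm
    refine h0.ne' (integral_eq_zero_of_ae ?_)
    filter_upwards [this] with x hx
    have : P x = 0 := by simpa using hx
    simp [this]
  obtain ⟨i1, e1⟩ := integral_leftPot_sq hα h1 hd.contDiff.continuous hd.hasCompactSupport
  obtain ⟨i2, e2⟩ := integral_sub_sq_pot hα h1 hd.contDiff.continuous hd.hasCompactSupport
  have q1 := nz _ i1 hp'
  have q2 := nz _ i2 (by rw [h.integral_leftPot_sub_rightPot_mul h1]; positivity)
  rw [e1] at q1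
  rw [e2] at q2
  have hc : 0 < cLL α := lt_of_le_of_ne (cLL_nonneg α) fun h0 => by simp [← h0] at q1
  have hdI := (mul_pos_iff_of_pos_left hc).mp q1
  have := (mul_pos_iff_of_pos_right hdI).mp q2
  exact ⟨hc, by linarith⟩

/-! ### Localization of the estimate to the interval. -/

lemma IsTest.abs_props {a b : ℝ} {φ : ℝ → ℝ} (h : IsTest a b φ) :
    Continuous (fun y => |φ y|) ∧ HasCompactSupport (fun y => |φ y|) ∧
      tsupport (fun y => |φ y|) ⊆ Ioo a b :=
  ⟨h.contDiff.continuous.abs, h.hasCompactSupport.comp_left (g := fun t => |t|) (by simp),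
    (tsupport_comp_subset (g := fun t : ℝ => |t|) abs_zero φ).trans h.tsupport_subset⟩

/-- Let `ψ = (b - y) φ`. Since `L ψ'` vanishes left of `a`, pairing it with `L ψ' - R ψ'` bounds it
by the norm of this difference on `(a, ∞)`. On `(a, b)` the commutator formulas reduce the
difference to `L φ' - R φ'` and terms of order zero; beyond `b` the right potential vanishes and the
tail estimate applies. Schur's bound controls the terms of order zero. -/
lemma exists_integral_leftPot_endpoint_le {α : ℝ} (hα : 1 / 2 < α) (h1 : α < 1) {a b : ℝ}
    (hab : a < b) :
    ∃ C : ℝ, 0 ≤ C ∧ ∀ φ, IsTest a b φ →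
      ∫ x, leftPot α (deriv fun y => (b - y) * φ y) x ^ 2 ≤
        C * ((∫ x in Ioo a b, (leftPot α (deriv φ) x - rightPot α (deriv φ) x) ^ 2) +
          ∫ x, φ x ^ 2) := by
  obtain ⟨C₀, hC₀, hJ⟩ := exists_integral_leftPot_sq_le hα h1 a b
  obtain ⟨hc, hlt⟩ := cLR_lt hα h1
  -- `δ` is the ratio of `∫ L f (L f - R f)` to `∫ (L f)²`, the same for all `f`.
  obtain ⟨δ, hδ⟩ : ∃ δ, δ = 1 - cLR α / (2 * cLL α) := ⟨_, rfl⟩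
  have hδ0 : 0 < δ := by
    rw [hδ, sub_pos, div_lt_one (by positivity)]
    exact hlt
  refine ⟨(δ ^ 2)⁻¹ * (3 * (b - a) ^ 2 + 7 * C₀), by positivity, fun φ h => ?_⟩
  have hd := h.isTest_deriv
  have hψ : IsTest a b fun y => (b - y) * φ y := h.mul (by fun_prop)
  have hψd := hψ.isTest_deriv
  have hcomm := h.leftPot_deriv_sub_mul hab h1 b
  have hcomm' := h.rightPot_deriv_sub_mul hab h1 b
  have htail := fun x => h.abs_leftPot_deriv_le hab (by linarith) h1 (x := x)
  obtain ⟨ψ', hψ'⟩ : ∃ ψ', ψ' = deriv fun y => (b - y) * φ y := ⟨_, rfl⟩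
  rw [← hψ'] at hψd hcomm hcomm' htail ⊢
  obtain ⟨iB, eB⟩ := integral_leftPot_sq hα h1 hψd.contDiff.continuous hψd.hasCompactSupport
  obtain ⟨iBR, eBR⟩ := integral_leftPot_mul_rightPot hα h1 hψd.contDiff.continuous
    hψd.hasCompactSupport
  obtain ⟨iA, -⟩ := integral_sub_sq_pot hα h1 hψd.contDiff.continuous hψd.hasCompactSupport
  obtain ⟨iD, -⟩ := integral_sub_sq_pot hα h1 hd.contDiff.continuous hd.hasCompactSupport
  obtain ⟨iL, eL⟩ := integral_leftPot_sq hα h1 h.contDiff.continuous h.hasCompactSupport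
  obtain ⟨iR, eR⟩ := integral_rightPot_sq hα h1 h.contDiff.continuous h.hasCompactSupport
  obtain ⟨ha1, ha2, ha3⟩ := h.abs_props
  obtain ⟨iV, -⟩ := integral_leftPot_sq hα h1 ha1 ha2
  have hJ1 := hJ φ h.contDiff.continuous h.hasCompactSupport h.tsupport_subset
  have hJ2 := hJ _ ha1 ha2 ha3
  simp only [sq_abs] at hJ2
  have eAB : ∫ x, (leftPot α ψ' x ^ 2 - leftPot α ψ' x * rightPot α ψ' x) =
      δ * ∫ x, leftPot α ψ' x ^ 2 := by
    rw [integral_sub iB iBR, eB, eBR, hδ]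
    field_simp
  have step1 : δ ^ 2 * ∫ x, leftPot α ψ' x ^ 2 ≤
      ∫ x in Ioi a, (leftPot α ψ' x - rightPot α ψ' x) ^ 2 := by
    rw [← integral_indicator measurableSet_Ioi]
    have iA' := iA.indicator measurableSet_Ioi (s := Ioi a)
    -- Young's inequality, weighted so that exactly half of `δ ∫ (L ψ')²` is absorbed by the
    -- left-hand side.
    have hle : ∫ x, (leftPot α ψ' x ^ 2 - leftPot α ψ' x * rightPot α ψ' x) ≤
        ∫ x, (δ⁻¹ / 2 * (Ioi a).indicator
          (fun x => (leftPot α ψ' x - rightPot α ψ' x) ^ 2) x + δ / 2 * leftPot α ψ' x ^ 2) := by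
      refine integral_mono (iB.sub iBR) ((iA'.const_mul _).add (iB.const_mul _)) fun x => ?_
      simp only
      by_cases hx : x ∈ Ioi a
      · rw [indicator_of_mem hx]
        have : 0 ≤ δ⁻¹ / 2 * ((leftPot α ψ' x - rightPot α ψ' x) - δ * leftPot α ψ' x) ^ 2 := by
          positivity
        have e : δ⁻¹ / 2 * ((leftPot α ψ' x - rightPot α ψ' x) - δ * leftPot α ψ' x) ^ 2 =
          δ⁻¹ / 2 * (leftPot α ψ' x - rightPot α ψ' x) ^ 2 + δ / 2 * leftPot α ψ' x ^ 2 -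
            (leftPot α ψ' x ^ 2 - leftPot α ψ' x * rightPot α ψ' x) := by
          field_simp
          ring
        linarith
      · rw [indicator_of_notMem hx,
          leftPot_eq_zero (fun y hy => hψd.eq_zero hy) (not_lt.mp hx)]
        simp
    rw [eAB, integral_add (iA'.const_mul _) (iB.const_mul _), integral_const_mul,
      integral_const_mul] at hle
    have := mul_le_mul_of_nonneg_left hle (show 0 ≤ 2 * δ by positivity)
    have e : ∀ X Y : ℝ, 2 * δ * (δ⁻¹ / 2 * X + δ / 2 * Y) = X + δ ^ 2 * Y := fun X Y => by
      field_simp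
    rw [e] at this
    linarith
  have step2 : ∫ x in Ioi a, (leftPot α ψ' x - rightPot α ψ' x) ^ 2 ≤
      3 * (b - a) ^ 2 * (∫ x in Ioo a b, (leftPot α (deriv φ) x - rightPot α (deriv φ) x) ^ 2) +
        7 * C₀ * ∫ x, φ x ^ 2 := by
    rw [← integral_indicator measurableSet_Ioi, ← integral_indicator measurableSet_Ioo]
    have iA' := iA.indicator measurableSet_Ioi (s := Ioi a)
    have iD' := iD.indicator measurableSet_Ioo (s := Ioo a b)
    have j1 : Integrable fun x => 3 * leftPot α φ x ^ 2 + 3 * rightPot α φ x ^ 2 :=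
      (iL.const_mul 3).add (iR.const_mul 3)
    have j2 : Integrable fun x => 3 * leftPot α φ x ^ 2 + 3 * rightPot α φ x ^ 2 +
      leftPot α (fun y => |φ y|) x ^ 2 := j1.add iV
    -- The square of a sum of three terms is at most three times the sum of the squares. After
    -- integration the potentials of `φ` contribute `3 + 3` and the tail contributes `1`, hence the
    -- constant `7 C₀`.
    have hle : ∫ x, (Ioi a).indicator (fun x => (leftPot α ψ' x - rightPot α ψ' x) ^ 2) x ≤
        ∫ x, (3 * (b - a) ^ 2 * (Ioo a b).indicator
          (fun x => (leftPot α (deriv φ) x - rightPot α (deriv φ) x) ^ 2) x +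
          (3 * leftPot α φ x ^ 2 + 3 * rightPot α φ x ^ 2 +
            leftPot α (fun y => |φ y|) x ^ 2)) := by
      refine integral_mono_ae iA' ((iD'.const_mul _).add j2) ?_
      have hb : ∀ᵐ x : ℝ, x ≠ b := by simp [ae_iff]
      filter_upwards [hb] with x hxb
      have hn : 0 ≤ 3 * leftPot α φ x ^ 2 + 3 * rightPot α φ x ^ 2 := by positivity
      rcases le_or_gt x a with hxa | hxa
      · rw [indicator_of_notMem (by simpa using hxa),
          indicator_of_notMem (fun h => absurd h.1 (not_lt.mpr hxa))]
        positivity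
      rw [indicator_of_mem (by exact hxa)]
      rcases lt_or_gt_of_ne hxb with hlt | hgt
      · rw [indicator_of_mem (show x ∈ Ioo a b from ⟨hxa, hlt⟩), hcomm, hcomm']
        obtain ⟨X, hX⟩ : ∃ X, X = leftPot α (deriv φ) x - rightPot α (deriv φ) x := ⟨_, rfl⟩
        have e : (b - x) * leftPot α (deriv φ) x - α * leftPot α φ x -
            ((b - x) * rightPot α (deriv φ) x - α * rightPot α φ x) =
            (b - x) * X + -α * leftPot α φ x + α * rightPot α φ x := by rw [hX]; ring
        rw [e, ← hX]
        have s1 : ((b - x) * X + -α * leftPot α φ x + α * rightPot α φ x) ^ 2 ≤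
            3 * (((b - x) * X) ^ 2 + (-α * leftPot α φ x) ^ 2 + (α * rightPot α φ x) ^ 2) := by
          nlinarith [sq_nonneg ((b - x) * X - -α * leftPot α φ x),
            sq_nonneg ((b - x) * X - α * rightPot α φ x),
            sq_nonneg (-α * leftPot α φ x - α * rightPot α φ x)]
        have s2 : ((b - x) * X) ^ 2 ≤ (b - a) ^ 2 * X ^ 2 := by
          rw [mul_pow]
          gcongr
        have hα2 : α ^ 2 ≤ 1 := by nlinarith
        have s3 : (-α * leftPot α φ x) ^ 2 ≤ leftPot α φ x ^ 2 := by
          rw [mul_pow, neg_sq]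
          exact mul_le_of_le_one_left (sq_nonneg _) hα2
        have s4 : (α * rightPot α φ x) ^ 2 ≤ rightPot α φ x ^ 2 := by
          rw [mul_pow]
          exact mul_le_of_le_one_left (sq_nonneg _) hα2
        have s5 : 0 ≤ leftPot α (fun y => |φ y|) x ^ 2 := sq_nonneg _
        linarith
      · rw [indicator_of_notMem (fun h => absurd h.2 (not_lt.mpr hgt.le)),
          rightPot_eq_zero (fun y hy => hψd.eq_zero hy) hgt.le, sub_zero, mul_zero, zero_add]
        have s1 : leftPot α ψ' x ^ 2 ≤ leftPot α (fun y => |φ y|) x ^ 2 :=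
          sq_le_sq' (by have := abs_le.mp (htail x hgt); linarith [this.1])
            (abs_le.mp (htail x hgt)).2
        linarith
    refine hle.trans ?_
    rw [integral_add (iD'.const_mul _) j2, integral_add j1 iV,
      integral_add (iL.const_mul 3) (iR.const_mul 3), integral_const_mul, integral_const_mul,
      integral_const_mul, eR, ← eL]
    linarith
  have hX : 0 ≤ ∫ x in Ioo a b, (leftPot α (deriv φ) x - rightPot α (deriv φ) x) ^ 2 :=
    integral_nonneg fun x => sq_nonneg _
  have hY : 0 ≤ ∫ x, φ x ^ 2 := integral_nonneg fun x => sq_nonneg _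
  rw [mul_assoc, ← div_eq_inv_mul, le_div_iff₀ (by positivity), mul_comm]
  refine (step1.trans step2).trans ?_
  have q1 := mul_nonneg (show 0 ≤ 3 * (b - a) ^ 2 by positivity) hY
  have q2 := mul_nonneg (show 0 ≤ 7 * C₀ by positivity) hX
  linarith

/-- The a priori estimate for the fractional derivatives of test functions, up to a term of
order zero. -/
lemma exists_integral_leftPot_deriv_sq_le {α : ℝ} (hα : 1 / 2 < α) (h1 : α < 1) {a b : ℝ}
    (hab : a < b) :
    ∃ C : ℝ, 0 ≤ C ∧ ∀ φ, IsTest a b φ →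
      ∫ x, leftPot α (deriv φ) x ^ 2 ≤
        C * ((∫ x in Ioo a b, (leftPot α (deriv φ) x - rightPot α (deriv φ) x) ^ 2) +
          ∫ x, φ x ^ 2) := by
  obtain ⟨C₁, hC₁, H₁⟩ := exists_integral_leftPot_endpoint_le hα h1 hab
  -- The reflected interval yields the estimate with weight `a - y`. The two weights differ by the
  -- constant `b - a`, so subtracting the two products removes the degeneracy at either end point.
  obtain ⟨C₂, hC₂, H₂⟩ := exists_integral_leftPot_endpoint_le hα h1 (neg_lt_neg hab)
  refine ⟨2 / (b - a) ^ 2 * (C₁ + C₂), by positivity, fun φ h => ?_⟩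
  have hn := h.comp_neg
  have E₁ := H₁ φ h
  have E₂ := H₂ _ hn
  have e1 : ∫ x, φ (-x) ^ 2 = ∫ x, φ x ^ 2 := integral_neg_eq_self (fun x => φ x ^ 2) _
  have e2 : ∫ x in Ioo (-b) (-a), (leftPot α (deriv fun y => φ (-y)) x -
      rightPot α (deriv fun y => φ (-y)) x) ^ 2 =
      ∫ x in Ioo a b, (leftPot α (deriv φ) x - rightPot α (deriv φ) x) ^ 2 := by
    rw [← integral_indicator measurableSet_Ioo, ← integral_indicator measurableSet_Ioo,
      ← integral_neg_eq_self]
    congr 1 with x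
    by_cases hx : x ∈ Ioo a b
    · rw [indicator_of_mem hx, indicator_of_mem (show -x ∈ Ioo (-b) (-a) from
        ⟨by linarith [hx.2], by linarith [hx.1]⟩), leftPot_deriv α φ, rightPot_deriv α φ]
      ring
    · rw [indicator_of_notMem hx, indicator_of_notMem fun h' => hx
        ⟨by linarith [h'.2], by linarith [h'.1]⟩]
  have hψ₁ : IsTest a b fun y => (b - y) * φ y := h.mul (by fun_prop)
  have hψ₂ : IsTest a b fun y => (a - y) * φ y := h.mul (by fun_prop)
  have e3 : ∫ x, leftPot α (deriv fun y => (-a - y) * φ (-y)) x ^ 2 =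
      ∫ x, leftPot α (deriv fun y => (a - y) * φ y) x ^ 2 := by
    rw [(integral_leftPot_sq hα h1 hψ₂.isTest_deriv.contDiff.continuous
      hψ₂.isTest_deriv.hasCompactSupport).2, ← (integral_rightPot_sq hα h1
      hψ₂.isTest_deriv.contDiff.continuous hψ₂.isTest_deriv.hasCompactSupport).2,
      ← integral_neg_eq_self]
    congr 1 with x
    rw [rightPot_deriv α fun y => (a - y) * φ y, neg_sq]
    have : (fun y => (-a - y) * φ (-y)) = fun y => -((a - -y) * φ (-y)) := by
      funext y
      ring
    rw [this, deriv.fun_neg', leftPot_neg, neg_sq]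
  rw [e1, e2, e3] at E₂
  have i1 := (integral_leftPot_sq hα h1 hψ₁.isTest_deriv.contDiff.continuous
    hψ₁.isTest_deriv.hasCompactSupport).1
  have i2 := (integral_leftPot_sq hα h1 hψ₂.isTest_deriv.contDiff.continuous
    hψ₂.isTest_deriv.hasCompactSupport).1
  have i0 := (integral_leftPot_sq hα h1 h.isTest_deriv.contDiff.continuous
    h.isTest_deriv.hasCompactSupport).1
  have hle : ∫ x, (b - a) ^ 2 * leftPot α (deriv φ) x ^ 2 ≤
      ∫ x, (2 * leftPot α (deriv fun y => (b - y) * φ y) x ^ 2 +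
        2 * leftPot α (deriv fun y => (a - y) * φ y) x ^ 2) := by
    refine integral_mono (i0.const_mul _) ((i1.const_mul 2).add (i2.const_mul 2)) fun x => ?_
    simp only
    rw [h.leftPot_deriv_sub_mul hab h1 b, h.leftPot_deriv_sub_mul hab h1 a]
    nlinarith [sq_nonneg (((b - x) * leftPot α (deriv φ) x - α * leftPot α φ x) +
      ((a - x) * leftPot α (deriv φ) x - α * leftPot α φ x))]
  rw [integral_const_mul, integral_add (i1.const_mul 2) (i2.const_mul 2), integral_const_mul,
    integral_const_mul] at hle
  have hp : 0 < (b - a) ^ 2 := by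
    have := sub_pos.mpr hab
    positivity
  rw [div_mul_eq_mul_div, div_mul_eq_mul_div, le_div_iff₀ hp]
  linarith

/-- The a priori estimate in `L²` for test functions. -/
lemma exists_integral_sq_le {α : ℝ} (hα : 1 / 2 < α) (h1 : α < 1) {a b : ℝ} (hab : a < b) :
    ∃ C : ℝ, 0 ≤ C ∧ ∀ φ, IsTest a b φ → ∫ x, φ x ^ 2 ≤
        C * ∫ x in Ioo a b, (leftPot α (deriv φ) x - rightPot α (deriv φ) x) ^ 2 := by
  obtain ⟨c, hc⟩ : ∃ c, c = (b - a) ^ (-α) := ⟨_, rfl⟩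
  have hc0 : 0 < c := hc ▸ Real.rpow_pos_of_pos (sub_pos.mpr hab) _
  refine ⟨(4 * c ^ 2)⁻¹, by positivity, fun φ h => ?_⟩
  have hd := h.isTest_deriv
  have hp := h.le_integral_leftPot_mul hab (by linarith) h1
  have hp2 := h.integral_leftPot_sub_rightPot_mul h1 (α := α)
  rw [← hc] at hp
  obtain ⟨iD, -⟩ := integral_sub_sq_pot hα h1 hd.contDiff.continuous hd.hasCompactSupport
  have iφ : Integrable fun x => φ x ^ 2 := by
    simp only [pow_two]
    exact h.integrable_mul h.contDiff.continuous
  have iD' := iD.indicator measurableSet_Ioo (s := Ioo a b)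
  have iP := h.integrable_mul
    ((continuous_leftPot h1 hd.contDiff.continuous hd.hasCompactSupport).sub
    (continuous_rightPot h1 hd.contDiff.continuous hd.hasCompactSupport))
  -- By positivity the left-hand side is at least `2 c ∫ φ²`; the weight in Young's inequality is
  -- chosen so that half of that is absorbed.
  have hle : ∫ x, φ x * (leftPot α (deriv φ) x - rightPot α (deriv φ) x) ≤
      ∫ x, (c * φ x ^ 2 + (4 * c)⁻¹ * (Ioo a b).indicator
        (fun x => (leftPot α (deriv φ) x - rightPot α (deriv φ) x) ^ 2) x) := by
    refine integral_mono iP ((iφ.const_mul _).add (iD'.const_mul _)) fun x => ?_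
    simp only
    by_cases hx : x ∈ Ioo a b
    · rw [indicator_of_mem hx]
      have e : ∀ u v : ℝ, c * u ^ 2 + (4 * c)⁻¹ * v ^ 2 - u * v =
          c * (u - (2 * c)⁻¹ * v) ^ 2 := fun u v => by
        field_simp
        ring
      have := e (φ x) (leftPot α (deriv φ) x - rightPot α (deriv φ) x)
      have h0 : 0 ≤ c * (φ x - (2 * c)⁻¹ *
        (leftPot α (deriv φ) x - rightPot α (deriv φ) x)) ^ 2 := by positivity
      linarith
    · rw [indicator_of_notMem hx, h.eq_zero hx]
      simp
  rw [integral_add (iφ.const_mul _) (iD'.const_mul _), integral_const_mul, integral_const_mul,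
    integral_indicator measurableSet_Ioo] at hle
  simp only [mul_comm (φ _)] at hle
  rw [hp2] at hle
  have h3 : c * ∫ x, φ x ^ 2 ≤ (4 * c)⁻¹ *
    ∫ x in Ioo a b, (leftPot α (deriv φ) x - rightPot α (deriv φ) x) ^ 2 := by linarith
  have h4 := mul_le_mul_of_nonneg_left h3 (inv_pos.mpr hc0).le
  rw [← mul_assoc, inv_mul_cancel₀ hc0.ne', one_mul, ← mul_assoc] at h4
  refine h4.trans (le_of_eq ?_)
  congr 1
  field_simp

/-! ### The uniform bound -/

/-- The quadratic `t ↦ ∫ (u + t v)²` is nonnegative, so its discriminant is not positive. -/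
lemma sq_integral_mul_le {X : Type*} [MeasurableSpace X] {μ : Measure X} {u v : X → ℝ}
    (hu : Integrable (fun x => u x ^ 2) μ) (hv : Integrable (fun x => v x ^ 2) μ)
    (huv : Integrable (fun x => u x * v x) μ) :
    (∫ x, u x * v x ∂μ) ^ 2 ≤ (∫ x, u x ^ 2 ∂μ) * ∫ x, v x ^ 2 ∂μ := by
  have h : ∀ t : ℝ, 0 ≤ (∫ x, v x ^ 2 ∂μ) * (t * t) + (2 * ∫ x, u x * v x ∂μ) * t +
      ∫ x, u x ^ 2 ∂μ := fun t => by
    have e : ∫ x, (u x + t * v x) ^ 2 ∂μ = (∫ x, v x ^ 2 ∂μ) * (t * t) +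
        (2 * ∫ x, u x * v x ∂μ) * t + ∫ x, u x ^ 2 ∂μ := by
      have : ∀ x, (u x + t * v x) ^ 2 = t * t * v x ^ 2 + 2 * t * (u x * v x) + u x ^ 2 :=
        fun x => by ring
      simp only [this]
      have i : Integrable (fun x => t * t * v x ^ 2 + 2 * t * (u x * v x)) μ :=
        (hv.const_mul _).add (huv.const_mul _)
      rw [integral_add i hu, integral_add (hv.const_mul _) (huv.const_mul _), integral_const_mul,
        integral_const_mul]
      ring
    rw [← e]
    exact integral_nonneg fun x => sq_nonneg _
  have := discrim_le_zero h
  rw [discrim] at this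
  nlinarith

/-! ### Abel inversion and the sup norm. -/

/-- The constant `∫ t₊^(-α) (1 - t)₊^(α - 1)` of Abel's inversion formula. -/
def cAbel (α : ℝ) : ℝ := ∫ t, leftKernel α t * leftKernel (1 - α) (1 - t)

lemma cAbel_pos {α : ℝ} (hα : 0 < α) (h1 : α < 1) : 0 < cAbel α := by
  rw [cAbel, integral_pos_iff_support_of_nonneg
    (fun t => mul_nonneg (leftKernel_nonneg _ _) (leftKernel_nonneg _ _))
    (integrable_leftKernel_mul_one_sub hα h1 (by linarith) (by linarith))]
  have : Ioo (0 : ℝ) 1 ⊆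
      Function.support fun t => leftKernel α t * leftKernel (1 - α) (1 - t) := fun t ht => by
    rw [Function.mem_support, leftKernel_of_pos α ht.1, leftKernel_of_pos _ (sub_pos.mpr ht.2)]
    exact (mul_pos (Real.rpow_pos_of_pos ht.1 _)
      (Real.rpow_pos_of_pos (sub_pos.mpr ht.2) _)).ne'
  exact lt_of_lt_of_le (by simp) (measure_mono this)

/-- The exponents `α` and `1 - α` add up to `1`, so the correlation is homogeneous of degree `0`,
that is, constant for `d > 0`. -/
lemma abel_pairing {α : ℝ} (hα : 0 < α) (h1 : α < 1) {d : ℝ} (hd : d ≠ 0) :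
    (Integrable fun t => leftKernel α t * leftKernel (1 - α) (d - t)) ∧
    ∫ t, leftKernel α t * leftKernel (1 - α) (d - t) =
      (Ioi 0).indicator (fun _ => cAbel α) d := by
  rcases lt_or_gt_of_ne hd with h | h
  · have : ∀ t, leftKernel α t * leftKernel (1 - α) (d - t) = 0 := fun t => by
      rcases le_or_gt t 0 with h2 | h2
      · rw [leftKernel_of_nonpos _ h2, zero_mul]
      · rw [leftKernel_of_nonpos (1 - α) (t := d - t) (by linarith), mul_zero]
    simp only [this]
    rw [indicator_of_notMem (by simp [h.le])]
    simp
  · have := scaled_pairing (α := α) (β := 1 - α) (k := fun d t => leftKernel (1 - α) (d - t)) h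
      (fun t => by rw [← leftKernel_mul (1 - α) h]; congr 1; ring)
      (integrable_leftKernel_mul_one_sub hα h1 (by linarith) (by linarith))
    refine ⟨this.1, this.2.trans ?_⟩
    rw [indicator_of_mem (by exact h), leftKernel_of_pos _ h]
    simp [cAbel]

/-- Abel's inversion formula. -/
lemma integral_leftKernel_mul_leftPot {α : ℝ} (hα : 0 < α) (h1 : α < 1) {f : ℝ → ℝ}
    (hf : Continuous f) (hfc : HasCompactSupport f) (x : ℝ) :
    Integrable (fun y => leftKernel (1 - α) (x - y) * leftPot α f y) ∧
    ∫ y, leftKernel (1 - α) (x - y) * leftPot α f y = cAbel α * ∫ z in Iio x, f z := by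
  have hpair : ∀ z, x - z ≠ 0 →
      (Integrable fun y => leftKernel α (y - z) * leftKernel (1 - α) (x - y)) ∧
      ∫ y, leftKernel α (y - z) * leftKernel (1 - α) (x - y) =
        (Iio x).indicator (fun _ => cAbel α) z := fun z hz => by
    obtain ⟨i, e⟩ := abel_pairing hα h1 hz
    have e2 : (fun y => leftKernel α (y - z) * leftKernel (1 - α) (x - y)) =
        fun y => (fun t => leftKernel α t * leftKernel (1 - α) (x - z - t)) (y - z) := by
      funext y
      simp only
      congr 2
      ring
    rw [e2]
    refine ⟨i.comp_sub_right z, ?_⟩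
    rw [integral_sub_right_eq_self (fun t => leftKernel α t * leftKernel (1 - α) (x - z - t)), e]
    simp [indicator]
  have hne : ∀ᵐ z : ℝ, x - z ≠ 0 := by
    have : ∀ᵐ z : ℝ, z ≠ x := by simp [ae_iff]
    filter_upwards [this] with z hz h0
    exact hz (by linarith)
  have hi := (hf.integrable_of_hasCompactSupport (μ := volume) hfc).indicator (measurableSet_Iio (a := x))
  have hm : Measurable fun q : ℝ × ℝ =>
      leftKernel α (q.2 - q.1) * leftKernel (1 - α) (x - q.2) := by
    have := measurable_leftKernel α
    have := measurable_leftKernel (1 - α)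
    fun_prop
  have hΦ : Integrable (fun q : ℝ × ℝ =>
      f q.1 * (leftKernel α (q.2 - q.1) * leftKernel (1 - α) (x - q.2)))
      ((volume : Measure ℝ).prod volume) := by
    rw [integrable_prod_iff]
    · refine ⟨?_, ?_⟩
      · filter_upwards [hne] with z hz
        exact (hpair z hz).1.const_mul _
      · refine (hi.norm.const_mul (cAbel α)).congr ?_
        filter_upwards [hne] with z hz
        have : ∀ y, ‖f z * (leftKernel α (y - z) * leftKernel (1 - α) (x - y))‖ =
            ‖f z‖ * (leftKernel α (y - z) * leftKernel (1 - α) (x - y)) := fun y => by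
          rw [norm_mul, Real.norm_of_nonneg (mul_nonneg (leftKernel_nonneg _ _)
            (leftKernel_nonneg _ _))]
        simp only [this]
        rw [integral_const_mul, (hpair z hz).2]
        by_cases hz2 : z ∈ Iio x
        · rw [indicator_of_mem hz2, indicator_of_mem hz2, mul_comm]
        · rw [indicator_of_notMem hz2, indicator_of_notMem hz2]
          simp
    · have h2 : Measurable fun q : ℝ × ℝ => f q.1 := by
        have := hf.measurable
        fun_prop
      exact (h2.mul hm).aestronglyMeasurable
  have e3 : ∀ y, ∫ z, f z * (leftKernel α (y - z) * leftKernel (1 - α) (x - y)) =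
      leftKernel (1 - α) (x - y) * leftPot α f y := fun y => by
    rw [leftPot, ← integral_const_mul]
    congr 1 with z
    ring
  refine ⟨hΦ.integral_prod_right.congr (Filter.Eventually.of_forall e3), ?_⟩
  calc ∫ y, leftKernel (1 - α) (x - y) * leftPot α f y
      = ∫ y, ∫ z, f z * (leftKernel α (y - z) * leftKernel (1 - α) (x - y)) := by
        simp only [e3]
    _ = ∫ z, ∫ y, f z * (leftKernel α (y - z) * leftKernel (1 - α) (x - y)) :=
        (integral_integral_swap hΦ).symm
    _ = ∫ z, cAbel α * (Iio x).indicator f z := by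
        refine integral_congr_ae ?_
        filter_upwards [hne] with z hz
        rw [integral_const_mul, (hpair z hz).2]
        by_cases hz2 : z ∈ Iio x
        · rw [indicator_of_mem hz2, indicator_of_mem hz2, mul_comm]
        · rw [indicator_of_notMem hz2, indicator_of_notMem hz2]
          simp
    _ = _ := by rw [integral_const_mul, integral_indicator measurableSet_Iio]

/-- Abel inversion recovers `φ x` from `L φ'` through the kernel `(x - y)₊ ^ (α - 1)`, whose square
is locally integrable because `2 α - 2 > -1`; Cauchy–Schwarz concludes. -/
lemma exists_sq_le {α : ℝ} (hα : 1 / 2 < α) (h1 : α < 1) (a b : ℝ) :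
    ∃ C : ℝ, 0 ≤ C ∧ ∀ φ, IsTest a b φ → ∀ x,
      φ x ^ 2 ≤ C * ∫ y, leftPot α (deriv φ) y ^ 2 := by
  have hA := cAbel_pos (by linarith) h1 (α := α)
  have hκ : Integrable ((Ioc 0 (b - a)).indicator fun t : ℝ => t ^ (2 * α - 2)) :=
    (integrableOn_Ioc_rpow (by linarith) _).integrable_indicator measurableSet_Ioc
  obtain ⟨I, hI⟩ : ∃ I, I = ∫ t, (Ioc 0 (b - a)).indicator (fun t : ℝ => t ^ (2 * α - 2)) t :=
    ⟨_, rfl⟩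
  have hI0 : 0 ≤ I := hI ▸ integral_nonneg fun t =>
    indicator_nonneg (fun x hx => Real.rpow_nonneg hx.1.le _) t
  refine ⟨(cAbel α ^ 2)⁻¹ * I, by positivity, fun φ h x => ?_⟩
  have hd := h.isTest_deriv
  obtain ⟨iP, -⟩ := integral_leftPot_sq hα h1 hd.contDiff.continuous hd.hasCompactSupport
  have hP : 0 ≤ ∫ y, leftPot α (deriv φ) y ^ 2 := integral_nonneg fun y => sq_nonneg _
  by_cases hx : x ∈ Ioo a b
  swap
  · rw [h.eq_zero hx, zero_pow two_ne_zero]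
    positivity
  obtain ⟨i, e⟩ := integral_leftKernel_mul_leftPot (by linarith) h1 hd.contDiff.continuous
    hd.hasCompactSupport x
  have e2 : ∫ z in Iio x, deriv φ z = φ x := by
    rw [← integral_Iic_eq_integral_Iio]
    exact h.hasCompactSupport.integral_Iic_deriv_eq (h.contDiff.of_le (by simp)) x
  rw [e2] at e
  -- The full kernel is not square integrable at infinity. Cutting it off at `b - a` loses nothing,
  -- because `L φ'` vanishes left of `a` and `x < b`.
  let u : ℝ → ℝ := fun y => (Ioc 0 (b - a)).indicator (fun t : ℝ => t ^ (α - 1)) (x - y)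
  have eu : ∀ y, leftKernel (1 - α) (x - y) * leftPot α (deriv φ) y =
      u y * leftPot α (deriv φ) y := fun y => by
    rcases le_or_gt y a with hy | hy
    · rw [leftPot_eq_zero (fun y hy => hd.eq_zero hy) hy, mul_zero, mul_zero]
    · congr 1
      simp only [u, leftKernel, neg_sub]
      by_cases hxy : 0 < x - y
      · rw [indicator_of_mem (by exact hxy), indicator_of_mem]
        exact ⟨hxy, by linarith [hx.2]⟩
      · rw [indicator_of_notMem (by exact hxy), indicator_of_notMem fun h => hxy h.1]
  have eu2 : ∀ y, u y ^ 2 =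
      (Ioc 0 (b - a)).indicator (fun t : ℝ => t ^ (2 * α - 2)) (x - y) := fun y => by
    simp only [u]
    by_cases hxy : x - y ∈ Ioc 0 (b - a)
    · rw [indicator_of_mem hxy, indicator_of_mem hxy, ← Real.rpow_natCast, ← Real.rpow_mul hxy.1.le]
      congr 1
      push_cast
      ring
    · rw [indicator_of_notMem hxy, indicator_of_notMem hxy]
      simp
  simp only [eu] at i e
  have hu : Integrable fun y => u y ^ 2 := by
    simp only [eu2]
    exact hκ.comp_sub_left x
  have key := sq_integral_mul_le hu iP i
  rw [e] at key
  simp only [eu2] at key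
  rw [integral_sub_left_eq_self _ volume x, ← hI, mul_pow] at key
  rw [mul_assoc, ← div_eq_inv_mul, le_div_iff₀ (by positivity)]
  linarith

/-! ### Polynomial solutions on the interval `(-1, 1)` -/

/-- The odd kernel `sgn t |t| ^ (-α)`. -/
def oddKernel (α t : ℝ) : ℝ := leftKernel α t - leftKernel α (-t)

lemma oddKernel_neg (α t : ℝ) : oddKernel α (-t) = -oddKernel α t := by
  rw [oddKernel, oddKernel, neg_neg, neg_sub]

lemma oddKernel_of_pos (α : ℝ) {t : ℝ} (ht : 0 < t) : oddKernel α t = t ^ (-α) := by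
  rw [oddKernel, leftKernel_of_pos α ht, leftKernel_of_nonpos α (neg_nonpos.mpr ht.le), sub_zero]

lemma oddKernel_zero (α : ℝ) : oddKernel α 0 = 0 := by simp [oddKernel]

lemma abs_oddKernel (α : ℝ) {t : ℝ} (ht : t ≠ 0) : |oddKernel α t| = |t| ^ (-α) := by
  rcases lt_or_gt_of_ne ht with h | h
  · rw [← neg_neg t, oddKernel_neg, abs_neg, oddKernel_of_pos α (neg_pos.mpr h), neg_neg,
      abs_of_neg h, abs_of_pos (Real.rpow_pos_of_pos (neg_pos.mpr h) _)]
  · rw [oddKernel_of_pos α h, abs_of_pos h, abs_of_pos (Real.rpow_pos_of_pos h _)]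

lemma oddKernel_mul_self (α : ℝ) {t : ℝ} (ht : t ≠ 0) : oddKernel α t * t = |t| ^ (1 - α) := by
  rcases lt_or_gt_of_ne ht with h | h
  · have hp := neg_pos.mpr h
    rw [← neg_neg t, oddKernel_neg, neg_mul_neg, oddKernel_of_pos α hp, neg_neg,
      abs_of_neg h, ← Real.rpow_add_one hp.ne']
    congr 1
    ring
  · rw [oddKernel_of_pos α h, abs_of_pos h, ← Real.rpow_add_one h.ne']
    congr 1
    ring

lemma measurable_oddKernel (α : ℝ) : Measurable (oddKernel α) :=
  (measurable_leftKernel α).sub ((measurable_leftKernel α).comp measurable_neg)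

lemma locallyIntegrable_oddKernel {α : ℝ} (h1 : α < 1) : LocallyIntegrable (oddKernel α) :=
  (leftKernel_locallyIntegrable h1).sub (locallyIntegrable_leftKernel_neg h1)

lemma integrableOn_one_sub_sq_rpow {σ : ℝ} (hσ : -1 < σ) (hσ0 : σ ≤ 0) :
    IntegrableOn (fun y : ℝ => (1 - y ^ 2) ^ σ) (Ioo (-1) 1) := by
  have h : IntervalIntegrable (fun t : ℝ => t ^ σ) volume 0 2 :=
    intervalIntegral.intervalIntegrable_rpow' hσ
  have h2 := h.comp_sub_left 1
  have h3 := h.comp_add_right 1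
  norm_num at h2 h3
  rw [intervalIntegrable_iff_integrableOn_Ioo_of_le (by norm_num)] at h3
  have h2' := h2.symm
  rw [intervalIntegrable_iff_integrableOn_Ioo_of_le (by norm_num)] at h2'
  refine (h2'.add h3).mono' ?_ ?_
  · exact Measurable.aestronglyMeasurable (by fun_prop)
  · filter_upwards [ae_restrict_mem measurableSet_Ioo] with y hy
    have p1 : 0 < 1 - y := by linarith [hy.2]
    have p2 : 0 < y + 1 := by linarith [hy.1]
    have e : 1 - y ^ 2 = (1 - y) * (y + 1) := by ring
    have q1 := Real.rpow_pos_of_pos p1 σ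
    have q2 := Real.rpow_pos_of_pos p2 σ
    rw [e, Real.mul_rpow p1.le p2.le, Real.norm_of_nonneg (by positivity)]
    simp only [Pi.add_apply]
    rcases le_or_gt 0 y with h0 | h0
    · have : (y + 1) ^ σ ≤ 1 := Real.rpow_le_one_of_one_le_of_nonpos (by linarith) hσ0
      nlinarith
    · have : (1 - y) ^ σ ≤ 1 := Real.rpow_le_one_of_one_le_of_nonpos (by linarith) hσ0
      nlinarith

lemma one_sub_sq_pos {y : ℝ} (hy : y ∈ Ioo (-1 : ℝ) 1) : 0 < 1 - y ^ 2 := by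
  nlinarith [hy.1, hy.2]

/-- The weight `(1 - y²)₊ ^ (α / 2) yⁿ`. -/
def wgt (α : ℝ) (n : ℕ) (y : ℝ) : ℝ := max (1 - y ^ 2) 0 ^ (α / 2) * y ^ n

/-- The derivative of `wgt α n`. -/
def wgtDeriv (α : ℝ) (n : ℕ) : ℝ → ℝ := (Ioo (-1 : ℝ) 1).indicator fun y =>
  n * ((1 - y ^ 2) ^ (α / 2) * y ^ (n - 1)) - α * ((1 - y ^ 2) ^ (α / 2 - 1) * y ^ (n + 1))

/-- The potential of `(1 - y²) ^ (α / 2 - 1) yⁿ`. -/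
def vPot (α : ℝ) (n : ℕ) (x : ℝ) : ℝ :=
  ∫ y in Ioo (-1 : ℝ) 1, oddKernel α (x - y) * ((1 - y ^ 2) ^ (α / 2 - 1) * y ^ n)

/-- The potential of `wgt α n`. -/
def fPot (α : ℝ) (n : ℕ) (x : ℝ) : ℝ := ∫ y, oddKernel α (x - y) * wgt α n y

/-- The potential of `wgtDeriv α n`. -/
def qPot (α : ℝ) (n : ℕ) (x : ℝ) : ℝ := ∫ y, oddKernel α (x - y) * wgtDeriv α n y

variable {α : ℝ}

lemma continuous_wgt (hα : 0 < α) (n : ℕ) : Continuous (wgt α n) := by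
  refine Continuous.mul ?_ (continuous_pow n)
  exact ((continuous_const.sub (continuous_pow 2)).max continuous_const).rpow_const
    fun _ => Or.inr (by positivity)

lemma wgt_eq_zero (hα : 0 < α) (n : ℕ) {y : ℝ} (hy : y ∉ Ioo (-1 : ℝ) 1) : wgt α n y = 0 := by
  have : 1 - y ^ 2 ≤ 0 := by
    rw [mem_Ioo, not_and_or, not_lt, not_lt] at hy
    rcases hy with h | h <;> nlinarith
  rw [wgt, max_eq_right this, Real.zero_rpow (by positivity), zero_mul]

lemma wgt_of_mem (n : ℕ) {y : ℝ} (hy : y ∈ Ioo (-1 : ℝ) 1) :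
    wgt α n y = (1 - y ^ 2) ^ (α / 2) * y ^ n := by
  rw [wgt, max_eq_left (one_sub_sq_pos hy).le]

lemma hasCompactSupport_wgt (hα : 0 < α) (n : ℕ) : HasCompactSupport (wgt α n) :=
  HasCompactSupport.intro (isCompact_Icc (a := -1) (b := 1)) fun _ hy =>
    wgt_eq_zero hα n fun h => hy (Ioo_subset_Icc_self h)

lemma hasDerivAt_wgt (hα : 0 < α) (n : ℕ) {y : ℝ} (h : y ≠ 1) (h' : y ≠ -1) :
    HasDerivAt (wgt α n) (wgtDeriv α n y) y := by
  by_cases hy : y ∈ Ioo (-1 : ℝ) 1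
  · have hp := one_sub_sq_pos hy
    have h2 : HasDerivAt (fun y : ℝ => 1 - y ^ 2) (-(2 * y)) y := by
      simpa using (hasDerivAt_pow 2 y).const_sub 1
    have h3 := (h2.rpow_const (p := α / 2) (Or.inl hp.ne')).mul (hasDerivAt_pow n y)
    have h4 := h3.congr_of_eventuallyEq (f₁ := wgt α n) (by
      filter_upwards [isOpen_Ioo.mem_nhds hy] with z hz
      exact wgt_of_mem n hz)
    refine h4.congr_deriv ?_
    rw [wgtDeriv, indicator_of_mem hy]
    ring
  · rw [wgtDeriv, indicator_of_notMem hy]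
    refine (hasDerivAt_const y (0 : ℝ)).congr_of_eventuallyEq ?_
    have hy' : y ∈ (Icc (-1 : ℝ) 1)ᶜ := fun h0 =>
      hy ⟨lt_of_le_of_ne h0.1 (Ne.symm h'), lt_of_le_of_ne h0.2 h⟩
    filter_upwards [isClosed_Icc.isOpen_compl.mem_nhds hy'] with z hz
    exact wgt_eq_zero hα n fun h0 => hz (Ioo_subset_Icc_self h0)

lemma abs_wgtDeriv_le (hα : 0 < α) (h1 : α < 1) (n : ℕ) {y : ℝ} (hy : y ∈ Ioo (-1 : ℝ) 1) :
    |wgtDeriv α n y| ≤ (n + 1) * (1 - y ^ 2) ^ (α / 2 - 1) := by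
  rw [wgtDeriv, indicator_of_mem hy]
  have hp := one_sub_sq_pos hy
  have hy1 : |y| ≤ 1 := abs_le.mpr ⟨hy.1.le, hy.2.le⟩
  have hpow : ∀ k : ℕ, |y ^ k| ≤ 1 := fun k => by
    rw [abs_pow]
    exact pow_le_one₀ (abs_nonneg _) hy1
  have a1 : (1 - y ^ 2) ^ (α / 2) ≤ 1 :=
    Real.rpow_le_one hp.le (by nlinarith) (by positivity)
  have a2 : 1 ≤ (1 - y ^ 2) ^ (α / 2 - 1) :=
    Real.one_le_rpow_of_pos_of_le_one_of_nonpos hp (by nlinarith) (by linarith)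
  have a3 : 0 < (1 - y ^ 2) ^ (α / 2) := Real.rpow_pos_of_pos hp _
  have a4 : 0 < (1 - y ^ 2) ^ (α / 2 - 1) := by linarith
  refine (abs_sub _ _).trans ?_
  rw [abs_mul, abs_mul, abs_mul, abs_mul, abs_of_pos a3, abs_of_pos a4, abs_of_pos hα,
    Nat.abs_cast]
  have b1 : (1 - y ^ 2) ^ (α / 2) * |y ^ (n - 1)| ≤ (1 - y ^ 2) ^ (α / 2 - 1) := by
    calc _ ≤ 1 * 1 := mul_le_mul a1 (hpow _) (abs_nonneg _) zero_le_one
      _ ≤ _ := by linarith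
  have b2 : α * ((1 - y ^ 2) ^ (α / 2 - 1) * |y ^ (n + 1)|) ≤ (1 - y ^ 2) ^ (α / 2 - 1) := by
    calc _ ≤ 1 * ((1 - y ^ 2) ^ (α / 2 - 1) * 1) := by
          gcongr
          exact hpow _
      _ = _ := by ring
  have b3 := mul_le_mul_of_nonneg_left b1 (Nat.cast_nonneg (α := ℝ) n)
  linarith

lemma measurable_wgtDeriv (α : ℝ) (n : ℕ) : Measurable (wgtDeriv α n) := by
  refine Measurable.indicator ?_ measurableSet_Ioo
  fun_prop

lemma integrable_wgtDeriv (hα : 0 < α) (h1 : α < 1) (n : ℕ) : Integrable (wgtDeriv α n) := by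
  have h0 : IntegrableOn (fun y : ℝ => ((n : ℝ) + 1) * (1 - y ^ 2) ^ (α / 2 - 1)) (Ioo (-1) 1) :=
    (integrableOn_one_sub_sq_rpow (by linarith) (by linarith)).const_mul _
  have h := h0.integrable_indicator measurableSet_Ioo
  refine h.mono' (measurable_wgtDeriv α n).aestronglyMeasurable
    (Filter.Eventually.of_forall fun y => ?_)
  by_cases hy : y ∈ Ioo (-1 : ℝ) 1
  · rw [indicator_of_mem hy]
    exact abs_wgtDeriv_le hα h1 n hy
  · rw [indicator_of_notMem hy, wgtDeriv, indicator_of_notMem hy, norm_zero]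

lemma integral_wgtDeriv (hα : 0 < α) (h1 : α < 1) (n : ℕ) {c d : ℝ} (hcd : c ≤ d) :
    ∫ y in c..d, wgtDeriv α n y = wgt α n d - wgt α n c :=
  integral_eq_of_hasDerivAt_off_countable_of_le (wgt α n) (wgtDeriv α n) hcd
    (s := {1, -1}) (by simp) (continuous_wgt hα n).continuousOn
    (fun y hy => hasDerivAt_wgt hα n (fun h => hy.2 (by simp [h])) (fun h => hy.2 (by simp [h])))
    (integrable_wgtDeriv hα h1 n).intervalIntegrable

/-- Integrability of the potentials at interior points. -/
lemma integrableOn_oddKernel_mul (hα : 0 < α) (h1 : α < 1) {x : ℝ} (hx : x ∈ Ioo (-1 : ℝ) 1)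
    {g : ℝ → ℝ} (hg : Continuous g) {σ : ℝ} (hσ : -1 < σ) (hσ0 : σ ≤ 0) :
    IntegrableOn (fun y => oddKernel α (x - y) * ((1 - y ^ 2) ^ σ * g y)) (Ioo (-1) 1) := by
  -- Half the distance from `x` to the end points separates the singularities: for `|x - y| ≥ d` the
  -- kernel is bounded, and otherwise `1 - y² ≥ d` bounds the weight.
  have hd : 0 < (1 - |x|) / 2 := by
    have := abs_lt.mpr ⟨hx.1, hx.2⟩
    linarith
  obtain ⟨d, hdd⟩ : ∃ d, d = (1 - |x|) / 2 := ⟨_, rfl⟩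
  rw [← hdd] at hd
  have i1 : IntegrableOn (fun y => oddKernel α (x - y)) (Ioo (-1) 1) := by
    have h := ((locallyIntegrable_oddKernel h1).integrableOn_isCompact
      (isCompact_Icc (a := x - 1) (b := x + 1))).integrable_indicator measurableSet_Icc
    refine (h.comp_sub_left x).integrableOn.congr_fun (fun y hy => ?_) measurableSet_Ioo
    simp only
    rw [indicator_of_mem]
    exact ⟨by linarith [hy.2], by linarith [hy.1]⟩
  have i2 := integrableOn_one_sub_sq_rpow hσ hσ0
  have hm : Measurable fun y => oddKernel α (x - y) * (1 - y ^ 2) ^ σ := by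
    have := measurable_oddKernel α
    fun_prop
  have i3 : IntegrableOn (fun y => oddKernel α (x - y) * (1 - y ^ 2) ^ σ) (Ioo (-1) 1) := by
    refine ((i2.const_mul (d ^ (-α))).add (i1.norm.const_mul (d ^ σ))).mono'
      hm.aestronglyMeasurable ?_
    filter_upwards [ae_restrict_mem measurableSet_Ioo] with y hy
    have hp := one_sub_sq_pos hy
    have a1 := Real.rpow_pos_of_pos hp σ
    have a2 : 0 < d ^ (-α) := Real.rpow_pos_of_pos hd _
    have a3 : 0 < d ^ σ := Real.rpow_pos_of_pos hd _
    have a4 : 0 ≤ |oddKernel α (x - y)| := abs_nonneg _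
    simp only [Pi.add_apply]
    rw [norm_mul, Real.norm_eq_abs, Real.norm_of_nonneg a1.le]
    rcases le_or_gt d |x - y| with h | h
    · have h0 : x - y ≠ 0 := fun h0 => by
        rw [h0, abs_zero] at h
        linarith
      have : |oddKernel α (x - y)| ≤ d ^ (-α) := by
        rw [abs_oddKernel α h0]
        exact Real.rpow_le_rpow_of_nonpos hd h (by linarith)
      nlinarith
    · have b1 : |y| ≤ |x| + |x - y| := by
        calc |y| = |x - (x - y)| := by rw [sub_sub_cancel]
          _ ≤ _ := abs_sub _ _
      have b2 : d ≤ 1 - y ^ 2 := by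
        have := abs_nonneg y
        have hy1 : |y| < 1 := abs_lt.mpr ⟨hy.1, hy.2⟩
        rw [← sq_abs y]
        nlinarith
      have : (1 - y ^ 2) ^ σ ≤ d ^ σ := Real.rpow_le_rpow_of_nonpos hd b2 hσ0
      nlinarith
  obtain ⟨C, hC⟩ := (isCompact_Icc (a := (-1 : ℝ)) (b := 1)).exists_bound_of_continuousOn
    hg.continuousOn
  have i4 := i3.mul_bdd (c := C) (g := g) hg.aestronglyMeasurable (by
    filter_upwards [ae_restrict_mem measurableSet_Ioo] with y hy
    exact hC y (Ioo_subset_Icc_self hy))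
  refine i4.congr (Filter.Eventually.of_forall fun y => ?_)
  simp only
  ring

lemma integrableOn_vPot (hα : 0 < α) (h1 : α < 1) (n : ℕ) {x : ℝ} (hx : x ∈ Ioo (-1 : ℝ) 1) :
    IntegrableOn (fun y => oddKernel α (x - y) * ((1 - y ^ 2) ^ (α / 2 - 1) * y ^ n))
      (Ioo (-1) 1) :=
  integrableOn_oddKernel_mul hα h1 hx (continuous_pow n) (by linarith) (by linarith)

lemma fPot_eq (hα : 0 < α) (n : ℕ) (x : ℝ) : fPot α n x =
    ∫ y in Ioo (-1 : ℝ) 1, oddKernel α (x - y) * ((1 - y ^ 2) ^ (α / 2) * y ^ n) := by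
  rw [fPot, ← setIntegral_eq_integral_of_forall_compl_eq_zero (s := Ioo (-1 : ℝ) 1)
    fun y hy => by rw [wgt_eq_zero hα n hy, mul_zero]]
  exact setIntegral_congr_fun measurableSet_Ioo fun y hy => by simp only [wgt_of_mem n hy]

lemma rpow_half_eq {y : ℝ} (hy : y ∈ Ioo (-1 : ℝ) 1) :
    (1 - y ^ 2) ^ (α / 2) = (1 - y ^ 2) ^ (α / 2 - 1) * (1 - y ^ 2) := by
  rw [← Real.rpow_add_one (one_sub_sq_pos hy).ne', sub_add_cancel]

lemma integrableOn_fPot (hα : 0 < α) (h1 : α < 1) (n : ℕ) {x : ℝ} (hx : x ∈ Ioo (-1 : ℝ) 1) :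
    IntegrableOn (fun y => oddKernel α (x - y) * ((1 - y ^ 2) ^ (α / 2) * y ^ n))
      (Ioo (-1) 1) := by
  refine (integrableOn_oddKernel_mul hα h1 hx (g := fun y => (1 - y ^ 2) * y ^ n)
    (σ := α / 2 - 1) (by fun_prop) (by linarith) (by linarith)).congr_fun (fun y hy => ?_)
    measurableSet_Ioo
  rw [rpow_half_eq hy]
  ring

lemma fPot_eq_sub (hα : 0 < α) (h1 : α < 1) (n : ℕ) {x : ℝ} (hx : x ∈ Ioo (-1 : ℝ) 1) :
    fPot α n x = vPot α n x - vPot α (n + 2) x := by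
  rw [fPot_eq hα, vPot, vPot, ← integral_sub (integrableOn_vPot hα h1 n hx)
    (integrableOn_vPot hα h1 (n + 2) hx)]
  refine setIntegral_congr_fun measurableSet_Ioo fun y hy => ?_
  rw [rpow_half_eq hy]
  ring

lemma setIntegral_wgtDeriv (α : ℝ) (n : ℕ) (k : ℝ → ℝ) : ∫ y, k y * wgtDeriv α n y =
    ∫ y in Ioo (-1 : ℝ) 1, k y * (n * ((1 - y ^ 2) ^ (α / 2) * y ^ (n - 1)) -
      α * ((1 - y ^ 2) ^ (α / 2 - 1) * y ^ (n + 1))) := by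
  rw [← setIntegral_eq_integral_of_forall_compl_eq_zero (s := Ioo (-1 : ℝ) 1)
    fun y hy => by rw [wgtDeriv, indicator_of_notMem hy, mul_zero]]
  exact setIntegral_congr_fun measurableSet_Ioo fun y hy => by
    simp only [wgtDeriv, indicator_of_mem hy]

lemma qPot_eq (hα : 0 < α) (h1 : α < 1) (n : ℕ) {x : ℝ} (hx : x ∈ Ioo (-1 : ℝ) 1) :
    qPot α n x = n * fPot α (n - 1) x - α * vPot α (n + 1) x := by
  rw [qPot, setIntegral_wgtDeriv, fPot_eq hα, vPot, ← integral_const_mul, ← integral_const_mul,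
    ← integral_sub ((integrableOn_fPot hα h1 (n - 1) hx).const_mul _)
    ((integrableOn_vPot hα h1 (n + 1) hx).const_mul _)]
  congr 1 with y
  ring

lemma hasDerivAt_abs_rpow {x y : ℝ} (h : y ≠ x) :
    HasDerivAt (fun y => |x - y| ^ (1 - α)) (-((1 - α) * oddKernel α (x - y))) y := by
  rcases lt_or_gt_of_ne h with hlt | hgt
  · have hpos : 0 < x - y := sub_pos.mpr hlt
    have h2 := ((hasDerivAt_id y).const_sub x).rpow_const (p := 1 - α) (Or.inl hpos.ne')
    have h3 := h2.congr_of_eventuallyEq (f₁ := fun y => |x - y| ^ (1 - α)) (by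
      filter_upwards [Iio_mem_nhds hlt] with z hz
      rw [abs_of_pos (sub_pos.mpr hz)]
      rfl)
    refine h3.congr_deriv ?_
    rw [oddKernel_of_pos α hpos, show 1 - α - 1 = -α by ring]
    simp only [id]
    ring
  · have hpos : 0 < y - x := sub_pos.mpr hgt
    have h2 := ((hasDerivAt_id y).sub_const x).rpow_const (p := 1 - α) (Or.inl hpos.ne')
    have h3 := h2.congr_of_eventuallyEq (f₁ := fun y => |x - y| ^ (1 - α)) (by
      filter_upwards [Ioi_mem_nhds hgt] with z hz
      rw [abs_sub_comm, abs_of_pos (sub_pos.mpr hz)]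
      rfl)
    refine h3.congr_deriv ?_
    rw [← neg_sub y x, oddKernel_neg, oddKernel_of_pos α hpos, show 1 - α - 1 = -α by ring]
    simp

/-- Euler's relation for the homogeneous kernel. -/
lemma mul_qPot (hα : 0 < α) (h1 : α < 1) (n : ℕ) {x : ℝ} (hx : x ∈ Ioo (-1 : ℝ) 1) :
    x * qPot α n x = (n + 1) * fPot α n x - α * vPot α n x := by
  have iF := integrableOn_fPot hα h1 n hx
  have iF1 := integrableOn_fPot hα h1 (n - 1) hx
  have iV1 := integrableOn_vPot hα h1 (n + 1) hx
  have iV2 := integrableOn_vPot hα h1 (n + 2) hx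
  have iq : IntegrableOn (fun y => oddKernel α (x - y) *
      (n * ((1 - y ^ 2) ^ (α / 2) * y ^ (n - 1)) -
      α * ((1 - y ^ 2) ^ (α / 2 - 1) * y ^ (n + 1)))) (Ioo (-1) 1) := by
    refine ((iF1.const_mul (n : ℝ)).sub (iV1.const_mul α)).congr
      (Filter.Eventually.of_forall fun y => ?_)
    simp only [Pi.sub_apply]
    ring
  -- For `n = 0` the truncated exponent `n - 1` is wrong, but the coefficient `n` annihilates the
  -- term.
  have hn : ∀ y : ℝ, n * (y * y ^ (n - 1)) = n * y ^ n := fun y => by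
    rcases n with _ | n
    · simp
    · simp only [Nat.add_sub_cancel]
      ring
  have e1 : ∀ y, y ≠ x → |x - y| ^ (1 - α) * wgtDeriv α n y =
      (Ioo (-1 : ℝ) 1).indicator (fun y => x * (oddKernel α (x - y) *
      (n * ((1 - y ^ 2) ^ (α / 2) * y ^ (n - 1)) -
      α * ((1 - y ^ 2) ^ (α / 2 - 1) * y ^ (n + 1)))) -
      n * (oddKernel α (x - y) * ((1 - y ^ 2) ^ (α / 2) * y ^ n)) +
      α * (oddKernel α (x - y) * ((1 - y ^ 2) ^ (α / 2 - 1) * y ^ (n + 2)))) y := fun y hy => by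
    by_cases hy1 : y ∈ Ioo (-1 : ℝ) 1
    · rw [indicator_of_mem hy1, wgtDeriv, indicator_of_mem hy1,
        ← oddKernel_mul_self α (sub_ne_zero.mpr hy.symm)]
      linear_combination (-oddKernel α (x - y) * (1 - y ^ 2) ^ (α / 2)) * hn y
    · rw [indicator_of_notMem hy1, wgtDeriv, indicator_of_notMem hy1, mul_zero]
  have i3 : IntegrableOn (fun y => x * (oddKernel α (x - y) *
      (n * ((1 - y ^ 2) ^ (α / 2) * y ^ (n - 1)) -
      α * ((1 - y ^ 2) ^ (α / 2 - 1) * y ^ (n + 1)))) -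
      n * (oddKernel α (x - y) * ((1 - y ^ 2) ^ (α / 2) * y ^ n))) (Ioo (-1) 1) :=
    (iq.const_mul x).sub (iF.const_mul _)
  have i4 : IntegrableOn (fun y => x * (oddKernel α (x - y) *
      (n * ((1 - y ^ 2) ^ (α / 2) * y ^ (n - 1)) -
      α * ((1 - y ^ 2) ^ (α / 2 - 1) * y ^ (n + 1)))) -
      n * (oddKernel α (x - y) * ((1 - y ^ 2) ^ (α / 2) * y ^ n)) +
      α * (oddKernel α (x - y) * ((1 - y ^ 2) ^ (α / 2 - 1) * y ^ (n + 2)))) (Ioo (-1) 1) :=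
    i3.add (iV2.const_mul α)
  have hne : ∀ᵐ y : ℝ, y ≠ x := by simp [ae_iff]
  have i5 : Integrable fun y => |x - y| ^ (1 - α) * wgtDeriv α n y := by
    refine (i4.integrable_indicator measurableSet_Ioo).congr ?_
    filter_upwards [hne] with y hy
    exact (e1 y hy).symm
  have i6 : Integrable fun y => oddKernel α (x - y) * wgt α n y := by
    refine (iF.integrable_indicator measurableSet_Ioo).congr
      (Filter.Eventually.of_forall fun y => ?_)
    change _ = oddKernel α (x - y) * wgt α n y
    by_cases hy1 : y ∈ Ioo (-1 : ℝ) 1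
    · rw [indicator_of_mem hy1, wgt_of_mem n hy1]
    · rw [indicator_of_notMem hy1, wgt_eq_zero hα n hy1, mul_zero]
  have e2 : ∫ y, |x - y| ^ (1 - α) * wgtDeriv α n y =
      x * qPot α n x - n * fPot α n x + α * vPot α (n + 2) x := by
    have : ∫ y, |x - y| ^ (1 - α) * wgtDeriv α n y = ∫ y, (Ioo (-1 : ℝ) 1).indicator
        (fun y => x * (oddKernel α (x - y) *
        (n * ((1 - y ^ 2) ^ (α / 2) * y ^ (n - 1)) -
        α * ((1 - y ^ 2) ^ (α / 2 - 1) * y ^ (n + 1)))) -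
        n * (oddKernel α (x - y) * ((1 - y ^ 2) ^ (α / 2) * y ^ n)) +
        α * (oddKernel α (x - y) * ((1 - y ^ 2) ^ (α / 2 - 1) * y ^ (n + 2)))) y := by
      refine integral_congr_ae ?_
      filter_upwards [hne] with y hy
      exact e1 y hy
    rw [this, integral_indicator measurableSet_Ioo, integral_add i3 (iV2.const_mul α),
      integral_sub (iq.const_mul x) (iF.const_mul _), integral_const_mul, integral_const_mul,
      integral_const_mul, qPot, setIntegral_wgtDeriv, fPot_eq hα, vPot]
  -- The total derivative of `|x - y| ^ (1 - α)` times the weight integrates to zero, since the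
  -- weight vanishes at `±1`. Expanding `|x - y| ^ (1 - α)` as the odd kernel times `x - y` turns
  -- this into the claim.
  have key := integral_eq_of_hasDerivAt_off_countable_of_le
    (fun y => |x - y| ^ (1 - α) * wgt α n y)
    (fun y => |x - y| ^ (1 - α) * wgtDeriv α n y -
      (1 - α) * (oddKernel α (x - y) * wgt α n y)) (show (-1 : ℝ) ≤ 1 by norm_num)
    (s := {x}) (countable_singleton x) (by
      refine Continuous.continuousOn (Continuous.mul ?_ (continuous_wgt hα n))
      exact ((continuous_const.sub continuous_id).abs).rpow_const fun _ => Or.inr (by linarith))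
    (fun y hy => by
      refine ((hasDerivAt_abs_rpow hy.2).mul
        (hasDerivAt_wgt hα n hy.1.2.ne hy.1.1.ne')).congr_deriv ?_
      ring) (i5.sub (i6.const_mul _)).intervalIntegrable
  rw [wgt_eq_zero hα n (by simp), wgt_eq_zero hα n (by simp), mul_zero, mul_zero, sub_zero,
    intervalIntegral.integral_eq_integral_of_support_subset, integral_sub i5 (i6.const_mul _),
    integral_const_mul, e2] at key
  · have e3 := fPot_eq_sub hα h1 n hx
    have e4 : ∫ y, oddKernel α (x - y) * wgt α n y = fPot α n x := rfl
    rw [e4] at key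
    linear_combination key - α * e3
  · intro y hy
    by_contra hn
    have hn' : y ∉ Ioo (-1 : ℝ) 1 := fun h' => hn (Ioo_subset_Ioc_self h')
    exact hy (by simp [wgt_eq_zero hα n hn', wgtDeriv, indicator_of_notMem hn'])

lemma continuous_fPot (hα : 0 < α) (h1 : α < 1) (n : ℕ) : Continuous (fPot α n) := by
  have h := (hasCompactSupport_wgt hα n).continuous_convolution_right
    (ContinuousLinearMap.mul ℝ ℝ) (locallyIntegrable_oddKernel h1) (continuous_wgt hα n)
  convert h using 1
  funext x
  rw [convolution_eq_swap]
  rfl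

/-- `qPot` is the weak derivative of `fPot`. -/
lemma integral_qPot (hα : 0 < α) (h1 : α < 1) (n : ℕ) {c d : ℝ} (hcd : c ≤ d) :
    ∫ x in c..d, qPot α n x = fPot α n d - fPot α n c := by
  -- For `x ∈ [c, d]` and `x - t ∈ (-1, 1)` one has `|t| ≤ R`, so truncating the kernel at `R`
  -- changes no value on `[c, d]` and makes it integrable.
  obtain ⟨R, hR⟩ : ∃ R, R = |c| + |d| + 1 := ⟨_, rfl⟩
  have hK := ((locallyIntegrable_oddKernel h1).integrableOn_isCompact
    (isCompact_Icc (a := -R) (b := R))).integrable_indicator measurableSet_Icc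
  have hconv := hK.convolution_integrand (ContinuousLinearMap.mul ℝ ℝ)
    (integrable_wgtDeriv hα h1 n)
  have hcR := neg_abs_le c
  have hdR := le_abs_self d
  have hcR' := le_abs_self c
  have hdR' := neg_abs_le d
  have eqv : ∀ {g : ℝ → ℝ}, (∀ y ∉ Ioo (-1 : ℝ) 1, g y = 0) → ∀ x ∈ Icc c d,
      ∫ y, oddKernel α (x - y) * g y =
        ∫ t, (Icc (-R) R).indicator (oddKernel α) t * g (x - t) := fun {g} hg x hx => by
    rw [← integral_sub_left_eq_self _ volume x]
    congr 1 with t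
    rw [sub_sub_cancel]
    by_cases ht : t ∈ Icc (-R) R
    · rw [indicator_of_mem ht]
    · rw [hg (x - t), mul_zero, mul_zero]
      refine fun h => ht ⟨?_, ?_⟩
      · linarith [h.2, hx.1, abs_nonneg d]
      · linarith [h.1, hx.2, abs_nonneg c]
  have hw0 : ∀ y ∉ Ioo (-1 : ℝ) 1, wgtDeriv α n y = 0 := fun y hy => by
    rw [wgtDeriv, indicator_of_notMem hy]
  have e1 : ∫ x in c..d, qPot α n x =
      ∫ x in Ioc c d, ∫ t, (Icc (-R) R).indicator (oddKernel α) t * wgtDeriv α n (x - t) := by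
    rw [intervalIntegral.integral_of_le hcd]
    exact setIntegral_congr_fun measurableSet_Ioc fun x hx => eqv hw0 x (Ioc_subset_Icc_self hx)
  have hres : Integrable (fun p : ℝ × ℝ =>
      (Icc (-R) R).indicator (oddKernel α) p.2 * wgtDeriv α n (p.1 - p.2))
      ((volume.restrict (Ioc c d)).prod volume) := by
    have := hconv.restrict (s := Ioc c d ×ˢ univ)
    rw [← Measure.prod_restrict, Measure.restrict_univ] at this
    exact this
  have e2 : ∀ t, ∫ x in Ioc c d, (Icc (-R) R).indicator (oddKernel α) t * wgtDeriv α n (x - t) =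
      (Icc (-R) R).indicator (oddKernel α) t * wgt α n (d - t) -
        (Icc (-R) R).indicator (oddKernel α) t * wgt α n (c - t) := fun t => by
    rw [integral_const_mul, ← intervalIntegral.integral_of_le hcd,
      intervalIntegral.integral_comp_sub_right (fun x => wgtDeriv α n x),
      integral_wgtDeriv hα h1 n (sub_le_sub_right hcd t), mul_sub]
  obtain ⟨M, hM⟩ := (hasCompactSupport_wgt hα n).exists_bound_of_continuous (continuous_wgt hα n)
  have iw : ∀ z, Integrable fun t =>
      (Icc (-R) R).indicator (oddKernel α) t * wgt α n (z - t) := fun z =>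
    hK.mul_bdd (c := M) ((continuous_wgt hα n).comp
      (continuous_const.sub continuous_id)).aestronglyMeasurable
      (Filter.Eventually.of_forall fun t => hM _)
  rw [e1, integral_integral_swap hres]
  simp only [e2]
  rw [integral_sub (iw d) (iw c), ← eqv (fun y hy => wgt_eq_zero hα n hy) d ⟨hcd, le_rfl⟩,
    ← eqv (fun y hy => wgt_eq_zero hα n hy) c ⟨le_rfl, hcd⟩]
  rfl

/-! ### The potentials of lowest order. -/

lemma fPot_zero_neg (x : ℝ) : fPot α 0 (-x) = -fPot α 0 x := by
  rw [fPot, fPot, ← integral_neg_eq_self, ← integral_neg]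
  congr 1 with y
  rw [show -x - -y = -(x - y) by ring, oddKernel_neg, wgt, wgt]
  simp

/-- Oddness of the kernel gives `2 F(x) = ∫ k(t) (w(x - t) - w(x + t))`. For `x, t > 0` the point `x
- t` is closer to `0` than `x + t` and `w` does not increase with `|y|`, so the integrand is
nonnegative; it is positive for `0 < t < x`. -/
lemma fPot_zero_pos (hα : 0 < α) (h1 : α < 1) {x : ℝ} (hx : x ∈ Ioo (0 : ℝ) 1) :
    0 < fPot α 0 x := by
  have hw := continuous_wgt hα 0
  have hwc := hasCompactSupport_wgt hα 0
  have hi : Integrable fun y => oddKernel α (x - y) * wgt α 0 y :=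
    (hwc.convolutionExists_right (ContinuousLinearMap.mul ℝ ℝ)
      (locallyIntegrable_oddKernel h1) hw x).integrable_swap
  have i1 : Integrable fun t => oddKernel α t * wgt α 0 (x - t) := by
    simpa using hi.comp_sub_left x
  have i2 : Integrable fun t => oddKernel α t * wgt α 0 (x + t) := by
    have := i1.comp_neg
    simp only [oddKernel_neg, sub_neg_eq_add, neg_mul] at this
    simpa using this.neg
  have e1 : fPot α 0 x = ∫ t, oddKernel α t * wgt α 0 (x - t) := by
    rw [fPot, ← integral_sub_left_eq_self _ volume x]
    simp only [sub_sub_cancel]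
  have e2 : fPot α 0 x = -∫ t, oddKernel α t * wgt α 0 (x + t) := by
    rw [e1, ← integral_neg_eq_self, ← integral_neg]
    congr 1 with t
    rw [oddKernel_neg, sub_neg_eq_add, neg_mul]
  have e3 : 2 * fPot α 0 x = ∫ t, oddKernel α t * (wgt α 0 (x - t) - wgt α 0 (x + t)) := by
    simp only [mul_sub]
    rw [integral_sub i1 i2]
    linarith
  have hmono : ∀ u v : ℝ, |u| ≤ |v| → wgt α 0 v ≤ wgt α 0 u := fun u v huv => by
    simp only [wgt, pow_zero, mul_one]
    have := sq_le_sq.mpr huv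
    gcongr
  have hp : ∀ t, 0 < t → 0 ≤ oddKernel α t * (wgt α 0 (x - t) - wgt α 0 (x + t)) := fun t ht => by
    rw [oddKernel_of_pos α ht]
    refine mul_nonneg (Real.rpow_pos_of_pos ht _).le (sub_nonneg.mpr (hmono _ _ ?_))
    refine sq_le_sq.mp ?_
    nlinarith [hx.1]
  have hnn : ∀ t, 0 ≤ oddKernel α t * (wgt α 0 (x - t) - wgt α 0 (x + t)) := fun t => by
    rcases lt_trichotomy t 0 with h | h | h
    · have := hp (-t) (neg_pos.mpr h)
      rw [oddKernel_neg, sub_neg_eq_add, ← sub_eq_add_neg] at this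
      linarith
    · rw [h, oddKernel_zero, zero_mul]
    · exact hp t h
  have i3 : Integrable fun t => oddKernel α t * (wgt α 0 (x - t) - wgt α 0 (x + t)) := by
    simp only [mul_sub]
    exact i1.sub i2
  have : 0 < ∫ t, oddKernel α t * (wgt α 0 (x - t) - wgt α 0 (x + t)) := by
    rw [integral_pos_iff_support_of_nonneg hnn i3]
    have hsub : Ioo 0 x ⊆
        Function.support fun t => oddKernel α t * (wgt α 0 (x - t) - wgt α 0 (x + t)) :=
      fun t ht => by
      refine (mul_pos ?_ (sub_pos.mpr ?_)).ne'
      · rw [oddKernel_of_pos α ht.1]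
        exact Real.rpow_pos_of_pos ht.1 _
      · simp only [wgt, pow_zero, mul_one]
        have hm : x - t ∈ Ioo (-1 : ℝ) 1 :=
          ⟨by linarith [ht.2], by linarith [ht.1, hx.2]⟩
        have hp := one_sub_sq_pos hm
        refine Real.rpow_lt_rpow (le_max_right _ _) ?_ (by positivity)
        refine lt_of_lt_of_le (max_lt ?_ hp) (le_max_left _ _)
        nlinarith [ht.1, hx.1]
    exact lt_of_lt_of_le (by simp [hx.1]) (measure_mono hsub)
  linarith

/-- The Möbius map `t ↦ (t + x) / (1 + x t)` of `(-1, 1)` sends `0` to `x`. The exponent `α/2 - 1`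
is the one for which the powers of `1 + x t` from the Jacobian, the kernel and the weight cancel,
leaving a constant times an odd integrand. -/
lemma vPot_zero {x : ℝ} (hx : x ∈ Ioo (-1 : ℝ) 1) : vPot α 0 x = 0 := by
  have hp : ∀ t ∈ Ioo (-1 : ℝ) 1, 0 < 1 + x * t := fun t ht => by
    nlinarith [mul_pos (sub_pos.mpr hx.1) (sub_pos.mpr ht.1),
      mul_pos (sub_pos.mpr hx.2) (sub_pos.mpr ht.2)]
  have hx2 := one_sub_sq_pos hx
  let m : ℝ → ℝ := fun t => (t + x) / (1 + x * t)
  let m' : ℝ → ℝ := fun t => (1 - x ^ 2) / (1 + x * t) ^ 2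
  have hd : ∀ t ∈ Ioo (-1 : ℝ) 1, HasDerivWithinAt m (m' t) (Ioo (-1) 1) t := fun t ht => by
    have h := (((hasDerivAt_id t).add_const x).div
      (((hasDerivAt_id t).const_mul x).const_add 1) (hp t ht).ne').hasDerivWithinAt
        (s := Ioo (-1) 1)
    refine h.congr_deriv ?_
    simp only [id, m']
    congr 1
    ring
  have e1 : ∀ t ∈ Ioo (-1 : ℝ) 1, 1 - m t ^ 2 = (1 - x ^ 2) * (1 - t ^ 2) / (1 + x * t) ^ 2 :=
    fun t ht => by
      have := (hp t ht).ne'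
      simp only [m]
      rw [div_pow, one_sub_div (pow_ne_zero 2 this)]
      congr 1
      ring
  have hmaps : ∀ t ∈ Ioo (-1 : ℝ) 1, m t ∈ Ioo (-1 : ℝ) 1 := fun t ht => by
    have h0 : 0 < 1 - m t ^ 2 := by
      rw [e1 t ht]
      exact div_pos (mul_pos hx2 (one_sub_sq_pos ht)) (pow_pos (hp t ht) 2)
    exact ⟨by nlinarith, by nlinarith⟩
  have hinj : InjOn m (Ioo (-1) 1) := fun t ht t' ht' h => by
    have h1 := (hp t ht).ne'
    have h2 := (hp t' ht').ne'
    simp only [m] at h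
    rw [div_eq_div_iff h1 h2] at h
    have : (1 - x ^ 2) * (t - t') = 0 := by linear_combination h
    rcases mul_eq_zero.mp this with h3 | h3
    · exact absurd h3 hx2.ne'
    · linarith
  have himg : m '' Ioo (-1) 1 = Ioo (-1) 1 := by
    refine Subset.antisymm (image_subset_iff.mpr hmaps) fun y hy => ?_
    have hq : 0 < 1 - x * y := by
      nlinarith [mul_pos (sub_pos.mpr hx.1) (sub_pos.mpr hy.2),
        mul_pos (sub_pos.mpr hx.2) (sub_pos.mpr hy.1)]
    have hy2 := one_sub_sq_pos hy
    have e : 1 - ((y - x) / (1 - x * y)) ^ 2 = (1 - x ^ 2) * (1 - y ^ 2) / (1 - x * y) ^ 2 := by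
      rw [div_pow, one_sub_div (pow_ne_zero 2 hq.ne')]
      congr 1
      ring
    have h0 : 0 < 1 - ((y - x) / (1 - x * y)) ^ 2 := by
      rw [e]
      positivity
    refine ⟨(y - x) / (1 - x * y), ⟨by nlinarith, by nlinarith⟩, ?_⟩
    have := hq.ne'
    have e2 : 1 + x * ((y - x) / (1 - x * y)) = (1 - x ^ 2) / (1 - x * y) := by
      field_simp
      ring
    simp only [m]
    rw [e2, div_eq_iff (by positivity), div_add' _ _ _ this, mul_div_assoc']
    congr 1
    ring
  have key := integral_image_eq_integral_abs_deriv_smul measurableSet_Ioo hd hinj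
    (fun y => oddKernel α (x - y) * ((1 - y ^ 2) ^ (α / 2 - 1) * y ^ 0))
  rw [himg] at key
  have hint : ∀ t ∈ Ioo (-1 : ℝ) 1, |m' t| • (oddKernel α (x - m t) *
      ((1 - m t ^ 2) ^ (α / 2 - 1) * m t ^ 0)) =
      -((1 - x ^ 2) ^ (-(α / 2))) * (oddKernel α t * (1 - t ^ 2) ^ (α / 2 - 1)) := fun t ht => by
    have q := hp t ht
    have ht2 := one_sub_sq_pos ht
    have hA : 0 < (1 - x ^ 2) / (1 + x * t) := div_pos hx2 q
    have e2 : x - m t = -((1 - x ^ 2) / (1 + x * t) * t) := by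
      simp only [m]
      field_simp
      ring
    have e3 : oddKernel α (x - m t) =
        -(((1 - x ^ 2) / (1 + x * t)) ^ (-α) * oddKernel α t) := by
      rw [e2, oddKernel_neg, oddKernel, oddKernel, leftKernel_mul α hA, ← mul_neg,
        leftKernel_mul α hA, mul_sub]
    have hm'p : 0 < m' t := div_pos hx2 (pow_pos q 2)
    rw [e3, e1 t ht, smul_eq_mul, abs_of_pos hm'p, pow_zero, mul_one]
    simp only [m']
    generalize 1 + x * t = D at q
    have p1 : ((1 - x ^ 2) / D) ^ (-α) = (1 - x ^ 2) ^ (-α) * D ^ α := by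
      rw [Real.div_rpow hx2.le q.le, Real.rpow_neg q.le, div_inv_eq_mul]
    have p2 : ((1 - x ^ 2) * (1 - t ^ 2) / D ^ 2) ^ (α / 2 - 1) =
        (1 - x ^ 2) ^ (α / 2 - 1) * (1 - t ^ 2) ^ (α / 2 - 1) * D ^ (2 - α) := by
      rw [Real.div_rpow (by positivity) (by positivity), Real.mul_rpow hx2.le ht2.le,
        ← Real.rpow_natCast D 2, ← Real.rpow_mul q.le, div_eq_mul_inv, ← Real.rpow_neg q.le]
      congr 2
      push_cast
      ring
    have p3 : D ^ α * D ^ (2 - α) = D ^ 2 := by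
      rw [← Real.rpow_add q, ← Real.rpow_natCast D 2]
      congr 1
      push_cast
      ring
    have s1 : (1 - x ^ 2) ^ (-(α / 2)) =
        (1 - x ^ 2) * (1 - x ^ 2) ^ (-α) * (1 - x ^ 2) ^ (α / 2 - 1) := by
      rw [mul_assoc, ← Real.rpow_add hx2, mul_comm, ← Real.rpow_add_one hx2.ne']
      congr 1
      ring
    rw [p1, p2, s1, div_mul_eq_mul_div, div_eq_iff (by positivity)]
    linear_combination (-(1 - x ^ 2) * (1 - x ^ 2) ^ (-α) * (1 - x ^ 2) ^ (α / 2 - 1) *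
      oddKernel α t * (1 - t ^ 2) ^ (α / 2 - 1)) * p3
  rw [vPot, key, setIntegral_congr_fun measurableSet_Ioo hint, integral_const_mul]
  have hodd : ∫ t in Ioo (-1 : ℝ) 1, oddKernel α t * (1 - t ^ 2) ^ (α / 2 - 1) = 0 := by
    rw [← integral_indicator measurableSet_Ioo]
    have h : ∀ t, (Ioo (-1 : ℝ) 1).indicator
        (fun t => oddKernel α t * (1 - t ^ 2) ^ (α / 2 - 1)) (-t) =
        -(Ioo (-1 : ℝ) 1).indicator (fun t => oddKernel α t * (1 - t ^ 2) ^ (α / 2 - 1)) t :=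
      fun t => by
        by_cases ht : t ∈ Ioo (-1 : ℝ) 1
        · rw [indicator_of_mem ht, indicator_of_mem (show -t ∈ Ioo (-1 : ℝ) 1 from
            ⟨by linarith [ht.2], by linarith [ht.1]⟩), oddKernel_neg, neg_sq, neg_mul]
        · rw [indicator_of_notMem ht, indicator_of_notMem fun h => ht
            ⟨by linarith [h.2], by linarith [h.1]⟩, neg_zero]
    have h2 := integral_neg_eq_self ((Ioo (-1 : ℝ) 1).indicator
      fun t => oddKernel α t * (1 - t ^ 2) ^ (α / 2 - 1)) volume
    simp only [h, integral_neg] at h2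
    linarith
  rw [hodd, mul_zero]

lemma exists_derivative_eq (p : ℝ[X]) : ∃ g : ℝ[X], Polynomial.derivative g = p := by
  induction p using Polynomial.induction_on' with
  | add p q hp hq =>
    obtain ⟨g, rfl⟩ := hp
    obtain ⟨g', rfl⟩ := hq
    exact ⟨g + g', by simp⟩
  | monomial n a =>
    refine ⟨Polynomial.monomial (n + 1) (a / (n + 1)), ?_⟩
    rw [Polynomial.derivative_monomial]
    congr 1
    push_cast
    field_simp

/-- With `V₀ = 0`, Euler's relation becomes `x F₀' = F₀`, so `F₀ / x` is constant on `(0, 1)`.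
Oddness covers the rest of the interval, and positivity makes the slope nonzero. -/
lemma exists_fPot_zero (hα : 0 < α) (h1 : α < 1) :
    ∃ c : ℝ, c ≠ 0 ∧ ∀ x ∈ Ioo (-1 : ℝ) 1, fPot α 0 x = c * x := by
  have hq : ∀ x ∈ Ioo (0 : ℝ) 1, qPot α 0 x = fPot α 0 x / x := fun x hx => by
    have hx' : x ∈ Ioo (-1 : ℝ) 1 := ⟨by linarith [hx.1], hx.2⟩
    have := mul_qPot hα h1 0 hx'
    rw [vPot_zero hx'] at this
    rw [eq_div_iff hx.1.ne']
    push_cast at this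
    linarith
  have hc := continuous_fPot hα h1 0
  have hd : ∀ x ∈ Ioo (0 : ℝ) 1, HasDerivAt (fPot α 0) (fPot α 0 x / x) x := fun x hx => by
    have hcont : ContinuousOn (fun z => fPot α 0 z / z) (Ioo 0 1) :=
      hc.continuousOn.div continuousOn_id fun z hz => hz.1.ne'
    have hx2 : x / 2 ∈ Ioo (0 : ℝ) 1 := ⟨by linarith [hx.1], by linarith [hx.1, hx.2]⟩
    have hint : IntervalIntegrable (fun z => fPot α 0 z / z) volume (x / 2) x :=
      (hcont.mono (by
        rw [uIcc_of_le (by linarith [hx.1])]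
        exact fun z hz => ⟨by linarith [hz.1, hx.1], by linarith [hz.2, hx.2]⟩)).intervalIntegrable
    have h := intervalIntegral.integral_hasDerivAt_right hint
      (hcont.stronglyMeasurableAtFilter isOpen_Ioo x hx) (hcont.continuousAt (isOpen_Ioo.mem_nhds hx))
    refine (h.const_add (fPot α 0 (x / 2))).congr_of_eventuallyEq ?_
    filter_upwards [Ioo_mem_nhds (show x / 2 < x by linarith [hx.1]) hx.2] with z hz
    have e := integral_qPot hα h1 0 hz.1.le
    rw [intervalIntegral.integral_congr (g := fun z => fPot α 0 z / z)] at e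
    · linarith
    · intro y hy
      rw [uIcc_of_le hz.1.le] at hy
      exact hq y ⟨by linarith [hy.1, hx.1], by linarith [hy.2, hz.2]⟩
  have hd2 : ∀ x ∈ Ioo (0 : ℝ) 1, HasDerivAt (fun x => fPot α 0 x / x) 0 x := fun x hx => by
    refine ((hd x hx).div (hasDerivAt_id x) hx.1.ne').congr_deriv ?_
    have := hx.1.ne'
    simp only [id]
    field_simp
    simp
  have hhalf : (1 / 2 : ℝ) ∈ Ioo (0 : ℝ) 1 := by norm_num
  have hconst : ∀ x ∈ Ioo (0 : ℝ) 1, fPot α 0 x / x = fPot α 0 (1 / 2) / (1 / 2) := fun x hx =>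
    isOpen_Ioo.is_const_of_deriv_eq_zero isPreconnected_Ioo
      (fun z hz => (hd2 z hz).differentiableAt.differentiableWithinAt)
      (fun z hz => (hd2 z hz).deriv) hx hhalf
  have hpos : ∀ x ∈ Ioo (0 : ℝ) 1, fPot α 0 x = fPot α 0 (1 / 2) / (1 / 2) * x := fun x hx => by
    rw [← hconst x hx, div_mul_cancel₀ _ hx.1.ne']
  refine ⟨fPot α 0 (1 / 2) / (1 / 2), (div_pos (fPot_zero_pos hα h1 hhalf) (by norm_num)).ne',
    fun x hx => ?_⟩
  rcases lt_trichotomy x 0 with h | h | h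
  · have := hpos (-x) ⟨by linarith, by linarith [hx.1]⟩
    rw [fPot_zero_neg] at this
    linarith
  · have := fPot_zero_neg (α := α) 0
    rw [neg_zero] at this
    rw [h, mul_zero]
    linarith
  · exact hpos x ⟨h, hx.2⟩

/-- `fPot α n` and `vPot α n` are polynomials on `(-1, 1)`. -/
lemma exists_polynomial_pots (hα : 0 < α) (h1 : α < 1) (n : ℕ) :
    (∃ f : ℝ[X], f.degree = (n + 1 : ℕ) ∧ ∀ x ∈ Ioo (-1 : ℝ) 1, fPot α n x = f.eval x) ∧
    (∃ v : ℝ[X], v.degree < n ∧ ∀ x ∈ Ioo (-1 : ℝ) 1, x ≠ 0 → vPot α n x = v.eval x) ∧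
    (∃ v : ℝ[X], v.degree < (n + 1 : ℕ) ∧
      ∀ x ∈ Ioo (-1 : ℝ) 1, x ≠ 0 → vPot α (n + 1) x = v.eval x) ∧
    ∃ p : ℝ[X], p.degree = n ∧ ∀ x ∈ Ioo (-1 : ℝ) 1, x ≠ 0 → qPot α n x = p.eval x := by
  -- Writing `F`, `V`, `Q` for the three potentials, the recursion is `V (n+2) = V n - F n`, then `Q
  -- (n+1) = (n+1) F n - α V (n+2)`, then `F (n+1)` as an antiderivative of `Q (n+1)`. Two
  -- consecutive `V` are carried because the first relation has step two. The point `x = 0` is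
  -- excluded since `Q 0` comes from dividing Euler's relation by `x`.
  induction n with
  | zero =>
    obtain ⟨c, hc, hF⟩ := exists_fPot_zero hα h1
    have hq : ∀ x ∈ Ioo (-1 : ℝ) 1, x ≠ 0 → qPot α 0 x = c := fun x hx h0 => by
      have := mul_qPot hα h1 0 hx
      rw [vPot_zero hx, hF x hx] at this
      push_cast at this
      refine mul_left_cancel₀ h0 ?_
      linarith
    refine ⟨⟨Polynomial.C c * Polynomial.X, ?_, fun x hx => by simpa using hF x hx⟩,
      ⟨0, by simp, fun x hx _ => by simpa using vPot_zero hx⟩,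
      ⟨Polynomial.C (-(c / α)), ?_, fun x hx h0 => ?_⟩,
      ⟨Polynomial.C c, by simpa using Polynomial.degree_C hc, fun x hx h0 => by
        simpa using hq x hx h0⟩⟩
    · rw [Polynomial.degree_C_mul_X hc]
      rfl
    · exact lt_of_le_of_lt Polynomial.degree_C_le (by norm_num)
    · have := qPot_eq hα h1 0 hx
      rw [hq x hx h0] at this
      rw [Polynomial.eval_C, neg_eq_neg_one_mul, mul_div_assoc', eq_div_iff hα.ne']
      push_cast at this
      linarith
  | succ n ih =>
    obtain ⟨⟨f, hfd, hf⟩, ⟨v, hvd, hv⟩, ⟨v', hv'd, hv'⟩, -⟩ := ih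
    have hV2 : ∀ x ∈ Ioo (-1 : ℝ) 1, x ≠ 0 → vPot α (n + 2) x = (v - f).eval x :=
      fun x hx h0 => by
        rw [Polynomial.eval_sub, ← hf x hx, ← hv x hx h0, fPot_eq_sub hα h1 n hx]
        ring
    have hvf : v.degree < f.degree := by
      rw [hfd]
      exact hvd.trans (by exact_mod_cast Nat.lt_succ_self n)
    -- The coefficient of `f` comes from `(n+1) F - α (V - F)`. It is nonzero and `v` has smaller
    -- degree than `f`, so the degree is exact; this exactness is what later makes the polynomials
    -- span.
    obtain ⟨p, hp⟩ : ∃ p : ℝ[X],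
        p = Polynomial.C ((n : ℝ) + 1 + α) * f - Polynomial.C α * v := ⟨_, rfl⟩
    have hn1 : (n : ℝ) + 1 + α ≠ 0 := by positivity
    have hpd : p.degree = (n + 1 : ℕ) := by
      rw [hp, Polynomial.degree_sub_eq_left_of_degree_lt, Polynomial.degree_C_mul hn1, hfd]
      rw [Polynomial.degree_C_mul hn1, Polynomial.degree_C_mul hα.ne']
      exact hvf
    have hq : ∀ x ∈ Ioo (-1 : ℝ) 1, x ≠ 0 → qPot α (n + 1) x = p.eval x := fun x hx h0 => by
      rw [qPot_eq hα h1 (n + 1) hx, hV2 x hx h0, hp, Nat.add_sub_cancel, hf x hx]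
      simp only [Polynomial.eval_sub, Polynomial.eval_mul, Polynomial.eval_C]
      push_cast
      ring
    obtain ⟨g, hg⟩ := exists_derivative_eq p
    have hgd : g.degree = (n + 1 + 1 : ℕ) := by
      have hp0 : p ≠ 0 := fun h => by
        rw [h, Polynomial.degree_zero] at hpd
        exact WithBot.bot_ne_coe (a := n + 1) hpd
      have hpn : p.natDegree = n + 1 := Polynomial.natDegree_eq_of_degree_eq_some hpd
      have hg0 : g.natDegree ≠ 0 := fun h0 => by
        rw [Polynomial.eq_C_of_natDegree_eq_zero h0, Polynomial.derivative_C] at hg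
        exact hp0 hg.symm
      have := Polynomial.natDegree_derivative g
      rw [hg, hpn] at this
      have hgn : g ≠ 0 := fun h => hg0 (by simp [h])
      rw [Polynomial.degree_eq_natDegree hgn]
      congr 1
      omega
    have hint : ∀ c d : ℝ, c ∈ Ioo (-1 : ℝ) 1 → d ∈ Ioo (-1 : ℝ) 1 → c ≤ d →
        fPot α (n + 1) d - fPot α (n + 1) c = g.eval d - g.eval c := fun c d hc hd hcd => by
      rw [← integral_qPot hα h1 (n + 1) hcd]
      have : ∫ x in c..d, qPot α (n + 1) x = ∫ x in c..d, p.eval x := by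
        refine intervalIntegral.integral_congr_ae ?_
        have hne : ∀ᵐ x : ℝ, x ≠ 0 := by simp [ae_iff]
        filter_upwards [hne] with x hx0 hx
        rw [uIoc_of_le hcd] at hx
        exact hq x ⟨hc.1.trans hx.1, hx.2.trans_lt hd.2⟩ hx0
      rw [this]
      refine intervalIntegral.integral_eq_sub_of_hasDerivAt (f := fun x => g.eval x) (fun x _ => ?_)
        (p.continuous.intervalIntegrable _ _)
      rw [← hg]
      exact g.hasDerivAt x
    have h00 : (0 : ℝ) ∈ Ioo (-1 : ℝ) 1 := by norm_num
    refine ⟨⟨g + Polynomial.C (fPot α (n + 1) 0 - g.eval 0), ?_, fun x hx => ?_⟩,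
      ⟨v', hv'd, hv'⟩, ⟨v - f, ?_, hV2⟩, ⟨p, hpd, hq⟩⟩
    · rw [Polynomial.degree_add_eq_left_of_degree_lt, hgd]
      rw [hgd]
      exact lt_of_le_of_lt Polynomial.degree_C_le (by exact_mod_cast Nat.succ_pos _)
    · rw [Polynomial.eval_add, Polynomial.eval_C]
      rcases le_total x 0 with h | h
      · linarith [hint x 0 hx h00 h]
      · linarith [hint 0 x h00 hx h]
    · rw [Polynomial.degree_sub_eq_right_of_degree_lt hvf, hfd]
      exact_mod_cast Nat.lt_succ_self _

/-! ### The potential outside of `(-1, 1)` -/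

/-- Split `|x - y| ^ (-α)` into the powers `-τ` and `τ - α`, bounding `|x - y|` below by `|x| - 1`
in the first and by `(1 - y²) / 2` in the second. Here `τ = (α + 1) / 4` is the midpoint of `α/2`
and `1/2`: above `α/2` the remaining `y` integral converges, and below `1/2` the bound is locally
square integrable. -/
lemma exists_abs_qPot_le (hα : 1 / 2 < α) (h1 : α < 1) (n : ℕ) :
    ∃ C : ℝ, ∀ x, 1 < |x| → |qPot α n x| ≤ C * (|x| - 1) ^ (-((α + 1) / 4)) := by
  obtain ⟨τ, hτ⟩ : ∃ τ, τ = (α + 1) / 4 := ⟨_, rfl⟩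
  have h2 := integrableOn_one_sub_sq_rpow (σ := τ - α + (α / 2 - 1)) (by linarith) (by linarith)
  obtain ⟨I, hI⟩ : ∃ I, I = ∫ y in Ioo (-1 : ℝ) 1, (1 - y ^ 2) ^ (τ - α + (α / 2 - 1)) :=
    ⟨_, rfl⟩
  refine ⟨(2 : ℝ)⁻¹ ^ (τ - α) * (n + 1) * I, fun x hx => ?_⟩
  rw [← hτ]
  have hx1 : 0 < |x| - 1 := by linarith
  rw [qPot, setIntegral_wgtDeriv]
  have hle : ∀ y ∈ Ioo (-1 : ℝ) 1, ‖oddKernel α (x - y) *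
      (n * ((1 - y ^ 2) ^ (α / 2) * y ^ (n - 1)) -
        α * ((1 - y ^ 2) ^ (α / 2 - 1) * y ^ (n + 1)))‖ ≤
      (2 : ℝ)⁻¹ ^ (τ - α) * (n + 1) * (|x| - 1) ^ (-τ) *
        (1 - y ^ 2) ^ (τ - α + (α / 2 - 1)) := fun y hy => by
    have hp := one_sub_sq_pos hy
    have hy1 : |y| < 1 := abs_lt.mpr ⟨hy.1, hy.2⟩
    have hxy : |x| - |y| ≤ |x - y| := abs_sub_abs_le_abs_sub x y
    have a1 : |x| - 1 ≤ |x - y| := by linarith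
    have a2 : 2⁻¹ * (1 - y ^ 2) ≤ |x - y| := by
      rw [← sq_abs y]
      nlinarith [abs_nonneg y]
    have hd := abs_wgtDeriv_le (by linarith) h1 n hy
    rw [wgtDeriv, indicator_of_mem hy] at hd
    have hpos : 0 < |x - y| := by linarith
    have b1 : |x - y| ^ (-τ) ≤ (|x| - 1) ^ (-τ) :=
      Real.rpow_le_rpow_of_nonpos hx1 a1 (by linarith)
    have b2 : |x - y| ^ (τ - α) ≤ (2 : ℝ)⁻¹ ^ (τ - α) * (1 - y ^ 2) ^ (τ - α) := by
      rw [← Real.mul_rpow (by norm_num) hp.le]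
      exact Real.rpow_le_rpow_of_nonpos (by positivity) a2 (by linarith)
    rw [norm_mul, Real.norm_eq_abs, Real.norm_eq_abs, abs_oddKernel α (abs_pos.mp hpos),
      show -α = -τ + (τ - α) by ring, Real.rpow_add hpos, Real.rpow_add hp]
    calc |x - y| ^ (-τ) * |x - y| ^ (τ - α) * _ ≤
        (|x| - 1) ^ (-τ) * ((2 : ℝ)⁻¹ ^ (τ - α) * (1 - y ^ 2) ^ (τ - α)) *
          ((n + 1) * (1 - y ^ 2) ^ (α / 2 - 1)) := by
          refine mul_le_mul (mul_le_mul b1 b2 (by positivity) (by positivity)) hd (abs_nonneg _) ?_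
          have := Real.rpow_pos_of_pos hp (τ - α)
          positivity
      _ = _ := by ring
  have h3 : IntegrableOn (fun y : ℝ => (2 : ℝ)⁻¹ ^ (τ - α) * (n + 1) * (|x| - 1) ^ (-τ) *
      (1 - y ^ 2) ^ (τ - α + (α / 2 - 1))) (Ioo (-1) 1) := h2.const_mul _
  have h4 := norm_integral_le_of_norm_le h3
    ((ae_restrict_iff' measurableSet_Ioo).mpr (Filter.Eventually.of_forall hle))
  rw [Real.norm_eq_abs, integral_const_mul, ← hI] at h4
  refine h4.trans (le_of_eq ?_)
  ring

lemma stronglyMeasurable_qPot (α : ℝ) (n : ℕ) : StronglyMeasurable (qPot α n) := by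
  have hm : Measurable fun p : ℝ × ℝ => oddKernel α (p.1 - p.2) * wgtDeriv α n p.2 := by
    have := measurable_oddKernel α
    have := measurable_wgtDeriv α n
    fun_prop
  exact hm.stronglyMeasurable.integral_prod_right'

lemma integrableOn_abs_sub_one_rpow {σ : ℝ} (hσ : -1 < σ) (M : ℝ) :
    IntegrableOn (fun x : ℝ => (|x| - 1) ^ σ) {x | 1 < |x| ∧ |x| ≤ M} := by
  have h0 : Integrable ((Ioc (0 : ℝ) (M - 1)).indicator fun t : ℝ => t ^ σ) :=
    (integrableOn_Ioc_rpow hσ (M - 1)).integrable_indicator measurableSet_Ioc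
  have h1 := (h0.comp_sub_right 1).add (h0.comp_sub_right 1).comp_neg
  have hs : MeasurableSet {x : ℝ | 1 < |x| ∧ |x| ≤ M} :=
    (measurableSet_lt measurable_const continuous_abs.measurable).inter
      (measurableSet_le continuous_abs.measurable measurable_const)
  refine (h1.integrableOn (s := {x | 1 < |x| ∧ |x| ≤ M})).congr_fun (fun x hx => ?_) hs
  simp only [Pi.add_apply]
  rcases le_total 0 x with h | h
  · have e := abs_of_nonneg h
    have hx1 := hx.1
    have hx2 := hx.2
    rw [e] at hx1 hx2 ⊢
    rw [indicator_of_mem (show x - 1 ∈ Ioc 0 (M - 1) from ⟨by linarith, by linarith⟩),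
      indicator_of_notMem (fun h' => by linarith [h'.1]), add_zero]
  · have e := abs_of_nonpos h
    have hx1 := hx.1
    have hx2 := hx.2
    rw [e] at hx1 hx2 ⊢
    rw [indicator_of_mem (show -x - 1 ∈ Ioc 0 (M - 1) from ⟨by linarith, by linarith⟩),
      indicator_of_notMem (fun h' => by linarith [h'.1]), zero_add]

/-- The potential is locally square integrable. -/
lemma integrableOn_qPot_sq (hα : 1 / 2 < α) (h1 : α < 1) (n : ℕ) (M : ℝ) :
    IntegrableOn (fun x => qPot α n x ^ 2) (Icc (-M) M) := by
  obtain ⟨-, -, -, p, -, hp⟩ := exists_polynomial_pots (by linarith) h1 n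
  obtain ⟨C, hC⟩ := exists_abs_qPot_le hα h1 n
  have hm := ((stronglyMeasurable_qPot α n).measurable.pow_const 2)
  have i1 : IntegrableOn (fun x => qPot α n x ^ 2) (Ioo (-1) 1) := by
    have : IntegrableOn (fun x => p.eval x ^ 2) (Ioo (-1) 1) :=
      ((p.continuous.pow 2).continuousOn.integrableOn_compact
        (isCompact_Icc (a := (-1 : ℝ)) (b := 1))).mono_set Ioo_subset_Icc_self
    refine this.congr ?_
    have hne : ∀ᵐ x : ℝ ∂volume.restrict (Ioo (-1) 1), x ≠ 0 :=
      ae_restrict_of_ae (by simp [ae_iff])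
    filter_upwards [hne, ae_restrict_mem measurableSet_Ioo] with x hx0 hx
    rw [hp x hx hx0]
  have i2 : IntegrableOn (fun x => qPot α n x ^ 2) {x | 1 < |x| ∧ |x| ≤ M} := by
    have hs : MeasurableSet {x : ℝ | 1 < |x| ∧ |x| ≤ M} :=
      (measurableSet_lt measurable_const continuous_abs.measurable).inter
        (measurableSet_le continuous_abs.measurable measurable_const)
    refine ((integrableOn_abs_sub_one_rpow (σ := -((α + 1) / 2)) (by linarith) M).const_mul
      (C ^ 2)).mono' hm.aestronglyMeasurable ?_
    filter_upwards [ae_restrict_mem hs] with x hx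
    have hx1 : 0 < |x| - 1 := by linarith [hx.1]
    have := hC x hx.1
    rw [Real.norm_of_nonneg (sq_nonneg _), ← sq_abs]
    calc |qPot α n x| ^ 2 ≤ (C * (|x| - 1) ^ (-((α + 1) / 4))) ^ 2 :=
          pow_le_pow_left₀ (abs_nonneg _) this 2
      _ = C ^ 2 * (|x| - 1) ^ (-((α + 1) / 2)) := by
          rw [mul_pow, ← Real.rpow_natCast ((|x| - 1) ^ _) 2, ← Real.rpow_mul hx1.le]
          congr 2
          push_cast
          ring
  have i3 : IntegrableOn (fun x => qPot α n x ^ 2) {-1, 1} := by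
    rw [IntegrableOn, Measure.restrict_eq_zero.mpr ((toFinite _).measure_zero _)]
    exact integrable_zero_measure
  refine ((i1.union i2).union i3).mono_set fun x hx => ?_
  have hxM : |x| ≤ M := abs_le.mpr ⟨hx.1, hx.2⟩
  rcases lt_trichotomy |x| 1 with h | h | h
  · exact Or.inl (Or.inl (abs_lt.mp h))
  · rcases (abs_eq zero_le_one).mp h with h | h
    · exact Or.inr (by simp [h])
    · exact Or.inr (by simp [h])
  · exact Or.inl (Or.inr ⟨h, hxM⟩)

/-! ### Density of the Riesz derivatives of test functions -/

lemma leftPot_sub_rightPot (h1 : α < 1) {f : ℝ → ℝ} (hf : Continuous f)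
    (hfc : HasCompactSupport f) (x : ℝ) :
    leftPot α f x - rightPot α f x = ∫ y, oddKernel α (x - y) * f y := by
  have i1 := integrable_leftKernel_mul h1 hf hfc x
  have i2 : Integrable fun y => leftKernel α (y - x) * f y := by
    have := (integrable_leftKernel_mul h1 (hf.comp continuous_neg)
      (hfc.comp_homeomorph (Homeomorph.neg ℝ)) (-x)).comp_neg
    refine this.congr (Filter.Eventually.of_forall fun y => ?_)
    simp only [Function.comp_apply, neg_neg, sub_neg_eq_add, neg_add_eq_sub]
  rw [leftPot, rightPot, ← integral_sub i1 i2]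
  congr 1 with y
  rw [oddKernel, neg_sub]
  ring

/-- The scaled and translated weight. -/
def sWgt (α : ℝ) (n : ℕ) (m θ t : ℝ) : ℝ := wgt α n ((t - m) / θ)

/-- The derivative of `sWgt`. -/
def sWgtDeriv (α : ℝ) (n : ℕ) (m θ t : ℝ) : ℝ := θ⁻¹ * wgtDeriv α n ((t - m) / θ)

lemma div_mem_Ioo_iff {m θ t : ℝ} (hθ : 0 < θ) :
    (t - m) / θ ∈ Ioo (-1 : ℝ) 1 ↔ t ∈ Ioo (m - θ) (m + θ) := by
  rw [mem_Ioo, mem_Ioo, lt_div_iff₀ hθ, div_lt_iff₀ hθ]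
  constructor <;> rintro ⟨h, h'⟩ <;> constructor <;> linarith

lemma integrable_sWgtDeriv (hα : 0 < α) (h1 : α < 1) (n : ℕ) (m : ℝ) {θ : ℝ} (hθ : 0 < θ) :
    Integrable (sWgtDeriv α n m θ) :=
  (((integrable_wgtDeriv hα h1 n).comp_div hθ.ne').comp_sub_right m).const_mul _

/-- The kernel is homogeneous of degree `-α`, and the factor `θ⁻¹` in the derivative cancels the
Jacobian. -/
lemma integral_oddKernel_mul_sWgtDeriv (n : ℕ) (m : ℝ) {θ : ℝ} (hθ : 0 < θ) (x : ℝ) :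
    ∫ t, oddKernel α (x - t) * sWgtDeriv α n m θ t = θ ^ (-α) * qPot α n ((x - m) / θ) := by
  have hk : ∀ t, oddKernel α (θ * t) = θ ^ (-α) * oddKernel α t := fun t => by
    rw [oddKernel, oddKernel, leftKernel_mul α hθ, ← mul_neg, leftKernel_mul α hθ, mul_sub]
  have e1 := integral_add_right_eq_self (μ := volume)
    (fun t => oddKernel α (x - t) * sWgtDeriv α n m θ t) m
  have e2 := Measure.integral_comp_mul_left
    (fun t => oddKernel α (x - (t + m)) * sWgtDeriv α n m θ (t + m)) θ
  rw [e1, smul_eq_mul, abs_of_pos (inv_pos.mpr hθ)] at e2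
  rw [qPot, ← integral_const_mul]
  have e3 : ∀ τ, oddKernel α (x - (θ * τ + m)) * sWgtDeriv α n m θ (θ * τ + m) =
      θ⁻¹ * (θ ^ (-α) * (oddKernel α ((x - m) / θ - τ) * wgtDeriv α n τ)) := fun τ => by
    have : x - (θ * τ + m) = θ * ((x - m) / θ - τ) := by
      field_simp
      ring
    rw [this, hk, sWgtDeriv, add_sub_cancel_right, mul_div_cancel_left₀ _ hθ.ne']
    ring
  simp only [e3] at e2
  rw [integral_const_mul] at e2
  exact (mul_left_cancel₀ (inv_pos.mpr hθ).ne' e2).symm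

/-- The mollified weight is a test function with the expected derivative. -/
lemma isTest_convolution_sWgt (hα : 0 < α) (h1 : α < 1) (n : ℕ) {m ρ θ : ℝ} (hθ : 0 < θ)
    (hρ : θ < ρ) {η : ℝ → ℝ} (hη : ContDiff ℝ ∞ η) (hηc : HasCompactSupport η)
    (hηs : tsupport η ⊆ Ioo (-((ρ - θ) / 2)) ((ρ - θ) / 2)) :
    ∃ φ, IsTest (m - ρ) (m + ρ) φ ∧
      deriv φ = convolution (sWgtDeriv α n m θ) η (ContinuousLinearMap.mul ℝ ℝ) volume := by
  have hc : Continuous (sWgt α n m θ) := (continuous_wgt hα n).comp (by fun_prop)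
  have hW0 : ∀ t ∉ Ioo (m - θ) (m + θ), sWgt α n m θ t = 0 := fun t ht =>
    wgt_eq_zero hα n fun h => ht ((div_mem_Ioo_iff hθ).mp h)
  have hW'0 : ∀ t ∉ Ioo (m - θ) (m + θ), sWgtDeriv α n m θ t = 0 := fun t ht => by
    rw [sWgtDeriv, wgtDeriv, indicator_of_notMem fun h => ht ((div_mem_Ioo_iff hθ).mp h), mul_zero]
  have hWc : HasCompactSupport (sWgt α n m θ) :=
    HasCompactSupport.intro (isCompact_Icc (a := m - θ) (b := m + θ)) fun t ht =>
      hW0 t fun h => ht (Ioo_subset_Icc_self h)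
  refine ⟨convolution (sWgt α n m θ) η (ContinuousLinearMap.mul ℝ ℝ) volume,
    ⟨hηc.contDiff_convolution_right _ hc.locallyIntegrable hη, hWc.convolution _ hηc, ?_⟩, ?_⟩
  · have hsub : tsupport (convolution (sWgt α n m θ) η (ContinuousLinearMap.mul ℝ ℝ) volume) ⊆
        Icc (m - θ - (ρ - θ) / 2) (m + θ + (ρ - θ) / 2) := by
      refine closure_minimal ((support_convolution_subset _).trans ?_) isClosed_Icc
      rintro _ ⟨t, ht, z, hz, rfl⟩
      have ht' : t ∈ Ioo (m - θ) (m + θ) := by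
        by_contra h
        exact ht (hW0 t h)
      have hz' := hηs (subset_tsupport η hz)
      simp only
      exact ⟨by linarith [ht'.1, hz'.1], by linarith [ht'.2, hz'.2]⟩
    exact hsub.trans fun x hx => ⟨by linarith [hx.1], by linarith [hx.2]⟩
  · funext x
    rw [(hηc.hasDerivAt_convolution_right (ContinuousLinearMap.mul ℝ ℝ)
      (hc.locallyIntegrable (μ := volume)) (hη.of_le (by simp)) x).deriv]
    simp only [convolution, ContinuousLinearMap.mul_apply']
    have hdη : Continuous (deriv η) := hη.continuous_deriv (by simp)
    have hηd : ∀ y, HasDerivAt η (deriv η y) y := fun y =>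
      (hη.differentiable (by simp)).differentiableAt.hasDerivAt
    have i1 : Integrable fun t => sWgt α n m θ t * deriv η (x - t) :=
      (hc.mul (hdη.comp (continuous_const.sub continuous_id))).integrable_of_hasCompactSupport
        hWc.mul_right
    obtain ⟨C, hC⟩ := hηc.exists_bound_of_continuous hη.continuous
    have i2 : Integrable fun t => sWgtDeriv α n m θ t * η (x - t) :=
      (integrable_sWgtDeriv hα h1 n m hθ).mul_bdd (c := C)
        (hη.continuous.comp (continuous_const.sub continuous_id)).aestronglyMeasurable
        (Filter.Eventually.of_forall fun t => hC _)
    -- The derivative falls on `η` when the convolution is differentiated; integration by parts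
    -- moves it to the weight, which vanishes at both ends of its support.
    have key := integral_eq_of_hasDerivAt_off_countable_of_le
      (fun t => sWgt α n m θ t * η (x - t))
      (fun t => sWgtDeriv α n m θ t * η (x - t) - sWgt α n m θ t * deriv η (x - t))
      (show m - θ ≤ m + θ by linarith) (s := ∅) countable_empty
      (hc.mul (hη.continuous.comp (continuous_const.sub continuous_id))).continuousOn
      (fun t ht => by
        have hm := (div_mem_Ioo_iff hθ).mpr ht.1
        have d1 := (hasDerivAt_wgt hα n hm.2.ne hm.1.ne').comp t
          (((hasDerivAt_id t).sub_const m).div_const θ)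
        have d2 := (hηd (x - t)).comp t ((hasDerivAt_id t).const_sub x)
        refine (d1.mul d2).congr_deriv ?_
        simp only [Function.comp_apply, id, sWgtDeriv, sWgt]
        ring) (i2.sub i1).intervalIntegrable
    rw [hW0 _ (by simp), hW0 _ (by simp), zero_mul, zero_mul, sub_zero,
      intervalIntegral.integral_eq_integral_of_support_subset, integral_sub i2 i1] at key
    · linarith
    · intro t ht
      by_contra hn
      have hn' : t ∉ Ioo (m - θ) (m + θ) := fun h' => hn (Ioo_subset_Ioc_self h')
      exact ht (by simp [hW0 t hn', hW'0 t hn'])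

/-- If `h` is orthogonal to all Riesz derivatives of test functions, it is orthogonal to almost
all small translates of the scaled potentials. -/
lemma ae_integral_qPot_eq_zero (hα : 0 < α) (h1 : α < 1) (n : ℕ) {m ρ θ : ℝ} (hθ : 0 < θ)
    (hρ : θ < ρ) {h : ℝ → ℝ} (hh : Integrable h (vol (m - ρ) (m + ρ)))
    (horth : ∀ φ, IsTest (m - ρ) (m + ρ) φ →
      ∫ x in Ioo (m - ρ) (m + ρ), h x * (leftPot α (deriv φ) x - rightPot α (deriv φ) x) = 0) :
    ∀ᵐ z, z ∈ Ioo (-((ρ - θ) / 2)) ((ρ - θ) / 2) →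
      ∫ x in Ioo (m - ρ) (m + ρ), h x * qPot α n ((x - z - m) / θ) = 0 := by
  let Ω := Ioo (m - ρ) (m + ρ)
  have hH : Integrable (Ω.indicator h) := (integrable_indicator_iff measurableSet_Ioo).mpr hh
  -- The cutoff `4 ρ` exceeds every difference that occurs below, so the truncated kernel is
  -- integrable and yet gives the same potentials on the interval.
  have hK : Integrable ((Icc (-(4 * ρ)) (4 * ρ)).indicator (oddKernel α)) :=
    ((locallyIntegrable_oddKernel h1).integrableOn_isCompact
      isCompact_Icc).integrable_indicator measurableSet_Icc
  obtain ⟨K, hKd⟩ : ∃ K, K = (Icc (-(4 * ρ)) (4 * ρ)).indicator (oddKernel α) := ⟨_, rfl⟩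
  rw [← hKd] at hK
  have hKe : ∀ t, |t| ≤ 4 * ρ → K t = oddKernel α t := fun t ht => by
    rw [hKd, indicator_of_mem (show t ∈ Icc (-(4 * ρ)) (4 * ρ) from abs_le.mp ht)]
  have hW := integrable_sWgtDeriv hα h1 n m hθ (α := α)
  have hW'0 : ∀ t ∉ Ioo (m - θ) (m + θ), sWgtDeriv α n m θ t = 0 := fun t ht => by
    rw [sWgtDeriv, wgtDeriv, indicator_of_notMem fun h => ht ((div_mem_Ioo_iff hθ).mp h), mul_zero]
  have hWc : HasCompactSupport (sWgtDeriv α n m θ) :=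
    HasCompactSupport.intro (isCompact_Icc (a := m - θ) (b := m + θ)) fun t ht =>
      hW'0 t fun h => ht (Ioo_subset_Icc_self h)
  obtain ⟨Q, hQd⟩ : ∃ Q, Q = convolution K (sWgtDeriv α n m θ)
    (ContinuousLinearMap.mul ℝ ℝ) volume := ⟨_, rfl⟩
  have hQ : Integrable Q := hQd ▸ hK.integrable_convolution _ hW
  have hQe : ∀ x z, x ∈ Ω → z ∈ Ioo (-((ρ - θ) / 2)) ((ρ - θ) / 2) →
      Q (x - z) = θ ^ (-α) * qPot α n ((x - z - m) / θ) := fun x z hx hz => by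
    rw [← integral_oddKernel_mul_sWgtDeriv n m hθ, hQd, convolution_eq_swap]
    congr 1 with t
    simp only [ContinuousLinearMap.mul_apply']
    by_cases ht : t ∈ Ioo (m - θ) (m + θ)
    · rw [hKe]
      rw [abs_le]
      exact ⟨by linarith [hx.1, hz.2, ht.2], by linarith [hx.2, hz.1, ht.1]⟩
    · rw [hW'0 t ht, mul_zero, mul_zero]
  have hprod : Integrable (fun p : ℝ × ℝ => Ω.indicator h p.2 * Q (p.2 - p.1))
      ((volume : Measure ℝ).prod volume) := by
    have := hH.convolution_integrand (ContinuousLinearMap.mul ℝ ℝ) hQ.comp_neg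
    refine this.congr (Filter.Eventually.of_forall fun p => ?_)
    simp only [ContinuousLinearMap.mul_apply', neg_sub]
  have hc : Integrable fun z => ∫ x, Ω.indicator h x * Q (x - z) := hprod.integral_prod_left
  -- Integrating the function of `z` against `η` gives, by Fubini and associativity of convolution,
  -- the pairing of `h` with the Riesz potential of a mollified weight, which vanishes by
  -- hypothesis.
  have hzero := isOpen_Ioo.ae_eq_zero_of_integral_contDiff_smul_eq_zero (μ := volume)
    (U := Ioo (-((ρ - θ) / 2)) ((ρ - θ) / 2))
    (f := fun z => ∫ x, Ω.indicator h x * Q (x - z))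
    (hc.locallyIntegrable.locallyIntegrableOn _) (fun η hη hηc hηs => by
      obtain ⟨φ, hφ, hφd⟩ := isTest_convolution_sWgt hα h1 n hθ hρ hη hηc hηs (m := m)
      have ho := horth φ hφ
      have hφ' := hφ.isTest_deriv
      obtain ⟨C, hC⟩ := hηc.exists_bound_of_continuous hη.continuous
      have hprod2 : Integrable (fun p : ℝ × ℝ => η p.1 * (Ω.indicator h p.2 * Q (p.2 - p.1)))
          ((volume : Measure ℝ).prod volume) :=
        hprod.bdd_mul (c := C) (f := fun p : ℝ × ℝ => η p.1)
          (hη.continuous.comp continuous_fst).aestronglyMeasurable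
          (Filter.Eventually.of_forall fun p => hC p.1)
      have e1 : ∀ x ∈ Ω, leftPot α (deriv φ) x - rightPot α (deriv φ) x =
          ∫ z, η z * Q (x - z) := fun x hx => by
        rw [leftPot_sub_rightPot h1 hφ'.contDiff.continuous hφ'.hasCompactSupport]
        have a1 : ∫ y, oddKernel α (x - y) * deriv φ y =
            convolution K (deriv φ) (ContinuousLinearMap.mul ℝ ℝ) volume x := by
          rw [convolution_eq_swap]
          congr 1 with y
          simp only [ContinuousLinearMap.mul_apply']
          by_cases hy : y ∈ Ω
          · rw [hKe]
            rw [abs_le]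
            exact ⟨by linarith [hx.1, hy.2], by linarith [hx.2, hy.1]⟩
          · rw [hφ'.eq_zero hy, mul_zero, mul_zero]
        rw [a1, hφd]
        have a2 := convolution_assoc (ContinuousLinearMap.mul ℝ ℝ) (ContinuousLinearMap.mul ℝ ℝ)
          (ContinuousLinearMap.mul ℝ ℝ) (ContinuousLinearMap.mul ℝ ℝ) (μ := volume)
          (ν := volume) (f := K) (g := sWgtDeriv α n m θ) (k := η) (x₀ := x)
          (fun u v w => by simp [mul_assoc]) hK.aestronglyMeasurable hW.aestronglyMeasurable
          hη.continuous.aestronglyMeasurable (hK.ae_convolution_exists _ hW)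
          (Filter.Eventually.of_forall fun y =>
            (hηc.norm.convolutionExists_right _ hW.norm.locallyIntegrable hη.continuous.norm) y)
          (((hWc.norm.convolution _ hηc.norm).convolutionExists_right _ hK.norm.locallyIntegrable
            (hηc.norm.continuous_convolution_right _ hW.norm.locallyIntegrable
              hη.continuous.norm)) x)
        rw [← a2, ← hQd, convolution_eq_swap]
        congr 1 with z
        simp only [ContinuousLinearMap.mul_apply']
        exact mul_comm _ _
      simp only [smul_eq_mul, ← integral_const_mul]
      rw [integral_integral_swap hprod2, ← ho, ← integral_indicator measurableSet_Ioo]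
      congr 1 with x
      by_cases hx : x ∈ Ω
      · rw [indicator_of_mem (show x ∈ Ioo (m - ρ) (m + ρ) from hx),
          indicator_of_mem (show x ∈ Ioo (m - ρ) (m + ρ) from hx), e1 x hx,
          ← integral_const_mul]
        congr 1 with z
        ring
      · rw [indicator_of_notMem (show x ∉ Ioo (m - ρ) (m + ρ) from hx),
          indicator_of_notMem (show x ∉ Ioo (m - ρ) (m + ρ) from hx)]
        refine integral_eq_zero_of_ae (Filter.Eventually.of_forall fun z => ?_)
        simp only [zero_mul, mul_zero, Pi.zero_apply])
  filter_upwards [hzero] with z hz hzm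
  have e := hz hzm
  rw [← integral_indicator measurableSet_Ioo]
  have hθp : θ ^ (-α) ≠ 0 := (Real.rpow_pos_of_pos hθ _).ne'
  refine mul_left_cancel₀ hθp ?_
  rw [mul_zero, ← e, ← integral_const_mul]
  congr 1 with x
  by_cases hx : x ∈ Ω
  · rw [indicator_of_mem hx, indicator_of_mem hx, hQe x z hx hzm]
    ring
  · rw [indicator_of_notMem hx, indicator_of_notMem hx]
    simp

/-- The bound must be uniform in `θ` and `z`. Since `θ ≥ ρ / 2`, the rescaled variable stays in
`[-3, 3]`, and the Jacobian `θ` is at most `ρ`. -/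
lemma integral_qPot_comp_sq_le (hα : 1 / 2 < α) (h1 : α < 1) (n : ℕ) {m ρ θ z : ℝ} (hρ : 0 < ρ)
    (hθ : ρ / 2 ≤ θ) (hθ' : θ ≤ ρ) (hz : z ∈ Ioo (-((ρ - θ) / 2)) ((ρ - θ) / 2)) :
    IntegrableOn (fun x => qPot α n ((x - z - m) / θ) ^ 2) (Ioo (m - ρ) (m + ρ)) ∧
    ∫ x in Ioo (m - ρ) (m + ρ), qPot α n ((x - z - m) / θ) ^ 2 ≤
      ρ * ∫ x in Icc (-3) 3, qPot α n x ^ 2 := by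
  have hθ0 : 0 < θ := by linarith
  obtain ⟨g, hg⟩ : ∃ g, g = (Icc (-3 : ℝ) 3).indicator fun x => qPot α n x ^ 2 := ⟨_, rfl⟩
  have hgi : Integrable g := by
    rw [hg]
    exact (integrable_indicator_iff measurableSet_Icc).mpr (integrableOn_qPot_sq hα h1 n 3)
  have hg0 : ∀ x, 0 ≤ g x := fun x => by
    rw [hg]
    exact indicator_nonneg (fun _ _ => sq_nonneg _) x
  have hgc : Integrable fun x => g ((x - (z + m)) / θ) :=
    (hgi.comp_div hθ0.ne').comp_sub_right (z + m)
  have he : ∀ x ∈ Ioo (m - ρ) (m + ρ), g ((x - (z + m)) / θ) = qPot α n ((x - z - m) / θ) ^ 2 :=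
    fun x hx => by
      have : (x - (z + m)) / θ ∈ Icc (-3 : ℝ) 3 := by
        rw [mem_Icc, le_div_iff₀ hθ0, div_le_iff₀ hθ0]
        constructor <;> linarith [hx.1, hx.2, hz.1, hz.2]
      rw [hg, indicator_of_mem this, sub_sub]
  refine ⟨hgc.integrableOn.congr_fun he measurableSet_Ioo, ?_⟩
  rw [← setIntegral_congr_fun measurableSet_Ioo he]
  refine (setIntegral_le_integral hgc (Filter.Eventually.of_forall fun x => hg0 _)).trans ?_
  rw [integral_sub_right_eq_self (fun x => g (x / θ)) (z + m),
    Measure.integral_comp_div g θ, smul_eq_mul, abs_of_pos hθ0, ← integral_indicator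
    measurableSet_Icc, ← hg]
  exact mul_le_mul_of_nonneg_right hθ' (integral_nonneg hg0)

/-- Let `θ → ρ` and `z → 0` in the vanishing integrals. Where the rescaled point lies in `(-1, 1)`
the potential is the polynomial and dominated convergence applies; elsewhere Cauchy–Schwarz pairs
the uniform `L²` bound of the potential with the vanishing mass of `h`. -/
lemma exists_polynomial_integral_eq_zero (hα : 1 / 2 < α) (h1 : α < 1) (n : ℕ) {m ρ : ℝ}
    (hρ : 0 < ρ) {h : ℝ → ℝ} (hh : MemLp h 2 (vol (m - ρ) (m + ρ)))
    (horth : ∀ φ, IsTest (m - ρ) (m + ρ) φ →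
      ∫ x in Ioo (m - ρ) (m + ρ), h x * (leftPot α (deriv φ) x - rightPot α (deriv φ) x) = 0) :
    ∃ p : ℝ[X], p.degree = n ∧
      ∫ x in Ioo (m - ρ) (m + ρ), h x * p.eval ((x - m) / ρ) = 0 := by
  have hα0 : 0 < α := by linarith
  have hhi : Integrable h (vol (m - ρ) (m + ρ)) := hh.integrable (by norm_num)
  have hh2 : Integrable (fun x => h x ^ 2) (vol (m - ρ) (m + ρ)) := hh.integrable_sq
  obtain ⟨-, -, -, p, hpd, hp⟩ := exists_polynomial_pots hα0 h1 n
  refine ⟨p, hpd, ?_⟩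
  -- The shift by `2` keeps the radii at least `ρ / 2` from `k = 0` on.
  have hθ0 : ∀ k : ℕ, 0 < ρ * (1 - 1 / ((k : ℝ) + 2)) ∧ ρ / 2 ≤ ρ * (1 - 1 / ((k : ℝ) + 2)) ∧
      ρ * (1 - 1 / ((k : ℝ) + 2)) < ρ := fun k => by
    have e1 : 1 / ((k : ℝ) + 2) ≤ 1 / 2 :=
      one_div_le_one_div_of_le (by norm_num) (by linarith [k.cast_nonneg (α := ℝ)])
    have e2 : 0 < 1 / ((k : ℝ) + 2) := by positivity
    exact ⟨by nlinarith, by nlinarith, by nlinarith⟩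
  obtain ⟨θ, hθd⟩ : ∃ θ : ℕ → ℝ, ∀ k, θ k = ρ * (1 - 1 / ((k : ℝ) + 2)) := ⟨_, fun _ => rfl⟩
  simp only [← hθd] at hθ0
  have hθlim : Filter.Tendsto θ Filter.atTop (nhds ρ) := by
    have e : Filter.Tendsto (fun k : ℕ => 1 / ((k : ℝ) + 2)) Filter.atTop (nhds 0) := by
      have := (tendsto_one_div_atTop_nhds_zero_nat (𝕜 := ℝ)).comp (Filter.tendsto_add_atTop_nat 2)
      refine this.congr fun k => ?_
      simp
    have e2 := (e.const_sub 1).const_mul ρ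
    rw [sub_zero, mul_one] at e2
    exact e2.congr fun k => (hθd k).symm
  have hz : ∀ k, ∃ z, z ∈ Ioo (-((ρ - θ k) / 2)) ((ρ - θ k) / 2) ∧
      ∫ x in Ioo (m - ρ) (m + ρ), h x * qPot α n ((x - z - m) / θ k) = 0 := fun k => by
    have hae := ae_integral_qPot_eq_zero hα0 h1 n (hθ0 k).1 (hθ0 k).2.2 hhi horth
    -- An almost-everywhere statement on a set of positive measure provides at least one admissible
    -- translate.
    have hpos : volume (Ioo (-((ρ - θ k) / 2)) ((ρ - θ k) / 2)) ≠ 0 := by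
      rw [Real.volume_Ioo]
      simp only [ne_eq, ENNReal.ofReal_eq_zero, not_le]
      linarith [(hθ0 k).2.2]
    by_contra! hcon
    refine hpos (measure_mono_null (fun z hz => ?_) hae)
    exact fun hi => hcon z hz (hi hz)
  choose z hzm hz0 using hz
  have hzlim : Filter.Tendsto z Filter.atTop (nhds 0) := by
    have e : Filter.Tendsto (fun k => (ρ - θ k) / 2) Filter.atTop (nhds 0) := by
      simpa using (hθlim.const_sub ρ).div_const 2
    refine squeeze_zero_norm (fun k => ?_) e
    rw [Real.norm_eq_abs]
    exact (abs_lt.mpr (hzm k)).le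
  obtain ⟨y, hyd⟩ : ∃ y : ℕ → ℝ → ℝ, ∀ k x, y k x = (x - z k - m) / θ k := ⟨_, fun _ _ => rfl⟩
  have hylim : ∀ x, Filter.Tendsto (fun k => y k x) Filter.atTop (nhds ((x - m) / ρ)) := fun x => by
    simp only [hyd]
    have := ((hzlim.const_sub x).sub_const m).div hθlim hρ.ne'
    rw [sub_zero] at this
    exact this
  have hyc : ∀ k, Continuous (y k) := fun k => by
    have : y k = fun x => (x - z k - m) / θ k := funext (hyd k)
    rw [this]
    fun_prop
  have hin : ∀ x ∈ Ioo (m - ρ) (m + ρ), ∀ᶠ k in Filter.atTop, y k x ∈ Ioo (-1 : ℝ) 1 :=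
    fun x hx => (hylim x).eventually (isOpen_Ioo.mem_nhds ((div_mem_Ioo_iff hρ).mpr hx))
  obtain ⟨S, hSd⟩ : ∃ S : ℕ → Set ℝ, ∀ k, S k = y k ⁻¹' Ioo (-1) 1 := ⟨_, fun _ => rfl⟩
  have hSm : ∀ k, MeasurableSet (S k) := fun k => by
    rw [hSd]
    exact (hyc k).measurable measurableSet_Ioo
  obtain ⟨C, hC⟩ := (isCompact_Icc (a := (-1 : ℝ)) (b := 1)).exists_bound_of_continuousOn
    p.continuous.continuousOn
  have hpc : ∀ k, Continuous fun x => p.eval (y k x) := fun k => p.continuous.comp (hyc k)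
  have hbd : ∀ k x, ‖(S k).indicator (fun x => h x * p.eval (y k x)) x‖ ≤ C * ‖h x‖ := fun k x => by
    have hC0 : 0 ≤ C := (norm_nonneg _).trans (hC 0 (by norm_num))
    by_cases hx : x ∈ S k
    · rw [indicator_of_mem hx, norm_mul, mul_comm]
      rw [hSd] at hx
      exact mul_le_mul_of_nonneg_right (hC _ (Ioo_subset_Icc_self hx)) (norm_nonneg _)
    · rw [indicator_of_notMem hx, norm_zero]
      positivity
  have hmeas : ∀ k, AEStronglyMeasurable ((S k).indicator (fun x => h x * p.eval (y k x)))
      (vol (m - ρ) (m + ρ)) := fun k =>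
    (hhi.aestronglyMeasurable.mul (hpc k).aestronglyMeasurable).indicator (hSm k)
  have hI : Filter.Tendsto (fun k => ∫ x in Ioo (m - ρ) (m + ρ),
      (S k).indicator (fun x => h x * p.eval (y k x)) x) Filter.atTop
      (nhds (∫ x in Ioo (m - ρ) (m + ρ), h x * p.eval ((x - m) / ρ))) := by
    refine tendsto_integral_of_dominated_convergence (fun x => C * ‖h x‖) hmeas
      (hhi.norm.const_mul C) (fun k => Filter.Eventually.of_forall (hbd k)) ?_
    filter_upwards [ae_restrict_mem measurableSet_Ioo] with x hx
    have e : Filter.Tendsto (fun k => h x * p.eval (y k x)) Filter.atTop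
        (nhds (h x * p.eval ((x - m) / ρ))) :=
      ((p.continuous.tendsto _).comp (hylim x)).const_mul _
    refine e.congr' ?_
    filter_upwards [hin x hx] with k hk
    rw [indicator_of_mem]
    rw [hSd]
    exact hk
  have hJ : Filter.Tendsto (fun k => ∫ x in Ioo (m - ρ) (m + ρ),
      ((S k)ᶜ.indicator h x) ^ 2) Filter.atTop (nhds 0) := by
    have := tendsto_integral_of_dominated_convergence (μ := vol (m - ρ) (m + ρ))
      (F := fun k x => ((S k)ᶜ.indicator h x) ^ 2) (f := fun _ => (0 : ℝ)) (fun x => h x ^ 2)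
      (fun k => (hhi.aestronglyMeasurable.indicator (hSm k).compl).pow 2) hh2
      (fun k => Filter.Eventually.of_forall fun x => ?_) ?_
    · simpa using this
    · by_cases hx : x ∈ (S k)ᶜ
      · simp [indicator_of_mem hx]
      · simp [indicator_of_notMem hx, sq_nonneg]
    · filter_upwards [ae_restrict_mem measurableSet_Ioo] with x hx
      refine tendsto_const_nhds.congr' ?_
      filter_upwards [hin x hx] with k hk
      rw [indicator_of_notMem]
      · simp
      · rw [hSd]
        exact fun h' => h' hk
  have hle : ∀ k, (∫ x in Ioo (m - ρ) (m + ρ),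
      (S k).indicator (fun x => h x * p.eval (y k x)) x) ^ 2 ≤
      (∫ x in Ioo (m - ρ) (m + ρ), ((S k)ᶜ.indicator h x) ^ 2) *
        (ρ * ∫ x in Icc (-3) 3, qPot α n x ^ 2) := fun k => by
    obtain ⟨q1, q2⟩ := integral_qPot_comp_sq_le hα h1 n hρ (hθ0 k).2.1 (hθ0 k).2.2.le (hzm k)
      (m := m)
    simp only [← hyd] at q1 q2
    have hqm : AEStronglyMeasurable (fun x => qPot α n (y k x)) (vol (m - ρ) (m + ρ)) :=
      ((stronglyMeasurable_qPot α n).measurable.comp (hyc k).measurable).aestronglyMeasurable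
    have hqL : MemLp (fun x => qPot α n (y k x)) 2 (vol (m - ρ) (m + ρ)) :=
      (memLp_two_iff_integrable_sq hqm).mpr q1
    have hoL : MemLp ((S k)ᶜ.indicator h) 2 (vol (m - ρ) (m + ρ)) := hh.indicator (hSm k).compl
    have i2 : Integrable (fun x => (S k)ᶜ.indicator h x * qPot α n (y k x))
        (vol (m - ρ) (m + ρ)) := hoL.integrable_mul hqL
    have i1 : Integrable ((S k).indicator (fun x => h x * p.eval (y k x)))
        (vol (m - ρ) (m + ρ)) :=
      (hhi.norm.const_mul C).mono' (hmeas k) (Filter.Eventually.of_forall (hbd k))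
    have hsum : (∫ x in Ioo (m - ρ) (m + ρ), (S k).indicator (fun x => h x * p.eval (y k x)) x) +
        ∫ x in Ioo (m - ρ) (m + ρ), (S k)ᶜ.indicator h x * qPot α n (y k x) = 0 := by
      rw [← integral_add i1 i2, ← hz0 k]
      refine integral_congr_ae (ae_restrict_of_ae ?_)
      -- This is the point where the rescaled variable is `0`, at which the polynomial formula is
      -- not known.
      have hne : ∀ᵐ x : ℝ, x ≠ z k + m := by simp [ae_iff]
      filter_upwards [hne] with x hx
      by_cases hxS : x ∈ S k
      · have hy0 : y k x ≠ 0 := by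
          rw [hyd]
          refine div_ne_zero (fun h' => hx (by linarith)) (hθ0 k).1.ne'
        rw [indicator_of_mem hxS, indicator_of_notMem (show x ∉ (S k)ᶜ from fun h' => h' hxS), zero_mul, add_zero,
          ← hyd]
        rw [hSd] at hxS
        rw [hp _ hxS hy0]
      · rw [indicator_of_notMem hxS, indicator_of_mem (show x ∈ (S k)ᶜ from hxS), zero_add, ← hyd]
    rw [eq_neg_of_add_eq_zero_left hsum, neg_sq]
    refine (sq_integral_mul_le hoL.integrable_sq q1 i2).trans ?_
    exact mul_le_mul_of_nonneg_left q2 (integral_nonneg fun x => sq_nonneg _)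
  have hfin := le_of_tendsto_of_tendsto' (hI.pow 2) (hJ.mul_const _) hle
  rw [zero_mul] at hfin
  exact pow_eq_zero_iff two_ne_zero |>.mp (le_antisymm hfin (sq_nonneg _))

/-- A square integrable function that is orthogonal to all Riesz derivatives of test functions
vanishes. -/
lemma ae_eq_zero_of_integral_pot_eq_zero (hα : 1 / 2 < α) (h1 : α < 1) {a b : ℝ} (hab : a < b)
    {h : ℝ → ℝ} (hh : MemLp h 2 (vol a b))
    (horth : ∀ φ, IsTest a b φ →
      ∫ x in Ioo a b, h x * (leftPot α (deriv φ) x - rightPot α (deriv φ) x) = 0) :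
    h =ᵐ[vol a b] 0 := by
  obtain ⟨m, hm⟩ : ∃ m, m = (a + b) / 2 := ⟨_, rfl⟩
  obtain ⟨ρ, hρd⟩ : ∃ ρ, ρ = (b - a) / 2 := ⟨_, rfl⟩
  have hρ : 0 < ρ := by linarith
  obtain rfl : a = m - ρ := by linarith
  obtain rfl : b = m + ρ := by linarith
  have hhi : Integrable h (vol (m - ρ) (m + ρ)) := hh.integrable (by norm_num)
  have hlin : Continuous fun x => (x - m) / ρ := by fun_prop
  have hint : ∀ p : ℝ[X], Integrable (fun x => h x * p.eval ((x - m) / ρ))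
      (vol (m - ρ) (m + ρ)) := fun p => integrable_mul_continuous hhi (p.continuous.comp hlin)
  have hpoly : ∀ n : ℕ, ∀ P : ℝ[X], P.degree < n →
      ∫ x in Ioo (m - ρ) (m + ρ), h x * P.eval ((x - m) / ρ) = 0 := by
    intro n
    induction n with
    | zero =>
      intro P hP
      have : P = 0 := by
        rw [← Polynomial.degree_eq_bot]
        exact Nat.WithBot.lt_zero_iff.mp (by exact_mod_cast hP)
      simp [this]
    | succ n ih =>
      intro P hP
      obtain ⟨p, hpd, hp⟩ := exists_polynomial_integral_eq_zero hα h1 n hρ hh horth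
      have hp0 : p.leadingCoeff ≠ 0 := by
        rw [Polynomial.leadingCoeff_ne_zero]
        rintro rfl
        simp at hpd
      have hnd := Polynomial.natDegree_eq_of_degree_eq_some hpd
      -- Since `p` has degree exactly `n`, a multiple of it removes the coefficient of order `n`
      -- from `P`.
      have hdeg : (P - Polynomial.C (P.coeff n / p.leadingCoeff) * p).degree < n := by
        rw [Polynomial.degree_lt_iff_coeff_zero]
        intro k hk
        rw [Polynomial.coeff_sub, Polynomial.coeff_C_mul]
        rcases hk.eq_or_lt with rfl | hk
        · rw [← hnd, Polynomial.coeff_natDegree, hnd, div_mul_cancel₀ _ hp0, sub_self]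
        · rw [Polynomial.coeff_eq_zero_of_degree_lt (hP.trans_le (by exact_mod_cast hk)),
            Polynomial.coeff_eq_zero_of_degree_lt (hpd.trans_lt (by exact_mod_cast hk)), mul_zero,
            sub_zero]
      have h2 := ih _ hdeg
      have e : ∀ x, h x * (P - Polynomial.C (P.coeff n / p.leadingCoeff) * p).eval ((x - m) / ρ) =
          h x * P.eval ((x - m) / ρ) -
            P.coeff n / p.leadingCoeff * (h x * p.eval ((x - m) / ρ)) := fun x => by
        simp only [Polynomial.eval_sub, Polynomial.eval_mul, Polynomial.eval_C]
        ring
      simp only [e] at h2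
      rw [integral_sub (hint P) ((hint p).const_mul _), integral_const_mul, hp, mul_zero,
        sub_zero] at h2
      exact h2
  have hhO : IntegrableOn h (Ioo (m - ρ) (m + ρ)) := hhi
  refine ae_eq_of_integral_test hhO.locallyIntegrableOn
    (locallyIntegrable_zero.locallyIntegrableOn _) fun φ hφ => ?_
  simp only [Pi.zero_apply, zero_mul, integral_zero]
  obtain ⟨I, hI⟩ : ∃ I, I = ∫ x in Ioo (m - ρ) (m + ρ), ‖h x‖ := ⟨_, rfl⟩
  have hI0 : 0 ≤ I := hI ▸ integral_nonneg fun x => norm_nonneg _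
  have hφi := integrable_mul_continuous hhi hφ.contDiff.continuous
  -- Weierstrass approximation of `φ` by a polynomial, to which `h` is orthogonal.
  have hsmall : ∀ ε > 0, |∫ x in Ioo (m - ρ) (m + ρ), h x * φ x| ≤ ε * I := fun ε hε => by
    obtain ⟨P, hP⟩ := exists_polynomial_near_of_continuousOn (m - ρ) (m + ρ) φ
      hφ.contDiff.continuous.continuousOn ε hε
    have e0 := hpoly _ (P.comp (Polynomial.C ρ * Polynomial.X + Polynomial.C m))
      (Polynomial.degree_le_natDegree.trans_lt (by exact_mod_cast Nat.lt_succ_self _))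
    have e1 : ∀ x, (P.comp (Polynomial.C ρ * Polynomial.X + Polynomial.C m)).eval
        ((x - m) / ρ) = P.eval x := fun x => by
      simp only [Polynomial.eval_comp, Polynomial.eval_add, Polynomial.eval_mul,
        Polynomial.eval_C, Polynomial.eval_X]
      rw [mul_div_cancel₀ _ hρ.ne', sub_add_cancel]
    simp only [e1] at e0
    rw [← sub_zero (∫ x in Ioo (m - ρ) (m + ρ), h x * φ x), ← e0,
      ← integral_sub hφi (integrable_mul_continuous hhi P.continuous), hI, ← integral_const_mul,
      ← Real.norm_eq_abs]
    refine norm_integral_le_of_norm_le (hhi.norm.const_mul ε) ?_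
    filter_upwards [ae_restrict_mem measurableSet_Ioo] with x hx
    rw [← mul_sub, norm_mul, mul_comm, Real.norm_eq_abs (φ x - _), abs_sub_comm]
    exact mul_le_mul_of_nonneg_right (hP x (Ioo_subset_Icc_self hx)).le (norm_nonneg _)
  by_contra hne
  have hpos := abs_pos.mpr hne
  have := hsmall (|∫ x in Ioo (m - ρ) (m + ρ), h x * φ x| / (2 * (I + 1))) (by positivity)
  rw [div_mul_eq_mul_div, le_div_iff₀ (by positivity)] at this
  nlinarith

/-! ### Minimization of quadratic energies -/

/-- Existence and uniqueness of the minimizer of a quadratic energy on a vector space that is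
isomorphic to a Hilbert space. -/
lemma existsUnique_minimizer {X E : Type*} [AddCommGroup X] [Module ℝ X] [NormedAddCommGroup E]
    [InnerProductSpace ℝ E] [CompleteSpace E] (e : X ≃ₗ[ℝ] E) (T : E →L[ℝ] E) {lam : ℝ}
    (hlam : 0 ≤ lam) (q : X → ℝ) (hq : ∀ x, q x = ‖e x‖ ^ 2 + lam * ‖T (e x)‖ ^ 2)
    (f : X →ₗ[ℝ] ℝ) (hf : ∃ C : ℝ, ∀ x, |f x| ≤ C * √(q x)) :
    ∃! u : X, ∀ v : X, 1 / 2 * q u - f u ≤ 1 / 2 * q v - f v := by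
  obtain ⟨C, hC⟩ := hf
  -- `A = 1 + lam T* T` represents the polarization of `q` transported to `E`; the identity summand
  -- makes it coercive with constant `1`.
  obtain ⟨A, hA⟩ : ∃ A : E →L[ℝ] E, A = ContinuousLinearMap.id ℝ E +
    lam • (ContinuousLinearMap.adjoint T ∘L T) := ⟨_, rfl⟩
  obtain ⟨B, hBd⟩ : ∃ B : E →L[ℝ] E →L[ℝ] ℝ, B = (innerSL ℝ).comp A := ⟨_, rfl⟩
  have hB : ∀ g h, B g h = inner ℝ g h + lam * inner ℝ (T g) (T h) := fun g h => by
    simp only [hBd, hA, ContinuousLinearMap.comp_apply, innerSL_apply_apply,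
      add_apply, smul_apply, ContinuousLinearMap.id_apply,
      inner_add_left, real_inner_smul_left, ContinuousLinearMap.adjoint_inner_left]
  have hBq : ∀ x, q x = B (e x) (e x) := fun x => by
    rw [hB, hq, real_inner_self_eq_norm_sq, real_inner_self_eq_norm_sq]
  have hBs : ∀ g h, B g h = B h g := fun g h => by
    rw [hB, hB, real_inner_comm, real_inner_comm (T h)]
  have hBp : ∀ g, ‖g‖ ^ 2 ≤ B g g := fun g => by
    rw [hB, real_inner_self_eq_norm_sq, real_inner_self_eq_norm_sq]
    have : 0 ≤ lam * ‖T g‖ ^ 2 := by positivity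
    linarith
  have hcoer : IsCoercive B := ⟨1, one_pos, fun g => by
    have := hBp g
    rw [pow_two] at this
    simpa using this⟩
  obtain ⟨F, hF⟩ : ∃ F : E →L[ℝ] ℝ, ∀ g, F g = f (e.symm g) := by
    refine ⟨LinearMap.mkContinuous (f ∘ₗ e.symm.toLinearMap) (|C| * √(1 + lam * ‖T‖ ^ 2))
      fun g => ?_, fun g => rfl⟩
    have h1 := hC (e.symm g)
    have h2 : q (e.symm g) ≤ (1 + lam * ‖T‖ ^ 2) * ‖g‖ ^ 2 := by
      rw [hq, e.apply_symm_apply]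
      have : ‖T g‖ ^ 2 ≤ (‖T‖ * ‖g‖) ^ 2 := pow_le_pow_left₀ (norm_nonneg _) (T.le_opNorm g) 2
      rw [mul_pow] at this
      nlinarith [mul_le_mul_of_nonneg_left this hlam]
    have h3 : √(q (e.symm g)) ≤ √(1 + lam * ‖T‖ ^ 2) * ‖g‖ := by
      refine (Real.sqrt_le_sqrt h2).trans (le_of_eq ?_)
      rw [Real.sqrt_mul (by positivity), Real.sqrt_sq (norm_nonneg _)]
    calc ‖(f ∘ₗ e.symm.toLinearMap) g‖ = |f (e.symm g)| := rfl
      _ ≤ C * √(q (e.symm g)) := h1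
      _ ≤ |C| * √(q (e.symm g)) := mul_le_mul_of_nonneg_right (le_abs_self C) (Real.sqrt_nonneg _)
      _ ≤ |C| * (√(1 + lam * ‖T‖ ^ 2) * ‖g‖) := mul_le_mul_of_nonneg_left h3 (abs_nonneg _)
      _ = _ := by ring
  -- Lax–Milgram: `g₀` solves the Euler–Lagrange equation.
  obtain ⟨g₀, hg₀⟩ : ∃ g₀, ∀ h, B g₀ h = F h := by
    refine ⟨hcoer.continuousLinearEquivOfBilin.symm ((InnerProductSpace.toDual ℝ E).symm F),
      fun h => ?_⟩
    rw [← hcoer.continuousLinearEquivOfBilin_apply, ContinuousLinearEquiv.apply_symm_apply,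
      InnerProductSpace.toDual_symm_apply]
  -- Completing the square around `g₀`; existence and uniqueness both follow from coercivity of the
  -- last term.
  have key : ∀ v, 1 / 2 * q v - f v =
      1 / 2 * q (e.symm g₀) - f (e.symm g₀) + 1 / 2 * B (e v - g₀) (e v - g₀) := fun v => by
    have e1 : f v = B g₀ (e v) := by rw [hg₀, hF, e.symm_apply_apply]
    have e2 : f (e.symm g₀) = B g₀ g₀ := by rw [hg₀, hF]
    rw [hBq, hBq, e.apply_symm_apply, e1, e2]
    simp only [map_sub, sub_apply]
    rw [hBs (e v) g₀]
    ring
  refine ⟨e.symm g₀, fun v => ?_, fun u hu => ?_⟩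
  · rw [key v]
    linarith [hBp (e v - g₀), sq_nonneg ‖e v - g₀‖]
  · have h1 := hu (e.symm g₀)
    rw [key u] at h1
    have h2 : ‖e u - g₀‖ ^ 2 = 0 :=
      le_antisymm (by linarith [hBp (e u - g₀)]) (sq_nonneg _)
    have h3 : e u = g₀ := sub_eq_zero.mp (norm_eq_zero.mp (pow_eq_zero_iff two_ne_zero |>.mp h2))
    rw [← h3, e.symm_apply_apply]

/-- Limits along a dense range under an a priori estimate. -/
lemma exists_tendsto_of_denseRange {M E F : Type*} [AddCommGroup M] [Module ℝ M]
    [NormedAddCommGroup E] [NormedSpace ℝ E] [NormedAddCommGroup F] [NormedSpace ℝ F]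
    [CompleteSpace F] (Z : M →ₗ[ℝ] E) (hZ : DenseRange Z) (Φ : M →ₗ[ℝ] F) {C : ℝ}
    (hC : ∀ x, ‖Φ x‖ ≤ C * ‖Z x‖) (g : E) :
    ∃ (x : ℕ → M) (y : F), Filter.Tendsto (fun n => Z (x n)) Filter.atTop (nhds g) ∧
      Filter.Tendsto (fun n => Φ (x n)) Filter.atTop (nhds y) ∧ ‖y‖ ≤ C * ‖g‖ := by
  obtain ⟨s, hs, hsg⟩ := mem_closure_iff_seq_limit.mp (hZ g)
  choose x hx using hs
  have hZx : Filter.Tendsto (fun n => Z (x n)) Filter.atTop (nhds g) := by simpa only [hx] using hsg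
  have hcau : CauchySeq fun n => Φ (x n) := by
    rw [Metric.cauchySeq_iff']
    intro ε hε
    obtain ⟨N, hN⟩ := Metric.cauchySeq_iff'.mp hZx.cauchySeq (ε / (|C| + 1)) (by positivity)
    refine ⟨N, fun n hn => ?_⟩
    have h1 := hN n hn
    rw [dist_eq_norm, ← map_sub, lt_div_iff₀ (by positivity)] at h1
    rw [dist_eq_norm, ← map_sub]
    refine (hC _).trans_lt (lt_of_le_of_lt ?_ h1)
    rw [mul_comm]
    exact mul_le_mul_of_nonneg_left ((le_abs_self C).trans (by linarith)) (norm_nonneg _)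
  obtain ⟨y, hy⟩ := cauchySeq_tendsto_of_complete hcau
  exact ⟨x, y, hZx, hy, le_of_tendsto_of_tendsto' hy.norm (hZx.norm.const_mul C) fun n => hC _⟩

/-! ### The Riesz derivative on test functions -/

lemma IsTest.add {a b : ℝ} {φ ψ : ℝ → ℝ} (hφ : IsTest a b φ) (hψ : IsTest a b ψ) :
    IsTest a b (φ + ψ) where
  contDiff := hφ.contDiff.add hψ.contDiff
  hasCompactSupport := hφ.hasCompactSupport.add hψ.hasCompactSupport
  tsupport_subset := (tsupport_add φ ψ).trans (union_subset hφ.tsupport_subset hψ.tsupport_subset)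

lemma IsTest.smul {a b : ℝ} {φ : ℝ → ℝ} (c : ℝ) (hφ : IsTest a b φ) : IsTest a b (c • φ) where
  contDiff := contDiff_const.smul hφ.contDiff
  hasCompactSupport := hφ.hasCompactSupport.smul_left (f := fun _ => c)
  tsupport_subset := (tsupport_smul_subset_right (fun _ => c) φ).trans hφ.tsupport_subset

/-- The space of test functions. -/
def testSpace (a b : ℝ) : Submodule ℝ (ℝ → ℝ) where
  carrier := {φ | IsTest a b φ}
  add_mem' := IsTest.add
  zero_mem' := ⟨contDiff_const, HasCompactSupport.zero, by simp [tsupport]⟩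
  smul_mem' := fun c _ hφ => IsTest.smul c hφ

lemma leftIntegral_smul (σ c : ℝ) (φ : ℝ → ℝ) :
    leftIntegral σ (c • φ) = c • leftIntegral σ φ := by
  funext x
  simp only [leftIntegral, Pi.smul_apply, smul_eq_mul, mul_left_comm _ c, integral_const_mul]

lemma rightIntegral_smul (σ c : ℝ) (φ : ℝ → ℝ) :
    rightIntegral σ (c • φ) = c • rightIntegral σ φ := by
  funext x
  simp only [rightIntegral, Pi.smul_apply, smul_eq_mul, mul_left_comm _ c, integral_const_mul]

lemma leftDeriv_smul (α c : ℝ) (φ : ℝ → ℝ) : leftDeriv α (c • φ) = c • leftDeriv α φ := by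
  funext x
  rw [leftDeriv, leftIntegral_smul]
  exact deriv_const_smul_field c _

lemma rightDeriv_smul (α c : ℝ) (φ : ℝ → ℝ) : rightDeriv α (c • φ) = c • rightDeriv α φ := by
  funext x
  rw [rightDeriv, rightIntegral_smul]
  simp [rightDeriv, deriv_const_smul_field c]

lemma IsTest.leftDeriv_add {a b : ℝ} (h1 : α < 1) {φ ψ : ℝ → ℝ} (hφ : IsTest a b φ)
    (hψ : IsTest a b ψ) : leftDeriv α (φ + ψ) = leftDeriv α φ + leftDeriv α ψ := by
  funext x
  have hs := hφ.add hψ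
  rw [Pi.add_apply, leftDeriv_eq h1 hs.contDiff hs.hasCompactSupport,
    leftDeriv_eq h1 hφ.contDiff hφ.hasCompactSupport,
    leftDeriv_eq h1 hψ.contDiff hψ.hasCompactSupport, ← mul_add, leftPot, leftPot, leftPot,
    ← integral_add (integrable_leftKernel_mul h1 hφ.isTest_deriv.contDiff.continuous
      hφ.isTest_deriv.hasCompactSupport x) (integrable_leftKernel_mul h1
      hψ.isTest_deriv.contDiff.continuous hψ.isTest_deriv.hasCompactSupport x)]
  congr 2 with y
  have : deriv (φ + ψ) y = deriv φ y + deriv ψ y :=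
    deriv_add ((hφ.contDiff.differentiable (by simp)) y) ((hψ.contDiff.differentiable (by simp)) y)
  rw [this, mul_add]

lemma IsTest.rightDeriv_add {a b : ℝ} (h1 : α < 1) {φ ψ : ℝ → ℝ} (hφ : IsTest a b φ)
    (hψ : IsTest a b ψ) : rightDeriv α (φ + ψ) = rightDeriv α φ + rightDeriv α ψ := by
  funext x
  rw [Pi.add_apply, rightDeriv_eq_leftDeriv, rightDeriv_eq_leftDeriv α φ,
    rightDeriv_eq_leftDeriv α ψ]
  have := IsTest.leftDeriv_add h1 hφ.comp_neg hψ.comp_neg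
  exact congrFun this (-x)

lemma memLp_of_continuous (a b : ℝ) {f : ℝ → ℝ} (hf : Continuous f) : MemLp f 2 (vol a b) := by
  refine (memLp_two_iff_integrable_sq hf.aestronglyMeasurable).mpr ?_
  exact ((hf.pow 2).continuousOn.integrableOn_compact
    (isCompact_Icc (a := a) (b := b))).mono_set Ioo_subset_Icc_self

/-- The left derivative of test functions, with values in `L²`. -/
def leftMap (a b : ℝ) (h1 : α < 1) : testSpace a b →ₗ[ℝ] Lp ℝ 2 (vol a b) where
  toFun φ := (memLp_of_continuous a b (IsTest.continuous_leftDeriv h1 φ.2)).toLp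
  map_add' φ ψ := by
    rw [← MemLp.toLp_add]
    congr 1
    exact IsTest.leftDeriv_add h1 φ.2 ψ.2
  map_smul' c φ := by
    rw [RingHom.id_apply, ← MemLp.toLp_const_smul]
    congr 1
    exact leftDeriv_smul α c φ

/-- The right derivative of test functions, with values in `L²`. -/
def rightMap (a b : ℝ) (h1 : α < 1) : testSpace a b →ₗ[ℝ] Lp ℝ 2 (vol a b) where
  toFun φ := (memLp_of_continuous a b (IsTest.continuous_rightDeriv h1 φ.2)).toLp
  map_add' φ ψ := by
    rw [← MemLp.toLp_add]
    congr 1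
    exact IsTest.rightDeriv_add h1 φ.2 ψ.2
  map_smul' c φ := by
    rw [RingHom.id_apply, ← MemLp.toLp_const_smul]
    congr 1
    exact rightDeriv_smul α c φ

/-- The Riesz derivative of test functions, with values in `L²`. -/
def rieszMap (a b : ℝ) (h1 : α < 1) : testSpace a b →ₗ[ℝ] Lp ℝ 2 (vol a b) :=
  (1 / 2 : ℝ) • (leftMap a b h1 + rightMap a b h1)

/-- Test functions as bounded continuous functions. -/
def testToBCF (a b : ℝ) : testSpace a b →ₗ[ℝ] BoundedContinuousFunction ℝ ℝ where
  toFun φ := BoundedContinuousFunction.ofNormedAddCommGroup φ φ.2.contDiff.continuous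
    (φ.2.hasCompactSupport.exists_bound_of_continuous φ.2.contDiff.continuous).choose
    (φ.2.hasCompactSupport.exists_bound_of_continuous φ.2.contDiff.continuous).choose_spec
  map_add' φ ψ := by
    ext x
    simp
  map_smul' c φ := by
    ext x
    simp

lemma norm_toLp_sq {a b : ℝ} {f : ℝ → ℝ} (hf : MemLp f 2 (vol a b)) :
    ‖hf.toLp‖ ^ 2 = ∫ x in Ioo a b, f x ^ 2 := by
  rw [← real_inner_self_eq_norm_sq, L2.inner_def]
  refine integral_congr_ae ?_
  filter_upwards [hf.coeFn_toLp] with x hx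
  rw [hx, real_inner_self_eq_norm_sq, Real.norm_eq_abs, sq_abs]

lemma inner_toLp {a b : ℝ} {f : ℝ → ℝ} (hf : MemLp f 2 (vol a b)) (g : Lp ℝ 2 (vol a b)) :
    inner ℝ hf.toLp g = ∫ x in Ioo a b, g x * f x := by
  rw [L2.inner_def]
  refine integral_congr_ae ?_
  filter_upwards [hf.coeFn_toLp] with x hx
  rw [hx]
  simp

lemma rieszMap_eq (a b : ℝ) (h1 : α < 1) (φ : testSpace a b) :
    rieszMap a b h1 φ = (memLp_of_continuous a b
      (((IsTest.continuous_leftDeriv h1 φ.2).add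
        (IsTest.continuous_rightDeriv h1 φ.2)).const_smul (1 / 2 : ℝ))).toLp := by
  rfl

lemma IsTest.leftDeriv_add_rightDeriv {a b : ℝ} (h1 : α < 1) {φ : ℝ → ℝ} (hφ : IsTest a b φ)
    (x : ℝ) : leftDeriv α φ x + rightDeriv α φ x =
      (Real.Gamma (1 - α))⁻¹ * (leftPot α (deriv φ) x - rightPot α (deriv φ) x) := by
  rw [leftDeriv_eq h1 hφ.contDiff hφ.hasCompactSupport,
    rightDeriv_eq h1 hφ.contDiff hφ.hasCompactSupport]
  ring

/-- Orthogonality to the Riesz derivatives of all test functions implies vanishing. -/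
lemma ae_eq_zero_of_integral_deriv_eq_zero (hα : 1 / 2 < α) (h1 : α < 1) {a b : ℝ} (hab : a < b)
    {h : ℝ → ℝ} (hh : MemLp h 2 (vol a b))
    (horth : ∀ φ, IsTest a b φ →
      ∫ x in Ioo a b, h x * (leftDeriv α φ x + rightDeriv α φ x) = 0) : h =ᵐ[vol a b] 0 := by
  refine ae_eq_zero_of_integral_pot_eq_zero hα h1 hab hh fun φ hφ => ?_
  have h2 := horth φ hφ
  simp only [hφ.leftDeriv_add_rightDeriv h1, mul_left_comm (h _)] at h2
  rw [integral_const_mul] at h2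
  exact (mul_eq_zero.mp h2).resolve_left
    (inv_pos.mpr (Real.Gamma_pos_of_pos (by linarith))).ne'

lemma denseRange_rieszMap (hα : 1 / 2 < α) (h1 : α < 1) {a b : ℝ} (hab : a < b) :
    DenseRange (rieszMap a b h1) := by
  have h : (LinearMap.range (rieszMap a b h1))ᗮ = ⊥ := by
    rw [Submodule.eq_bot_iff]
    intro h hh
    rw [Submodule.mem_orthogonal] at hh
    rw [Lp.eq_zero_iff_ae_eq_zero]
    refine ae_eq_zero_of_integral_deriv_eq_zero hα h1 hab (Lp.memLp h) fun φ hφ => ?_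
    have h2 := hh _ ⟨⟨φ, hφ⟩, rfl⟩
    rw [rieszMap_eq, inner_toLp] at h2
    simp only [Pi.smul_apply, Pi.add_apply, smul_eq_mul, mul_left_comm (h _)] at h2
    rw [integral_const_mul] at h2
    linarith
  have h2 := (LinearMap.range (rieszMap a b h1)).topologicalClosure_eq_top_iff.mpr h
  rw [DenseRange, dense_iff_closure_eq]
  have h3 := congrArg (fun S : Submodule ℝ (Lp ℝ 2 (vol a b)) => (S : Set (Lp ℝ 2 (vol a b)))) h2
  rwa [Submodule.topologicalClosure_coe, LinearMap.coe_range] at h3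

/-- All a priori estimates combined: the left-hand side is the largest of the norms of the two
one-sided derivatives and the sup norm. -/
lemma exists_norm_le (hα : 1 / 2 < α) (h1 : α < 1) {a b : ℝ} (hab : a < b) :
    ∃ C : ℝ, ∀ φ : testSpace a b,
      ‖((leftMap a b h1).prod ((rightMap a b h1).prod (testToBCF a b))) φ‖ ≤
        C * ‖rieszMap a b h1 φ‖ := by
  obtain ⟨C₁, hC₁, H₁⟩ := exists_integral_leftPot_deriv_sq_le hα h1 hab
  obtain ⟨C₂, hC₂, H₂⟩ := exists_integral_sq_le hα h1 hab
  obtain ⟨C₃, hC₃, H₃⟩ := exists_sq_le hα h1 a b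
  obtain ⟨γ, hγ⟩ : ∃ γ, γ = (Real.Gamma (1 - α))⁻¹ := ⟨_, rfl⟩
  have hγ0 : 0 < γ := hγ ▸ inv_pos.mpr (Real.Gamma_pos_of_pos (by linarith))
  -- `C₂` eliminates the term of order zero from the first estimate; `4 / γ²` undoes the
  -- normalization of the Riesz derivative as `γ / 2` times the difference of the potentials.
  obtain ⟨D, hD⟩ : ∃ D, D = C₁ * (1 + C₂) * (4 / γ ^ 2) := ⟨_, rfl⟩
  have hD0 : 0 ≤ D := by rw [hD]; positivity
  have hZ : ∀ φ : testSpace a b, ∫ x, leftPot α (deriv φ) x ^ 2 ≤ D * ‖rieszMap a b h1 φ‖ ^ 2 :=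
    fun φ => by
      have e : ‖rieszMap a b h1 φ‖ ^ 2 = γ ^ 2 / 4 *
          ∫ x in Ioo a b, (leftPot α (deriv φ) x - rightPot α (deriv φ) x) ^ 2 := by
        rw [rieszMap_eq, norm_toLp_sq, ← integral_const_mul]
        congr 1 with x
        simp only [Pi.smul_apply, Pi.add_apply, smul_eq_mul]
        rw [IsTest.leftDeriv_add_rightDeriv h1 φ.2, ← hγ]
        ring
      have e2 : D * ‖rieszMap a b h1 φ‖ ^ 2 = C₁ * (1 + C₂) *
          ∫ x in Ioo a b, (leftPot α (deriv φ) x - rightPot α (deriv φ) x) ^ 2 := by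
        rw [e, hD]
        field_simp
      rw [e2, mul_assoc]
      refine (H₁ φ φ.2).trans (mul_le_mul_of_nonneg_left ?_ hC₁)
      linarith [H₂ φ φ.2]
  refine ⟨√(γ ^ 2 * D) + √(C₃ * D), fun φ => ?_⟩
  have hφd := IsTest.isTest_deriv φ.2
  obtain ⟨i1, e1⟩ := integral_leftPot_sq hα h1 hφd.contDiff.continuous hφd.hasCompactSupport
  obtain ⟨i2, e2⟩ := integral_rightPot_sq hα h1 hφd.contDiff.continuous hφd.hasCompactSupport
  have b1 : ‖leftMap a b h1 φ‖ ^ 2 ≤ γ ^ 2 * D * ‖rieszMap a b h1 φ‖ ^ 2 := by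
    have e : ‖leftMap a b h1 φ‖ ^ 2 = γ ^ 2 * ∫ x in Ioo a b, leftPot α (deriv φ) x ^ 2 := by
      refine (norm_toLp_sq (memLp_of_continuous a b (IsTest.continuous_leftDeriv h1 φ.2))).trans ?_
      simp only [leftDeriv_eq h1 φ.2.contDiff φ.2.hasCompactSupport, mul_pow, ← hγ]
      rw [integral_const_mul]
    rw [e, mul_assoc]
    refine mul_le_mul_of_nonneg_left ?_ (sq_nonneg _)
    exact (setIntegral_le_integral i1 (Filter.Eventually.of_forall fun x => sq_nonneg _)).trans
      (hZ φ)
  have b2 : ‖rightMap a b h1 φ‖ ^ 2 ≤ γ ^ 2 * D * ‖rieszMap a b h1 φ‖ ^ 2 := by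
    have e : ‖rightMap a b h1 φ‖ ^ 2 = γ ^ 2 * ∫ x in Ioo a b, rightPot α (deriv φ) x ^ 2 := by
      refine (norm_toLp_sq (memLp_of_continuous a b (IsTest.continuous_rightDeriv h1 φ.2))).trans ?_
      simp only [rightDeriv_eq h1 φ.2.contDiff φ.2.hasCompactSupport, neg_sq, mul_pow, ← hγ]
      rw [integral_const_mul]
    rw [e, mul_assoc]
    refine mul_le_mul_of_nonneg_left ?_ (sq_nonneg _)
    refine (setIntegral_le_integral i2 (Filter.Eventually.of_forall fun x => sq_nonneg _)).trans ?_
    rw [e2, ← e1]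
    exact hZ φ
  have hroot : ∀ {t K : ℝ}, 0 ≤ K → t ^ 2 ≤ K * ‖rieszMap a b h1 φ‖ ^ 2 →
      t ≤ √K * ‖rieszMap a b h1 φ‖ := fun {t K} hK ht => by
    have := Real.le_sqrt_of_sq_le ht
    rwa [Real.sqrt_mul hK, Real.sqrt_sq (norm_nonneg _)] at this
  have c1 := hroot (by positivity) b1
  have c2 := hroot (by positivity) b2
  have c3 : ‖testToBCF a b φ‖ ≤ √(C₃ * D) * ‖rieszMap a b h1 φ‖ := by
    refine (BoundedContinuousFunction.norm_le (by positivity)).mpr fun x => ?_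
    refine hroot (by positivity) ?_
    rw [Real.norm_eq_abs, sq_abs, mul_assoc]
    exact (H₃ φ φ.2 x).trans (mul_le_mul_of_nonneg_left (hZ φ) hC₃)
  have p1 : 0 ≤ √(γ ^ 2 * D) * ‖rieszMap a b h1 φ‖ := by positivity
  have p2 : 0 ≤ √(C₃ * D) * ‖rieszMap a b h1 φ‖ := by positivity
  rw [add_mul]
  refine max_le ?_ (max_le ?_ ?_)
  · exact c1.trans (by linarith)
  · exact c2.trans (by linarith)
  · exact c3.trans (by linarith)

/-- Every function in `L²` is the Riesz derivative of a function with zero traces. -/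
lemma exists_isRieszDeriv (hα : 1 / 2 < α) (h1 : α < 1) {a b : ℝ} (hab : a < b) :
    ∃ C : ℝ, ∀ g : Lp ℝ 2 (vol a b), ∃ u ∈ rieszHZero α a b h1,
      IsRieszDeriv α a b u g ∧ ‖u‖ ≤ C * ‖g‖ := by
  obtain ⟨C, hC⟩ := exists_norm_le hα h1 hab
  let J := BoundedContinuousFunction.toLp (E := ℝ) 2 (vol a b) ℝ
  refine ⟨‖J‖ * C, fun g => ?_⟩
  -- The test functions `φ n` have Riesz derivatives tending to `g`; by the estimate their left and
  -- right derivatives converge in `L²` to `v` and `w`, and they converge uniformly to `U`.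
  obtain ⟨φ, ⟨v, w, U⟩, hg, hy, hle⟩ :=
    exists_tendsto_of_denseRange _ (denseRange_rieszMap hα h1 hab) _ hC g
  have hv : Filter.Tendsto (fun n => leftMap a b h1 (φ n)) Filter.atTop (nhds v) :=
    (continuous_fst.tendsto _).comp hy
  have hw : Filter.Tendsto (fun n => rightMap a b h1 (φ n)) Filter.atTop (nhds w) :=
    ((continuous_fst.comp continuous_snd).tendsto _).comp hy
  have hU : Filter.Tendsto (fun n => testToBCF a b (φ n)) Filter.atTop (nhds U) :=
    ((continuous_snd.comp continuous_snd).tendsto _).comp hy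
  have hu : Filter.Tendsto (fun n => J (testToBCF a b (φ n))) Filter.atTop (nhds (J U)) :=
    (J.continuous.tendsto _).comp hU
  have hpt : ∀ x, Filter.Tendsto (fun n => (φ n : ℝ → ℝ) x) Filter.atTop (nhds (U x)) := fun x =>
    ((BoundedContinuousFunction.lipschitz_eval_const x).continuous.tendsto U).comp hU
  have hU0 : ∀ x, x ∉ Ioo a b → U x = 0 := fun x hx =>
    tendsto_nhds_unique (hpt x) (by
      have : ∀ n, (φ n : ℝ → ℝ) x = 0 := fun n => IsTest.eq_zero (φ n).2 hx
      simp only [this]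
      exact tendsto_const_nhds)
  have hlim : ∀ {s : ℕ → Lp ℝ 2 (vol a b)} {l : Lp ℝ 2 (vol a b)} {ψ : ℝ → ℝ}, Continuous ψ →
      Filter.Tendsto s Filter.atTop (nhds l) →
      Filter.Tendsto (fun n => ∫ x in Ioo a b, s n x * ψ x) Filter.atTop
        (nhds (∫ x in Ioo a b, l x * ψ x)) := fun {s l ψ} hψ hs => by
    have h2 := (tendsto_const_nhds (x := (memLp_of_continuous a b hψ).toLp)).inner hs (𝕜 := ℝ)
    simpa only [inner_toLp] using h2
  have hJφ : ∀ n, J (testToBCF a b (φ n)) =ᵐ[vol a b] (φ n : ℝ → ℝ) := fun n =>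
    BoundedContinuousFunction.coeFn_toLp 2 (vol a b) ℝ (testToBCF a b (φ n))
  have hLφ : ∀ n, leftMap a b h1 (φ n) =ᵐ[vol a b] leftDeriv α (φ n) := fun n =>
    MemLp.coeFn_toLp (memLp_of_continuous a b (IsTest.continuous_leftDeriv h1 (φ n).2))
  have hRφ : ∀ n, rightMap a b h1 (φ n) =ᵐ[vol a b] rightDeriv α (φ n) := fun n =>
    MemLp.coeFn_toLp (memLp_of_continuous a b (IsTest.continuous_rightDeriv h1 (φ n).2))
  have hJU : J U =ᵐ[vol a b] U := BoundedContinuousFunction.coeFn_toLp 2 (vol a b) ℝ U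
  have hout : ∀ {ψ χ : ℝ → ℝ}, (∀ x, x ∉ Ioo a b → ψ x = 0) →
      ∫ x in Ioo a b, χ x * ψ x = ∫ x, χ x * ψ x := fun {ψ χ} hψ =>
    setIntegral_eq_integral_of_forall_compl_eq_zero fun x hx => by rw [hψ x hx, mul_zero]
  have hcongr : ∀ {s t ψ : ℝ → ℝ}, s =ᵐ[vol a b] t →
      ∫ x in Ioo a b, s x * ψ x = ∫ x in Ioo a b, t x * ψ x := fun {s t ψ} hst =>
    integral_congr_ae (hst.mono fun x hx => by simp only [hx])
  have hloc : ∀ s : Lp ℝ 2 (vol a b), LocallyIntegrableOn s (Ioo a b) := fun s => by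
    have : IntegrableOn s (Ioo a b) := (Lp.memLp s).integrable (by norm_num)
    exact this.locallyIntegrableOn
  have hint : Integrable (J U) (vol a b) := (Lp.memLp (J U)).integrable (by norm_num)
  -- Both sides of the identity are limits of pairings for `φ n`, which agree by fractional
  -- integration by parts.
  have hL : IsWeakLeftDeriv α a b (J U) v := ⟨hint, hloc v, fun ψ hψ => by
    refine tendsto_nhds_unique (hlim hψ.contDiff.continuous hv) ?_
    refine (hlim (hψ.continuous_rightDeriv h1) hu).congr fun n => ?_
    have hφ := (φ n).2
    rw [hcongr (hJφ n), hcongr (hLφ n), hout fun x hx => hψ.eq_zero hx,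
      integral_leftDeriv_mul h1 hφ.contDiff hφ.hasCompactSupport hψ.contDiff
        hψ.hasCompactSupport]
    simp only [mul_comm ((φ n : ℝ → ℝ) _)]
    exact hout fun x hx => IsTest.eq_zero hφ hx⟩
  have hR : IsWeakRightDeriv α a b (J U) w := ⟨hint, hloc w, fun ψ hψ => by
    refine tendsto_nhds_unique (hlim hψ.contDiff.continuous hw) ?_
    refine (hlim (hψ.continuous_leftDeriv h1) hu).congr fun n => ?_
    have hφ := (φ n).2
    rw [hcongr (hJφ n), hcongr (hRφ n), hout fun x hx => hψ.eq_zero hx]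
    simp only [mul_comm (rightDeriv α (φ n : ℝ → ℝ) _)]
    rw [← integral_leftDeriv_mul h1 hψ.contDiff hψ.hasCompactSupport hφ.contDiff
        hφ.hasCompactSupport]
    simp only [mul_comm ((φ n : ℝ → ℝ) _)]
    exact hout fun x hx => IsTest.eq_zero hφ hx⟩
  have hgvw : g = (1 / 2 : ℝ) • (v + w) := tendsto_nhds_unique hg ((hv.add hw).const_smul _)
  have hD : IsRieszDeriv α a b (J U) g := by
    refine ⟨v, w, hL, hR, ?_⟩
    rw [hgvw]
    filter_upwards [Lp.coeFn_smul (1 / 2 : ℝ) (v + w), Lp.coeFn_add v w] with x e1 e2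
    rw [e1, Pi.smul_apply, e2, Pi.add_apply, smul_eq_mul]
    ring
  -- The same representative `U`, continuous on `ℝ` and zero outside `(a, b)`, serves for both
  -- traces.
  refine ⟨J U, ⟨⟨⟨g, hD, Lp.memLp g⟩, ⟨U, U.continuous.continuousOn, hJU, hU0 b (by simp)⟩⟩,
    ⟨U, U.continuous.continuousOn, hJU, hU0 a (by simp)⟩⟩, hD, ?_⟩
  rw [mul_assoc]
  refine (J.le_opNorm U).trans (mul_le_mul_of_nonneg_left ?_ (norm_nonneg _))
  exact ((le_max_right _ _).trans (le_max_right _ _)).trans hle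

/-- Adding the two weak identities shows that `u` is orthogonal to the Riesz derivatives of all test
functions, so density applies. No boundary condition enters. -/
lemma IsRieszDeriv.ae_eq_zero (hα : 1 / 2 < α) (h1 : α < 1) {a b : ℝ} (hab : a < b)
    {u g : ℝ → ℝ} (hu : MemLp u 2 (vol a b)) (h : IsRieszDeriv α a b u g)
    (hg : g =ᵐ[vol a b] 0) : u =ᵐ[vol a b] 0 := by
  obtain ⟨v, w, hv, hw, hgvw⟩ := h
  refine ae_eq_zero_of_integral_deriv_eq_zero hα h1 hab hu fun φ hφ => ?_
  simp only [mul_add]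
  rw [integral_add (integrable_mul_continuous hv.integrable (hφ.continuous_leftDeriv h1))
    (integrable_mul_continuous hv.integrable (hφ.continuous_rightDeriv h1)),
    ← hv.integral_eq φ hφ, ← hw.integral_eq φ hφ,
    ← integral_add (integrable_mul_test hw.locallyIntegrable hφ)
      (integrable_mul_test hv.locallyIntegrable hφ)]
  refine integral_eq_zero_of_ae ?_
  filter_upwards [hg, hgvw] with x e1 e2
  rw [e1] at e2
  simp only [Pi.zero_apply] at e2 ⊢
  rw [← add_mul, show w x + v x = 0 by linarith, zero_mul]

/-! ### The Riesz derivative as a bijection onto `L²`. -/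

lemma isRieszDeriv_of_mem {a b : ℝ} {h1 : α < 1} (u : rieszHZero α a b h1) :
    IsRieszDeriv α a b (u : Lp ℝ 2 (vol a b)) (rieszDeriv α a b (u : Lp ℝ 2 (vol a b))) :=
  let ⟨_, hg, _⟩ := u.2.1.1
  isRieszDeriv_rieszDeriv hg

lemma memLp_rieszDeriv {a b : ℝ} {h1 : α < 1} (u : rieszHZero α a b h1) :
    MemLp (rieszDeriv α a b (u : Lp ℝ 2 (vol a b))) 2 (vol a b) :=
  let ⟨_, hg, hgm⟩ := u.2.1.1
  hgm.ae_eq (hg.ae_eq (isRieszDeriv_rieszDeriv hg))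

/-- The Riesz derivative on the zero-trace space, with values in `L²`. -/
def rieszLin (a b : ℝ) (h1 : α < 1) : rieszHZero α a b h1 →ₗ[ℝ] Lp ℝ 2 (vol a b) where
  toFun u := (memLp_rieszDeriv u).toLp
  map_add' u u' := by
    rw [← MemLp.toLp_add, MemLp.toLp_eq_toLp_iff]
    exact (isRieszDeriv_of_mem (u + u')).ae_eq
      (((isRieszDeriv_of_mem u).add h1 (isRieszDeriv_of_mem u')).congr (Lp.coeFn_add _ _).symm)
  map_smul' c u := by
    rw [RingHom.id_apply, ← MemLp.toLp_const_smul, MemLp.toLp_eq_toLp_iff]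
    exact (isRieszDeriv_of_mem (c • u)).ae_eq
      (((isRieszDeriv_of_mem u).smul c).congr (Lp.coeFn_smul _ _).symm)

lemma bijective_rieszLin (hα : 1 / 2 < α) (h1 : α < 1) {a b : ℝ} (hab : a < b) :
    Function.Bijective (rieszLin a b h1) := by
  constructor
  · rw [← LinearMap.ker_eq_bot, LinearMap.ker_eq_bot']
    intro u hu
    have h0 : rieszDeriv α a b (u : Lp ℝ 2 (vol a b)) =ᵐ[vol a b] 0 := by
      have := (memLp_rieszDeriv u).coeFn_toLp
      rw [show (memLp_rieszDeriv u).toLp = 0 from hu] at this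
      exact this.symm.trans (Lp.coeFn_zero ℝ 2 (vol a b))
    refine Subtype.ext ?_
    exact (Lp.eq_zero_iff_ae_eq_zero).mpr
      ((isRieszDeriv_of_mem u).ae_eq_zero hα h1 hab (Lp.memLp _) h0)
  · intro g
    obtain ⟨C, hC⟩ := exists_isRieszDeriv hα h1 hab
    obtain ⟨u, hu, hug, -⟩ := hC g
    refine ⟨⟨u, hu⟩, Lp.ext ?_⟩
    exact (memLp_rieszDeriv ⟨u, hu⟩).coeFn_toLp.trans ((isRieszDeriv_rieszDeriv hug).ae_eq hug)

/-- A Poincaré inequality: by injectivity `u` is the preimage built in `exists_isRieszDeriv`, which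
comes with a norm bound. It makes the norm for `lam = 0` control the full one. -/
lemma exists_norm_le_norm_rieszLin (hα : 1 / 2 < α) (h1 : α < 1) {a b : ℝ} (hab : a < b) :
    ∃ C : ℝ, ∀ u : rieszHZero α a b h1,
      ‖(u : Lp ℝ 2 (vol a b))‖ ≤ C * ‖rieszLin a b h1 u‖ := by
  obtain ⟨C, hC⟩ := exists_isRieszDeriv hα h1 hab
  refine ⟨C, fun u => ?_⟩
  obtain ⟨u', hu', hug, hle⟩ := hC (rieszLin a b h1 u)
  have : u = ⟨u', hu'⟩ := by
    refine (bijective_rieszLin hα h1 hab).1 (Lp.ext ?_)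
    exact (hug.ae_eq (isRieszDeriv_rieszDeriv hug)).trans (memLp_rieszDeriv ⟨u', hu'⟩).coeFn_toLp.symm
  rw [this] at hle ⊢
  exact hle

lemma rieszQuad_eq {a b lam : ℝ} {h1 : α < 1} (u : rieszHZero α a b h1) :
    rieszQuad α a b lam (u : Lp ℝ 2 (vol a b)) =
      ‖rieszLin a b h1 u‖ ^ 2 + lam * ‖(u : Lp ℝ 2 (vol a b))‖ ^ 2 := by
  have hu := Lp.memLp (u : Lp ℝ 2 (vol a b))
  have e1 : ‖rieszLin a b h1 u‖ ^ 2 =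
      ∫ x in Ioo a b, rieszDeriv α a b (u : Lp ℝ 2 (vol a b)) x ^ 2 :=
    norm_toLp_sq (memLp_rieszDeriv u)
  have e2 : ‖(u : Lp ℝ 2 (vol a b))‖ ^ 2 = ∫ x in Ioo a b, (u : Lp ℝ 2 (vol a b)) x ^ 2 := by
    rw [← norm_toLp_sq hu, Lp.toLp_coeFn]
  simp only [rieszQuad, sq_abs]
  rw [integral_add (memLp_rieszDeriv u).integrable_sq (hu.integrable_sq.const_mul lam),
    integral_const_mul, e1, e2]

end RieszFrac

end

theorem mainTheorem9 (a b : ℝ) (hab : a < b) (α : ℝ) (hα : 1 / 2 < α) (h1 : α < 1)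
    (lam : ℝ) (hlam : lam = 0 ∨ lam = 1)
    (f : RieszFrac.rieszHZero α a b h1 →ₗ[ℝ] ℝ)
    (hf : RieszFrac.IsBoundedFunctional α a b lam h1 f) :
    ∃! u : RieszFrac.rieszHZero α a b h1, ∀ v : RieszFrac.rieszHZero α a b h1,
      RieszFrac.rieszEnergy α a b lam h1 f u ≤ RieszFrac.rieszEnergy α a b lam h1 f v := by
  obtain ⟨C, hC⟩ := RieszFrac.exists_norm_le_norm_rieszLin hα h1 hab
  let e := LinearEquiv.ofBijective _ (RieszFrac.bijective_rieszLin hα h1 hab)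
  -- `T` sends a Riesz derivative back to its function; the Poincaré inequality is its continuity.
  -- In the variable `g = e u` the quadratic form is `‖g‖² + lam ‖T g‖²`.
  let T : Lp ℝ 2 (RieszFrac.vol a b) →L[ℝ] Lp ℝ 2 (RieszFrac.vol a b) :=
    LinearMap.mkContinuous ((RieszFrac.rieszHZero α a b h1).subtype ∘ₗ e.symm.toLinearMap) C
      fun g => by
        have := hC (e.symm g)
        rwa [show RieszFrac.rieszLin a b h1 (e.symm g) = g from e.apply_symm_apply g] at this
  refine RieszFrac.existsUnique_minimizer e T (lam := lam) (by rcases hlam with h | h <;> simp [h])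
    _ (fun u => ?_) f hf
  have hT : T (e u) = (u : Lp ℝ 2 (RieszFrac.vol a b)) :=
    congrArg Subtype.val (e.symm_apply_apply u)
  rw [RieszFrac.rieszQuad_eq, hT]
  rfl
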